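/- **Corollary (Soft Boolean model with local interference).** Let $d\ge 1$, $\gamma\in(0,1)$, $\delta>1$, $\beta\in[0,1)$. For $\lambda>0$ let $\mathscr V$ be, under $\mathbb P_\lambda$, a Poisson point process on $\mathbb R^d\times(0,1)$ with intensity $\lambda\,\mathrm{d}x\otimes\mathrm{d}u$. Given $\mathscr V$, each pair of vertices $\mathbf x=(x,u_x)$, $\mathbf y=(y,u_y)$ with $u_x<u_y$ is joined by an edge, independently of all other pairs, with probability $\mathbf p(\mathbf x,\mathbf y,\mathscr V\setminus\{\mathbf x,\mathbf y\})$, where $$\mathbf p(\mathbf x,\mathbf y,\eta)=\mathbf p(\mathbf y,\mathbf x,\eta)=\frac{1\wedge u_x^{-\gamma\delta}|x-y|^{-d\delta}}{1+\sharp\{\mathbf z=(z,u_z)\in\eta:\ |x-z|^d\le u_x^{-\beta}\}},$$ (ties $u_x=u_y$ have probability zero; for given vertices with equal marks either end may be used in the count). Let $B(x,r)$ be the ball of radius $r$ around $x$, $B(r)=B(0,r)$, let $A\leftrightarrow B$ be the event that a path of the graph joins a vertex located in $A$ to one located in $B$, and let $\mathcal G(x,r)$ be the event that $B(x,r)\leftrightarrow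 B(x,2r)^{\mathsf c}$ in the subgraph induced by the vertices located in $B(x,3r)$. We use $\log 0=-\infty$ and $1/\beta=\infty$ for $\beta=0$. (a) *Polynomial mixing.* With $\xi=d(1-1/\beta)<0$, for all $\lambda>0$ and all $x\in\mathbb R^d$ with $|x|\ge 10$, $$\limsup_{r\to\infty}\frac{\log|\operatorname{Cov}_\lambda(\mathbf 1_{\mathcal G(0,r)},\mathbf 1_{\mathcal G(rx,r)})|}{\log r}\le\xi .$$ (b) *The coefficient.* For given $\mathbf x,\mathbf y$ with $x\ne y$ one has $\mathbb E_\lambda[\mathbf p(\mathbf x,\mathbf y,\mathscr V)]=\varphi_\lambda(u_x,u_y,|x-y|^d)$ for a function $\varphi_\lambda$. Put $$\psi_\lambda(\mu)=\limsup_{r\to\infty}\frac{\log\int_{r^{-d+d\mu}}^1\int_{r^{-d+d\mu}}^1\varphi_\lambda(u,v,r^d)\,\mathrm{d}u\,\mathrm{d}v}{d\log r},\qquad \zeta_\lambda=\sup\{\mu<1:\ \mu<2+\psi_\lambda(\mu)\},\qquad \overline\zeta_\lambda=\sup_{0<\lambda'<\lambda}\zeta_{\lambda'} .$$ Let $$Z=\begin{cases}(2-\delta)\vee\dfrac{1-\delta(1-\gamma)-\beta}{\gamma\delta-\beta}&\text{if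 }\gamma\delta>\beta,\\[2mm] 2-\delta&\text{if }\gamma\delta\le\beta.\end{cases}$$ Then, for all $\lambda>0$, $\overline\zeta_\lambda=Z$ if $\gamma\ge\beta$ or $\gamma\delta\le 1+\beta$, while $\overline\zeta_\lambda=2-\frac{1+\beta}{\gamma}$ if $\gamma<\beta$ and $\gamma\delta>1+\beta$. (c) Suppose moreover that $\delta>2$ and $\gamma<(\delta+\beta-1)/\delta$. Then $\overline\zeta_\lambda<0$ for all $\lambda>0$, the critical annulus-crossing intensity $$\widehat\lambda_{\mathsf c}=\inf\Big\{\lambda>0:\ \limsup_{r\to\infty}\mathbb P_\lambda\big(B(r)\leftrightarrow B(2r)^{\mathsf c}\big)>0\Big\}\in[0,\infty]$$ is positive, and for all $0<\lambda<\widehat\lambda_{\mathsf c}$ $$\limsup_{r\to\infty}\frac{\log\mathbb P_\lambda\big(B(r)\leftrightarrow B(2r)^{\mathsf c}\big)}{\log r}\le d\,\Big(Z\vee\big(1-\tfrac1\beta\big)\Big).$$ -/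

import Mathlib

open MeasureTheory ProbabilityTheory Set Filter Topology
open scoped ENNReal NNReal

noncomputable section

namespace SoftBoolean

/-- A marked vertex `(x, u)`: a location in Euclidean `d`-space and a mark (in `(0,1)` almost
surely for the processes considered below). -/
abbrev Vertex (d : ℕ) : Type := EuclideanSpace ℝ (Fin d) × ℝ

/-- The number of points of the family `X 0 ω, X 1 ω, …` in the set `A`, with multiplicity. -/
def count {Ω α : Type*} (X : ℕ → Ω → α) (A : Set α) (ω : Ω) : ℕ∞ :=
  {n : ℕ | X n ω ∈ A}.encard

/-- `X 0, X 1, …` enumerates, under `P`, a Poisson point process with intensity measure `Λ`: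
the number of points in a set of finite intensity is Poisson distributed, and the numbers of points
in finitely many disjoint sets are independent. -/
structure IsPoissonProcess {Ω α : Type*} [MeasurableSpace Ω] [MeasurableSpace α]
    (P : Measure Ω) (Λ : Measure α) (X : ℕ → Ω → α) : Prop where
  measurable : ∀ n, Measurable (X n)
  poisson : ∀ A : Set α, MeasurableSet A → Λ A ≠ ∞ → ∀ k : ℕ,
    P {ω | count X A ω = (k : ℕ∞)} = poissonMeasure (Λ A).toNNReal {k}
  indep : ∀ (m : ℕ) (A : Fin m → Set α), (∀ i, MeasurableSet (A i)) →
    Pairwise (fun i j => Disjoint (A i) (A j)) →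
    iIndepFun (fun (i : Fin m) (ω : Ω) => count X (A i) ω) P

/-- The intensity measure `l · Lebesgue ⊗ Uniform(0,1)` on `ℝ^d × (0,1)`. -/
def intensity (d : ℕ) (l : ℝ) : Measure (Vertex d) :=
  ENNReal.ofReal l • (volume : Measure (EuclideanSpace ℝ (Fin d))).prod
    (volume.restrict (Ioo (0 : ℝ) 1))

/-- The randomness of the graph under `P`: the vertices `X 0, X 1, …` form a Poisson point process
of intensity `l` on `ℝ^d × (0,1)`, and, independently of the vertices, every unordered pair of
vertices carries an independent variable `U` uniform on `[0,1]`, used to draw the edge. -/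
structure IsSample {Ω : Type*} [MeasurableSpace Ω] (d : ℕ) (l : ℝ) (P : Measure Ω)
    (X : ℕ → Ω → Vertex d) (U : Sym2 ℕ → Ω → ℝ) : Prop where
  vertices : IsPoissonProcess P (intensity d l) X
  measurable_unif : ∀ e, Measurable (U e)
  unif : ∀ e, P.map (U e) = volume.restrict (Icc (0 : ℝ) 1)
  indep_unif : iIndepFun U P
  indep : IndepFun (fun ω n => X n ω) (fun ω e => U e ω) P

/-- The number of points of the configuration `η` in the sphere of interference of `x`, the closed
ball of radius `u_x ^ (-β / d)` around the location of `x`. -/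
def interference (d : ℕ) (β : ℝ) (x : Vertex d) (η : Set (Vertex d)) : ℕ∞ :=
  {z : Vertex d | z ∈ η ∧ ‖x.1 - z.1‖ ^ d ≤ x.2 ^ (-β)}.encard

/-- `(1 ∧ u_x ^ (-γδ) |x-y| ^ (-dδ)) / (1 + N^β(x, η))`. -/
def halfProb (d : ℕ) (γ δ β : ℝ) (x y : Vertex d) (η : Set (Vertex d)) : ℝ≥0∞ :=
  ENNReal.ofReal (min 1 (x.2 ^ (-(γ * δ)) * ‖x.1 - y.1‖ ^ (-((d : ℝ) * δ)))) /
    (1 + ((interference d β x η : ℕ∞) : ℝ≥0∞))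

/-- The connection probability of the soft Boolean model with local interference, where `η` is the
configuration of all other vertices: only the interference at the end with smaller mark counts. -/
def connProb (d : ℕ) (γ δ β : ℝ) (x y : Vertex d) (η : Set (Vertex d)) : ℝ≥0∞ :=
  if x.2 < y.2 then halfProb d γ δ β x y η else halfProb d γ δ β y x η

section Model

variable {Ω : Type*} (d : ℕ) (γ δ β : ℝ) (X : ℕ → Ω → Vertex d) (U : Sym2 ℕ → Ω → ℝ)

/-- The vertex set. -/
def config (ω : Ω) : Set (Vertex d) := range fun n => X n ω

/-- The random graph. The vertex `X n` is represented by its index `n`; the vertices `X i` and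
`X j`, `i ≠ j`, are joined if `U {i,j}` is below their connection probability given all other
vertices. (The rule is symmetric unless two marks coincide, which has probability zero.) -/
def graph (ω : Ω) : SimpleGraph ℕ :=
  SimpleGraph.fromRel fun i j =>
    ENNReal.ofReal (U s(i, j) ω) <
      connProb d γ δ β (X i ω) (X j ω) (config d X ω \ {X i ω, X j ω})

/-- The event `B(r) ↔ B(2r)ᶜ`. -/
def crossing (r : ℝ) : Set Ω :=
  {ω | ∃ i j : ℕ, (X i ω).1 ∈ Metric.ball 0 r ∧ (X j ω).1 ∉ Metric.ball 0 (2 * r) ∧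
    (graph d γ δ β X U ω).Reachable i j}

/-- The local annulus-crossing event `B(c,r) ↔ B(c,2r)ᶜ` in the subgraph induced by the vertices
located in `B(c,3r)`. -/
def localCrossing (c : EuclideanSpace ℝ (Fin d)) (r : ℝ) : Set Ω :=
  {ω | ∃ i j : {n : ℕ | (X n ω).1 ∈ Metric.ball c (3 * r)},
    (X i ω).1 ∈ Metric.ball c r ∧ (X j ω).1 ∉ Metric.ball c (2 * r) ∧
    ((graph d γ δ β X U ω).induce {n : ℕ | (X n ω).1 ∈ Metric.ball c (3 * r)}).Reachable i j}

variable [MeasurableSpace Ω]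

/-- The polynomial mixing property with exponent `ξ < 0` under `P`; `log 0 = -∞`, and `ξ = -∞` is
allowed. -/
def PolynomiallyMixing (P : Measure Ω) (ξ : EReal) : Prop :=
  ξ < 0 ∧ ∀ x : EuclideanSpace ℝ (Fin d), 10 ≤ ‖x‖ →
    limsup (fun r : ℝ =>
      ENNReal.log (ENNReal.ofReal
        |cov[(localCrossing d γ δ β X U 0 r).indicator (fun _ => (1 : ℝ)),
          (localCrossing d γ δ β X U (r • x) r).indicator (fun _ => (1 : ℝ)); P]|) /
        ((Real.log r : ℝ) : EReal)) atTop ≤ ξ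

/-- The critical annulus-crossing intensity
`inf {l > 0 : limsup_{r → ∞} P_l (B(r) ↔ B(2r)ᶜ) > 0}`, with `inf ∅ = ∞`. -/
def critIntensity (P : ℝ → Measure Ω) : ℝ≥0∞ :=
  sInf {a : ℝ≥0∞ | ∃ l : ℝ, 0 < l ∧ a = ENNReal.ofReal l ∧
    0 < limsup (fun r : ℝ => P l (crossing d γ δ β X U r)) atTop}

/-- The annealed connection function `φ(u, v, t)` under `P`: the expected connection probability of
two given vertices with marks `u`, `v` whose locations `x`, `y` satisfy `|x - y| ^ d = t`. The
locations used here are the origin and a point on the first coordinate axis. -/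
def annealed [NeZero d] (P : Measure Ω) (u v t : ℝ) : ℝ≥0∞ :=
  ∫⁻ ω, connProb d γ δ β (0, u) (EuclideanSpace.single (0 : Fin d) (t ^ (1 / (d : ℝ))), v)
    (config d X ω) ∂P

/-- `ψ(μ) = limsup_{r → ∞} log (∫_a^1 ∫_a^1 φ(u, v, r^d) du dv) / (d log r)` with
`a = r ^ (-d + dμ)`. -/
def psi [NeZero d] (P : Measure Ω) (μ : ℝ) : EReal :=
  limsup (fun r : ℝ =>
    ENNReal.log (∫⁻ u in Ioo (r ^ (-(d : ℝ) + d * μ)) 1, ∫⁻ v in Ioo (r ^ (-(d : ℝ) + d * μ)) 1,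
      annealed d γ δ β X P u v (r ^ d)) / (((d : ℝ) * Real.log r : ℝ) : EReal)) atTop

/-- `ζ = sup {μ ∈ (-∞, 1) : μ < 2 + ψ(μ)}`. -/
def zeta [NeZero d] (P : Measure Ω) : EReal :=
  sSup ((fun μ : ℝ => (μ : EReal)) '' {μ : ℝ | μ < 1 ∧ (μ : EReal) < 2 + psi d γ δ β X P μ})

/-- `ζ̄_l = sup {ζ_{l'} : 0 < l' < l}`. -/
def zetaBar [NeZero d] (P : ℝ → Measure Ω) (l : ℝ) : EReal :=
  sSup ((fun l' : ℝ => zeta d γ δ β X (P l')) '' Ioo 0 l)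

end Model

/-- The mixing exponent `d (1 - 1/β)`, which is `-∞` for `β = 0`. -/
def mixingExponent (d : ℕ) (β : ℝ) : EReal :=
  if β = 0 then ⊥ else (((d : ℝ) * (1 - 1 / β) : ℝ) : EReal)

/-- `(2 - δ) ∨ (1 - δ (1 - γ) - β) / (γ δ - β)`, where the second term is present only if its
denominator is positive. -/
def longEdgeExponent (γ δ β : ℝ) : ℝ :=
  if β < γ * δ then max (2 - δ) ((1 - δ * (1 - γ) - β) / (γ * δ - β)) else 2 - δ

end SoftBoolean

end

/-! Mixing. A vertex with mark `u` feels interference only up to distance `u ^ (-β / d)`. If no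
vertex in `B(c,3r)` has a mark below `r ^ (-d / β)`, the local crossing event is determined by the
vertices in `B(c,4r)` and the edge variables between them. Let the local event be the version in
which only points of that window interfere. Local events of disjoint windows are exactly
independent: a Poisson process is independent over disjoint windows, and given the vertices the two
events use disjoint sets of edge variables. The covariance is therefore at most a constant times `r
^ d * r ^ (-d / β)`, and it vanishes for `β = 0` (`IsSample.abs_cov_le`).

Coefficient. If `N` is Poisson with mean `m`, then `E[1/(1+N)] = (1 - exp(-m))/m`. Here the mean is
proportional to `w ^ (-β)`, where `w` is the smaller mark, so the annealed connection function is of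
order `w ^ β * min 1 (w ^ (-γδ) * t ^ (-δ))`. With `t = R = r ^ d`, marks of order `R ^ (-k)` with
`k ≤ 1/γ` contribute `R ^ (-δ + k (γδ - β - 1))` to the double integral, and the cutoff requires `k
≤ 1 - μ`. Hence `ψ(μ) = -δ + min (1 - μ) (1/γ) * max (γδ - β - 1) 0` (upper bound `psi_le`, lower
bound `le_psi` for `k` short of `1 - μ`). Solving `μ = 2 + ψ(μ)` gives the stated values; the
intensity enters only through constants.

Decay. The expected number of long edges is bounded dyadically in mark and length. Vertices with
marks near `t` are grouped into cubes slightly smaller than their sphere of interference; all points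
of the cube with other marks interfere, and their number is independent of both endpoints
(`IsSample.measure_halfEdge_le`). For every admissible `μ` this bounds the probability of a long
edge at scale `r` by a multiple of `r ^ (dμ)`. A crossing at scale `11 r` without long edges forces
two crossings at scale `r` around centres at distance at least `8 r`. So the probability `g` of the
local event satisfies `g(11 r) ≤ A g(r)^2 + l C r ^ (dμ)` (`exists_localEvent_recursion`). For small
intensity, `g` stays small at all scales; below the critical intensity, the crossing probability
tends to zero. In both cases the recursion becomes a linear contraction and yields decay of order `r
^ (dμ)`. Letting `μ` decrease to `Z ∨ (1 - 1/β)` finishes the proof. -/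

set_option linter.unusedSectionVars false

noncomputable section

namespace SoftBoolean

/-! ### Poisson counts: moments, inverse moments and independence. -/

section Poisson

variable {Ω α : Type*} [MeasurableSpace Ω] [MeasurableSpace α]

theorem measurable_encard_setOf {p : ℕ → Ω → Prop} (hp : ∀ n, MeasurableSet {ω | p n ω}) :
    Measurable fun ω => {n : ℕ | p n ω}.encard := by
  classical
  have h1 : Measurable fun ω => ((({n : ℕ | p n ω}.encard : ℕ∞)) : ℝ≥0∞) := by
    have : (fun ω => ((({n : ℕ | p n ω}.encard : ℕ∞)) : ℝ≥0∞)) =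
        fun ω => ∑' n, {ω | p n ω}.indicator (fun _ => (1 : ℝ≥0∞)) ω := by
      funext ω
      rw [← ENNReal.tsum_set_one, tsum_subtype _ (fun _ => (1 : ℝ≥0∞))]
      rfl
    rw [this]
    exact Measurable.tsum fun n => measurable_const.indicator (hp n)
  refine measurable_to_countable' fun k => ?_
  have : (fun ω => {n : ℕ | p n ω}.encard) ⁻¹' {k} =
      (fun ω => ((({n : ℕ | p n ω}.encard : ℕ∞)) : ℝ≥0∞)) ⁻¹' {(k : ℝ≥0∞)} := by
    ext ω; simp
  rw [this]
  exact h1 (measurableSet_singleton _)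

variable {P : Measure Ω} {Λ : Measure α} {X : ℕ → Ω → α}

theorem measurable_count (hX : ∀ n, Measurable (X n)) {A : Set α} (hA : MeasurableSet A) :
    Measurable (count X A) :=
  measurable_encard_setOf fun n => hX n hA

theorem count_union {A B : Set α} (h : Disjoint A B) (ω : Ω) :
    count X (A ∪ B) ω = count X A ω + count X B ω := by
  rw [count, count, count, ← encard_union_eq]
  · rfl
  · rw [disjoint_left] at h ⊢
    exact fun n hA hB => h hA hB

theorem coe_count_eq_tsum (A : Set α) (ω : Ω) :
    ((count X A ω : ℕ∞) : ℝ≥0∞) = ∑' n, (X n ⁻¹' A).indicator (fun _ => (1 : ℝ≥0∞)) ω := by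
  rw [count, ← ENNReal.tsum_set_one, tsum_subtype _ (fun _ => (1 : ℝ≥0∞))]
  rfl

namespace IsPoissonProcess

theorem isProbabilityMeasure (h : IsPoissonProcess P Λ X) : IsProbabilityMeasure P := by
  constructor
  have := h.poisson ∅ MeasurableSet.empty (by simp) 0
  simpa [count, poissonMeasure_singleton] using this

theorem map_count (h : IsPoissonProcess P Λ X) {A : Set α} (hA : MeasurableSet A)
    (hfin : Λ A ≠ ∞) :
    P.map (count X A) = (poissonMeasure (Λ A).toNNReal).map (Nat.cast : ℕ → ℕ∞) := by
  have := h.isProbabilityMeasure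
  have hm := measurable_count h.measurable hA
  have := Measure.isProbabilityMeasure_map (μ := P) hm.aemeasurable
  have hc : Measurable (Nat.cast : ℕ → ℕ∞) := measurable_from_top
  have := Measure.isProbabilityMeasure_map (μ := poissonMeasure (Λ A).toNNReal) hc.aemeasurable
  have hk : ∀ k : ℕ, P.map (count X A) {(k : ℕ∞)} =
      (poissonMeasure (Λ A).toNNReal).map (Nat.cast : ℕ → ℕ∞) {(k : ℕ∞)} := by
    intro k
    rw [Measure.map_apply hm (measurableSet_singleton _),
      Measure.map_apply hc (measurableSet_singleton _)]
    have h2 : (Nat.cast : ℕ → ℕ∞) ⁻¹' {(k : ℕ∞)} = {k} := by ext; simp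
    rw [h2, ← h.poisson A hA hfin k]
    rfl
  -- The Poisson hypothesis concerns finite values only; the mass at `⊤` is the remainder of a
  -- probability measure.
  have hcompl : ∀ μ : Measure ℕ∞, IsProbabilityMeasure μ →
      μ {⊤} = 1 - ∑' k : ℕ, μ {(k : ℕ∞)} := by
    intro μ hμ
    have h1 : ({⊤} : Set ℕ∞) = (⋃ k : ℕ, {(k : ℕ∞)})ᶜ := by
      ext x
      cases x using ENat.recTopCoe <;> simp
    rw [h1, prob_compl_eq_one_sub (MeasurableSet.of_discrete), measure_iUnion]
    · intro i j hij
      simpa using hij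
    · intro i; exact MeasurableSet.of_discrete
  refine Measure.ext_of_singleton fun x => ?_
  cases x using ENat.recTopCoe with
  | top => rw [hcompl _ inferInstance, hcompl _ inferInstance]; simp_rw [hk]
  | coe k => exact hk k

theorem lintegral_comp_count (h : IsPoissonProcess P Λ X) {A : Set α} (hA : MeasurableSet A)
    (hfin : Λ A ≠ ∞) (g : ℕ∞ → ℝ≥0∞) :
    ∫⁻ ω, g (count X A ω) ∂P =
      ∑' k : ℕ, g k * poissonMeasure (Λ A).toNNReal {k} := by
  have hg : Measurable g := measurable_from_top
  have hc : Measurable (Nat.cast : ℕ → ℕ∞) := measurable_from_top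
  rw [← lintegral_map hg (measurable_count h.measurable hA), h.map_count hA hfin,
    lintegral_map hg hc, lintegral_countable']

/-- Poisson weights satisfy `(k + 1) p(k + 1) = Λ p(k)`, so the mean is `Λ` times the total mass. -/
theorem lintegral_count (h : IsPoissonProcess P Λ X) {A : Set α} (hA : MeasurableSet A)
    (hfin : Λ A ≠ ∞) : ∫⁻ ω, ((count X A ω : ℕ∞) : ℝ≥0∞) ∂P = Λ A := by
  rw [h.lintegral_comp_count hA hfin (fun n => (n : ℝ≥0∞)), tsum_eq_zero_add' ENNReal.summable]
  simp only [ENat.toENNReal_coe]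
  have key : ∀ k : ℕ, ((k + 1 : ℕ) : ℝ≥0∞) * poissonMeasure (Λ A).toNNReal {k + 1} =
      Λ A * poissonMeasure (Λ A).toNNReal {k} := by
    intro k
    obtain ⟨r, hr⟩ : ∃ r : ℝ≥0, Λ A = r := ⟨_, (ENNReal.coe_toNNReal hfin).symm⟩
    rw [hr, ENNReal.toNNReal_coe,
      poissonMeasure_singleton, poissonMeasure_singleton, ← ENNReal.ofReal_natCast,
      ← ENNReal.ofReal_coe_nnreal, ← ENNReal.ofReal_mul (by positivity),
      ← ENNReal.ofReal_mul (by positivity)]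
    congr 1
    rw [Nat.factorial_succ]
    push_cast
    have : (k.factorial : ℝ) ≠ 0 := by positivity
    field_simp
    ring
  simp only [key, Nat.cast_zero, zero_mul, zero_add]
  rw [ENNReal.tsum_mul_left]
  have h1 : ∑' k : ℕ, poissonMeasure (Λ A).toNNReal {k} = 1 := by
    have := lintegral_countable' (μ := poissonMeasure (Λ A).toNNReal) (fun _ => (1 : ℝ≥0∞))
    simpa using this.symm
  rw [h1, mul_one]

/-- Since `Λ p(k) / (k + 1) = p(k + 1)`, the sum is the mass off zero. This identity carries the
whole effect of interference: it gives the annealed connection function exactly, and the factor `1 /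
Λ(D)` in the long edge bound. -/
theorem mul_lintegral_inv_one_add_count (h : IsPoissonProcess P Λ X) {A : Set α}
    (hA : MeasurableSet A) (hfin : Λ A ≠ ∞) :
    Λ A * ∫⁻ ω, (1 + ((count X A ω : ℕ∞) : ℝ≥0∞))⁻¹ ∂P =
      ENNReal.ofReal (1 - Real.exp (-(Λ A).toReal)) := by
  rw [h.lintegral_comp_count hA hfin (fun n => (1 + (n : ℝ≥0∞))⁻¹), ← ENNReal.tsum_mul_left]
  have key : ∀ k : ℕ, Λ A * ((1 + ((k : ℕ∞) : ℝ≥0∞))⁻¹ * poissonMeasure (Λ A).toNNReal {k}) =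
      poissonMeasure (Λ A).toNNReal {k + 1} := by
    intro k
    obtain ⟨r, hr⟩ : ∃ r : ℝ≥0, Λ A = r := ⟨_, (ENNReal.coe_toNNReal hfin).symm⟩
    rw [hr, ENNReal.toNNReal_coe]
    have h1 : (1 + ((k : ℕ∞) : ℝ≥0∞))⁻¹ = ENNReal.ofReal ((1 + k : ℝ)⁻¹) := by
      rw [ENNReal.ofReal_inv_of_pos (by positivity), ENNReal.ofReal_add (by positivity)
        (by positivity)]
      simp
    rw [h1, poissonMeasure_singleton, poissonMeasure_singleton,
      ← ENNReal.ofReal_coe_nnreal, ← ENNReal.ofReal_mul (by positivity),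
      ← ENNReal.ofReal_mul (by positivity)]
    congr 1
    rw [Nat.factorial_succ]
    push_cast
    have : (k.factorial : ℝ) ≠ 0 := by positivity
    field_simp
    ring
  simp_rw [key]
  have h1 : ∑' k : ℕ, poissonMeasure (Λ A).toNNReal {k} = 1 := by
    have := lintegral_countable' (μ := poissonMeasure (Λ A).toNNReal) (fun _ => (1 : ℝ≥0∞))
    simpa using this.symm
  rw [tsum_eq_zero_add' ENNReal.summable] at h1
  have h2 : poissonMeasure (Λ A).toNNReal {0} = ENNReal.ofReal (Real.exp (-(Λ A).toReal)) := by
    rw [poissonMeasure_singleton]; simp [ENNReal.coe_toNNReal_eq_toReal]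
  rw [h2] at h1
  rw [ENNReal.ofReal_sub _ (by positivity), ENNReal.ofReal_one]
  exact ENNReal.eq_sub_of_add_eq ENNReal.ofReal_ne_top (by rw [add_comm]; exact h1)

theorem measure_one_le_count (h : IsPoissonProcess P Λ X) {A : Set α} (hA : MeasurableSet A) :
    P {ω | 1 ≤ count X A ω} ≤ Λ A := by
  by_cases hfin : Λ A = ∞
  · simp [hfin]
  rw [← h.lintegral_count hA hfin]
  have hm : Measurable fun ω => ((count X A ω : ℕ∞) : ℝ≥0∞) :=
    measurable_from_top.comp (measurable_count h.measurable hA)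
  have := mul_meas_ge_le_lintegral (μ := P) hm 1
  rw [one_mul] at this
  refine le_trans (measure_mono fun ω hω => ?_) this
  simp only [mem_ofPred_eq] at hω ⊢
  exact_mod_cast hω

theorem measure_exists_mem_le (h : IsPoissonProcess P Λ X) {A : Set α} (hA : MeasurableSet A) :
    P {ω | ∃ n, X n ω ∈ A} ≤ Λ A := by
  refine (measure_mono fun ω hω => ?_).trans (h.measure_one_le_count hA)
  obtain ⟨n, hn⟩ := hω
  simp only [mem_ofPred_eq, count]
  exact Order.one_le_iff_ne_zero.2 (by rw [encard_ne_zero]; exact ⟨n, hn⟩)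

theorem ae_notMem (h : IsPoissonProcess P Λ X) {A : Set α} (hA : MeasurableSet A)
    (h0 : Λ A = 0) : ∀ᵐ ω ∂P, ∀ n, X n ω ∉ A := by
  have := h.measure_exists_mem_le hA
  rw [h0, nonpos_iff_eq_zero] at this
  rw [ae_iff]
  simpa using this

theorem ae_finite (h : IsPoissonProcess P Λ X) {A : Set α} (hA : MeasurableSet A)
    (hfin : Λ A ≠ ∞) : ∀ᵐ ω ∂P, {n | X n ω ∈ A}.Finite := by
  have hm : Measurable fun ω => ((count X A ω : ℕ∞) : ℝ≥0∞) :=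
    measurable_from_top.comp (measurable_count h.measurable hA)
  have := ae_lt_top hm (by rw [h.lintegral_count hA hfin]; exact hfin)
  filter_upwards [this] with ω hω
  rw [← encard_lt_top_iff]
  simpa [count] using hω

theorem measure_two_le_count (h : IsPoissonProcess P Λ X) {A : Set α} (hA : MeasurableSet A)
    (hfin : Λ A ≠ ∞) : P {ω | 2 ≤ count X A ω} ≤ Λ A ^ 2 := by
  have := h.isProbabilityMeasure
  have h0 := h.poisson A hA hfin 0
  have h1 := h.poisson A hA hfin 1
  have hm := measurable_count h.measurable hA
  have hset : {ω | 2 ≤ count X A ω} =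
      ({ω | count X A ω = (0 : ℕ)} ∪ {ω | count X A ω = (1 : ℕ)})ᶜ := by
    ext ω
    simp only [mem_ofPred_eq, mem_compl_iff, mem_union, not_or]
    cases count X A ω using ENat.recTopCoe with
    | top => simp
    | coe k => norm_cast; omega
  have hms : ∀ k : ℕ, MeasurableSet {ω | count X A ω = (k : ℕ)} := fun k =>
    hm (measurableSet_singleton _)
  rw [hset, prob_compl_eq_one_sub ((hms 0).union (hms 1)), measure_union _ (hms 1), h0, h1,
    poissonMeasure_singleton, poissonMeasure_singleton, tsub_le_iff_right,
    ← ENNReal.ofReal_add (by positivity) (by positivity)]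
  · obtain ⟨r, hr⟩ : ∃ r : ℝ≥0, Λ A = r := ⟨_, (ENNReal.coe_toNNReal hfin).symm⟩
    rw [hr, ENNReal.toNNReal_coe, ← ENNReal.ofReal_coe_nnreal, ← ENNReal.ofReal_pow (by positivity),
      ← ENNReal.ofReal_add (by positivity) (by positivity), ENNReal.one_le_ofReal]
    have hr : (0 : ℝ) ≤ r := r.2
    have := Real.add_one_le_exp (-(r : ℝ))
    simp
    nlinarith
  · rw [disjoint_left]
    intro ω ha hb
    simp only [mem_ofPred_eq] at ha hb
    rw [ha] at hb
    simp at hb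

/-- Used in the long edge bound with `A` and `B` holding the two endpoints and `D` the interfering
points. -/
theorem lintegral_prod_three (h : IsPoissonProcess P Λ X) {A B D : Set α} (hA : MeasurableSet A)
    (hB : MeasurableSet B) (hD : MeasurableSet D) (hAB : Disjoint A B) (hAD : Disjoint A D)
    (hBD : Disjoint B D) (f g k : ℕ∞ → ℝ≥0∞) :
    ∫⁻ ω, f (count X A ω) * g (count X B ω) * k (count X D ω) ∂P =
      (∫⁻ ω, f (count X A ω) ∂P) * (∫⁻ ω, g (count X B ω) ∂P) * ∫⁻ ω, k (count X D ω) ∂P := by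
  have := h.isProbabilityMeasure
  have hind := h.indep 3 ![A, B, D] (by intro i; fin_cases i <;> assumption) (by
    intro i j hij
    fin_cases i <;> fin_cases j <;>
      first | exact absurd rfl hij | assumption | exact Disjoint.symm ‹_›)
  have hm : ∀ S : Set α, MeasurableSet S → Measurable (count X S) := fun S =>
    measurable_count h.measurable
  have hmi : ∀ i : Fin 3, Measurable fun ω => count X (![A, B, D] i) ω := by
    intro i; fin_cases i <;> [exact hm A hA; exact hm B hB; exact hm D hD]
  have hf : ∀ f : ℕ∞ → ℝ≥0∞, Measurable f := fun f => measurable_from_top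
  have h1 : IndepFun (count X A) (count X B) P := hind.indepFun (i := 0) (j := 1) (by decide)
  have h2 : IndepFun (fun ω => (count X A ω, count X B ω)) (count X D) P :=
    hind.indepFun_prodMk hmi 0 1 2 (by decide) (by decide)
  have hfg : Measurable fun p : ℕ∞ × ℕ∞ => f p.1 * g p.2 := by
    have := hf f; have := hf g; fun_prop
  have h3 : IndepFun (fun ω => f (count X A ω) * g (count X B ω)) (fun ω => k (count X D ω)) P :=
    h2.comp hfg (hf k)
  have h4 : IndepFun (fun ω => f (count X A ω)) (fun ω => g (count X B ω)) P :=
    h1.comp (hf f) (hf g)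
  have e1 := lintegral_mul_eq_lintegral_mul_lintegral_of_indepFun
    (hfg.comp ((hm A hA).prodMk (hm B hB))) ((hf k).comp (hm D hD)) h3
  have e2 := lintegral_mul_eq_lintegral_mul_lintegral_of_indepFun
    ((hf f).comp (hm A hA)) ((hf g).comp (hm B hB)) h4
  simp only [Pi.mul_apply, Function.comp_def] at e1 e2
  rw [e1, e2]

end IsPoissonProcess

end Poisson

/-! ### The marked process: almost surely all marks are distinct. -/

section Intensity

variable {d : ℕ} {l : ℝ}

theorem intensity_prod (s : Set (EuclideanSpace ℝ (Fin d))) (t : Set ℝ) :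
    intensity d l (s ×ˢ t) = ENNReal.ofReal l * (volume s * volume.restrict (Ioo (0 : ℝ) 1) t) := by
  rw [intensity, Measure.smul_apply, Measure.prod_prod, smul_eq_mul]

theorem intensity_cylinder (s : Set (EuclideanSpace ℝ (Fin d))) :
    intensity d l (s ×ˢ univ) = ENNReal.ofReal l * volume s := by
  rw [intensity_prod, Measure.restrict_apply_univ]
  simp

theorem intensity_cylinder_ne_top {s : Set (EuclideanSpace ℝ (Fin d))} (hs : volume s ≠ ∞) :
    intensity d l (s ×ˢ univ) ≠ ∞ := by
  rw [intensity_cylinder]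
  exact ENNReal.mul_ne_top ENNReal.ofReal_ne_top hs

theorem intensity_marks_compl :
    intensity d l (univ ×ˢ (Ioo (0 : ℝ) 1)ᶜ) = 0 := by
  rw [intensity_prod, Measure.restrict_apply measurableSet_Ioo.compl]
  simp

variable {Ω : Type*} [MeasurableSpace Ω] {P : Measure Ω} {X : ℕ → Ω → Vertex d}

theorem ae_mark_mem (h : IsPoissonProcess P (intensity d l) X) :
    ∀ᵐ ω ∂P, ∀ n, (X n ω).2 ∈ Ioo (0 : ℝ) 1 := by
  filter_upwards [h.ae_notMem (MeasurableSet.univ.prod measurableSet_Ioo.compl)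
    intensity_marks_compl] with ω hω n
  by_contra hn
  exact hω n ⟨mem_univ _, hn⟩

theorem two_le_count {α : Type*} {X : ℕ → Ω → α} {A : Set α} {ω : Ω} {i j : ℕ} (hij : i ≠ j)
    (hi : X i ω ∈ A) (hj : X j ω ∈ A) : 2 ≤ count X A ω := by
  rw [count, ← encard_pair hij]
  refine encard_le_encard ?_
  rintro n (rfl | rfl) <;> assumption

/-- Cut the marks into `n` slabs of height `1/n`. Two equal marks share a slab, and a slab of
intensity `v/n` holds two points with probability at most `(v/n)^2`; summed over the slabs this is
`v^2/n`, which tends to zero. -/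
theorem ae_mark_ne_on_ball (h : IsPoissonProcess P (intensity d l) X) (m : ℕ) :
    ∀ᵐ ω ∂P, ∀ i j, i ≠ j → (X i ω).1 ∈ Metric.ball 0 (m : ℝ) → (X j ω).1 ∈ Metric.ball 0 (m : ℝ) →
      (X i ω).2 ∈ Ioo (0 : ℝ) 1 → (X i ω).2 ≠ (X j ω).2 := by
  set b : Set (EuclideanSpace ℝ (Fin d)) := Metric.ball 0 (m : ℝ) with hb
  set v : ℝ≥0∞ := ENNReal.ofReal l * volume b with hv
  have hvt : v ≠ ∞ := ENNReal.mul_ne_top ENNReal.ofReal_ne_top measure_ball_lt_top.ne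
  have hbound : ∀ n : ℕ, 0 < n → P {ω | ∃ i j, i ≠ j ∧ (X i ω).1 ∈ b ∧ (X j ω).1 ∈ b ∧
      (X i ω).2 ∈ Ioo (0 : ℝ) 1 ∧ (X i ω).2 = (X j ω).2} ≤ v ^ 2 / n := by
    intro n hn
    have hn' : (0 : ℝ) < n := by exact_mod_cast hn
    let c : ℕ → Set (Vertex d) := fun k => b ×ˢ Ico ((k : ℝ) / n) ((k + 1 : ℝ) / n)
    have hc : ∀ k, intensity d l (c k) ≤ v / n := by
      intro k
      rw [intensity_prod, ← mul_assoc, ENNReal.div_eq_inv_mul, mul_comm]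
      gcongr
      refine (Measure.restrict_apply_le _ _).trans ?_
      rw [Real.volume_Ico, ← sub_div, add_sub_cancel_left, one_div,
        ENNReal.ofReal_inv_of_pos hn', ENNReal.ofReal_natCast]
    have hcm : ∀ k, MeasurableSet (c k) := fun k =>
      (Metric.isOpen_ball.measurableSet).prod measurableSet_Ico
    have hct : ∀ k, intensity d l (c k) ≠ ∞ := fun k =>
      ((hc k).trans_lt (ENNReal.div_lt_top hvt (by simpa using hn.ne'))).ne
    calc P {ω | ∃ i j, i ≠ j ∧ (X i ω).1 ∈ b ∧ (X j ω).1 ∈ b ∧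
          (X i ω).2 ∈ Ioo (0 : ℝ) 1 ∧ (X i ω).2 = (X j ω).2}
        ≤ P (⋃ k ∈ Finset.range n, {ω | 2 ≤ count X (c k) ω}) := by
          refine measure_mono ?_
          rintro ω ⟨i, j, hij, hi, hj, hu, he⟩
          simp only [mem_iUnion, Finset.mem_range, mem_ofPred_eq]
          have h0 : 0 ≤ (X i ω).2 * n := mul_nonneg hu.1.le hn'.le
          have hk : (X i ω).2 ∈ Ico (((⌊(X i ω).2 * n⌋₊ : ℕ) : ℝ) / n)
              (((⌊(X i ω).2 * n⌋₊ : ℕ) + 1 : ℝ) / n) := by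
            constructor
            · rw [div_le_iff₀ hn']; exact Nat.floor_le h0
            · rw [lt_div_iff₀ hn']; exact Nat.lt_floor_add_one _
          refine ⟨⌊(X i ω).2 * n⌋₊, ?_, two_le_count hij ⟨hi, hk⟩ ⟨hj, he ▸ hk⟩⟩
          rw [Nat.floor_lt h0]
          nlinarith [hu.2]
      _ ≤ ∑ k ∈ Finset.range n, P {ω | 2 ≤ count X (c k) ω} := measure_biUnion_finset_le _ _
      _ ≤ ∑ k ∈ Finset.range n, (v / n) ^ 2 := by
          gcongr with k _
          exact (h.measure_two_le_count (hcm k) (hct k)).trans (by gcongr; exact hc k)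
      _ = v ^ 2 / n := by
          rw [Finset.sum_const, Finset.card_range, nsmul_eq_mul, ENNReal.div_eq_inv_mul,
            ENNReal.div_eq_inv_mul, mul_pow, ← mul_assoc, sq (n : ℝ≥0∞)⁻¹, ← mul_assoc,
            ENNReal.mul_inv_cancel (by simpa using hn.ne') (by simp), one_mul]
  have hzero : P {ω | ∃ i j, i ≠ j ∧ (X i ω).1 ∈ b ∧ (X j ω).1 ∈ b ∧
      (X i ω).2 ∈ Ioo (0 : ℝ) 1 ∧ (X i ω).2 = (X j ω).2} = 0 := by
    have ht : Tendsto (fun n : ℕ => v ^ 2 / (n : ℝ≥0∞)) atTop (𝓝 0) :=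
      ENNReal.Tendsto.const_div ENNReal.tendsto_nat_nhds_top (Or.inr (by simpa using hvt)) |>.trans
        (by simp)
    exact le_antisymm (ge_of_tendsto ht (eventually_atTop.2 ⟨1, fun n hn => hbound n hn⟩))
      zero_le
  rw [ae_iff]
  convert hzero using 2
  ext ω
  simp [and_assoc]

theorem ae_mark_injective (h : IsPoissonProcess P (intensity d l) X) :
    ∀ᵐ ω ∂P, Function.Injective fun n => (X n ω).2 := by
  filter_upwards [ae_all_iff.2 (ae_mark_ne_on_ball h), ae_mark_mem h] with ω hω hu i j hij
  by_contra hne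
  obtain ⟨m, hm⟩ := exists_nat_gt (max ‖(X i ω).1‖ ‖(X j ω).1‖)
  exact hω m i j hne (by simpa using (le_max_left _ _).trans_lt hm)
    (by simpa using (le_max_right _ _).trans_lt hm) (hu i) hij

theorem ae_injective (h : IsPoissonProcess P (intensity d l) X) :
    ∀ᵐ ω ∂P, Function.Injective fun n => X n ω := by
  filter_upwards [ae_mark_injective h] with ω hω i j hij
  exact hω (congrArg Prod.snd hij)

end Intensity

/-! ### Laws and independence of functionals of the points in a window. -/

section Window

variable {Ω Ω' α : Type*} [MeasurableSpace Ω] [MeasurableSpace Ω'] [MeasurableSpace α]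

/-- The points whose membership in `S 0, …, S (n-1)` is prescribed by `s`. -/
def cell (S : ℕ → Set α) (n : ℕ) (s : Finset ℕ) : Set α := {z | ∀ i < n, z ∈ S i ↔ i ∈ s}

theorem measurableSet_cell {S : ℕ → Set α} (hS : ∀ n, MeasurableSet (S n)) (n : ℕ)
    (s : Finset ℕ) : MeasurableSet (cell S n s) := by
  have : cell S n s = ⋂ i, ⋂ (_ : i < n), {z | z ∈ S i ↔ i ∈ s} := by
    ext z; simp [cell]
  rw [this]
  refine MeasurableSet.iInter fun i => MeasurableSet.iInter fun _ => ?_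
  by_cases hi : i ∈ s
  · simpa [hi] using hS i
  · rw [show {z | z ∈ S i ↔ i ∈ s} = (S i)ᶜ by ext; simp [hi]]
    exact (hS i).compl

theorem disjoint_cell (S : ℕ → Set α) {n : ℕ} {s t : Finset ℕ}
    (hs : s ∈ (Finset.range n).powerset) (ht : t ∈ (Finset.range n).powerset) (hst : s ≠ t) :
    Disjoint (cell S n s) (cell S n t) := by
  rw [disjoint_left]
  intro z hz hz'
  refine hst (Finset.ext fun i => ?_)
  rw [Finset.mem_powerset] at hs ht
  by_cases hi : i < n
  · rw [← hz i hi, ← hz' i hi]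
  · exact ⟨fun h => absurd (Finset.mem_range.1 (hs h)) hi,
      fun h => absurd (Finset.mem_range.1 (ht h)) hi⟩

open Classical in
theorem cell_eq_biUnion (S : ℕ → Set α) {m n : ℕ} (hmn : m ≤ n) (s : Finset ℕ) :
    cell S m s = ⋃ t ∈ (Finset.range n).powerset.filter fun t => ∀ i < m, i ∈ t ↔ i ∈ s,
      cell S n t := by
  ext z
  simp only [Finset.mem_filter, Finset.mem_powerset, mem_iUnion, exists_prop]
  constructor
  · intro hz
    refine ⟨(Finset.range n).filter fun i => z ∈ S i, ⟨Finset.filter_subset _ _, fun i hi => ?_⟩,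
      fun i hi => ?_⟩
    · simpa [hi.trans_le hmn] using hz i hi
    · simp [hi]
  · rintro ⟨t, ⟨-, ht⟩, hz⟩ i hi
    rw [hz i (hi.trans_le hmn), ht i hi]

theorem count_biUnion {X : ℕ → Ω → α} {κ : Type*} (T : Finset κ) (A : κ → Set α)
    (hA : (T : Set κ).PairwiseDisjoint A) (ω : Ω) :
    count X (⋃ i ∈ T, A i) ω = ∑ i ∈ T, count X (A i) ω := by
  classical
  induction T using Finset.induction_on with
  | empty => simp [count]
  | insert a T ha ih =>
    rw [Finset.set_biUnion_insert, count_union, Finset.sum_insert ha, ih]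
    · exact hA.subset (by simp)
    · rw [disjoint_iUnion₂_right]
      intro i hi
      exact hA (by simp) (by simp [hi]) (fun h => ha (h ▸ hi))

/-- The numbers of points in the cells of the window `W`. -/
def cellCount (S : ℕ → Set α) (W : Set α) (X : ℕ → Ω → α) (p : ℕ × Finset ℕ) (ω : Ω) : ℕ∞ :=
  count X (W ∩ cell S p.1 p.2) ω

theorem measurable_cellCount {S : ℕ → Set α} (hS : ∀ n, MeasurableSet (S n)) {W : Set α}
    (hW : MeasurableSet W) {X : ℕ → Ω → α} (hX : ∀ n, Measurable (X n)) (p : ℕ × Finset ℕ) :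
    Measurable (cellCount S W X p) :=
  measurable_count hX (hW.inter (measurableSet_cell hS _ _))

open Classical in
theorem cellCount_eq_sum (S : ℕ → Set α) (W : Set α) (X : ℕ → Ω → α) {p : ℕ × Finset ℕ} {n : ℕ}
    (hn : p.1 ≤ n) (ω : Ω) :
    cellCount S W X p ω = ∑ t : (Finset.range n).powerset,
      if ∀ i < p.1, i ∈ (t : Finset ℕ) ↔ i ∈ p.2 then count X (W ∩ cell S n t) ω else 0 := by
  rw [cellCount, cell_eq_biUnion S hn, inter_iUnion₂, count_biUnion, Finset.sum_filter]
  · exact (Finset.sum_coe_sort (Finset.range n).powerset fun t =>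
      if ∀ i < p.1, i ∈ t ↔ i ∈ p.2 then count X (W ∩ cell S n t) ω else 0).symm
  · intro t ht t' ht' htt'
    simp only [Finset.coe_filter, mem_ofPred_eq] at ht ht'
    exact (disjoint_cell S ht.1 ht'.1 htt').mono inter_subset_right inter_subset_right

variable {P : Measure Ω} {P' : Measure Ω'} {Λ : Measure α} {X : ℕ → Ω → α} {X' : ℕ → Ω' → α}

theorem IsPoissonProcess.iIndepFun_count (h : IsPoissonProcess P Λ X) {κ : Type*} [Fintype κ]
    (A : κ → Set α) (hA : ∀ i, MeasurableSet (A i))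
    (hd : Pairwise fun i j => Disjoint (A i) (A j)) :
    iIndepFun (fun i ω => count X (A i) ω) P := by
  let e := Fintype.equivFin κ
  have := h.indep (Fintype.card κ) (fun i => A (e.symm i)) (fun i => hA _)
    (fun i j hij => hd (e.symm.injective.ne hij))
  have := this.precomp e.injective
  simpa using this

theorem IsPoissonProcess.map_level (h : IsPoissonProcess P Λ X) {S : ℕ → Set α}
    (hS : ∀ n, MeasurableSet (S n)) {W : Set α} (hW : MeasurableSet W) (hfin : Λ W ≠ ∞) (n : ℕ) :
    P.map (fun ω (t : (Finset.range n).powerset) => count X (W ∩ cell S n t) ω) =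
      Measure.pi fun t : (Finset.range n).powerset =>
        (poissonMeasure (Λ (W ∩ cell S n t)).toNNReal).map (Nat.cast : ℕ → ℕ∞) := by
  have := h.isProbabilityMeasure
  have hm : ∀ t : Finset ℕ, MeasurableSet (W ∩ cell S n t) := fun t =>
    hW.inter (measurableSet_cell hS _ _)
  have hi := h.iIndepFun_count (fun t : (Finset.range n).powerset => W ∩ cell S n t)
    (fun t => hm t) (fun t t' htt' => (disjoint_cell S t.2 t'.2 fun e =>
      htt' (Subtype.ext e)).mono inter_subset_right inter_subset_right)
  rw [(iIndepFun_iff_map_fun_eq_pi_map fun t : (Finset.range n).powerset =>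
    (measurable_count h.measurable (hm t)).aemeasurable).1 hi]
  congr with t : 1
  exact h.map_count (hm t) ((measure_mono inter_subset_left).trans_lt hfin.lt_top).ne

/-- Finitely many cell counts are sums of counts in the disjoint cells of one common level, whose
joint law is a product of Poisson laws fixed by `Λ`. Finite-dimensional laws determine the law of
the whole family. -/
theorem IsPoissonProcess.map_cellCount_eq (h : IsPoissonProcess P Λ X)
    (h' : IsPoissonProcess P' Λ X') {S : ℕ → Set α}
    (hS : ∀ n, MeasurableSet (S n)) {W : Set α} (hW : MeasurableSet W) (hfin : Λ W ≠ ∞) :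
    P.map (fun ω p => cellCount S W X p ω) = P'.map (fun ω p => cellCount S W X' p ω) := by
  classical
  have := h.isProbabilityMeasure
  have := h'.isProbabilityMeasure
  have m := measurable_cellCount hS hW h.measurable
  have m' := measurable_cellCount hS hW h'.measurable
  have l := isProjectiveLimit_map (P := P) (measurable_pi_lambda _ m).aemeasurable
  have l' := isProjectiveLimit_map (P := P') (measurable_pi_lambda _ m').aemeasurable
  have key : ∀ I : Finset (ℕ × Finset ℕ),
      P.map (fun ω => I.restrict (cellCount S W X · ω)) =
        P'.map (fun ω => I.restrict (cellCount S W X' · ω)) := by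
    intro I
    -- The finest level occurring in `I`; every coarser cell is a disjoint union of cells of this
    -- level.
    let n := I.sup Prod.fst
    let g : ((Finset.range n).powerset → ℕ∞) → I → ℕ∞ := fun v p =>
      ∑ t : (Finset.range n).powerset,
        if ∀ i < p.1.1, i ∈ (t : Finset ℕ) ↔ i ∈ p.1.2 then v t else 0
    have hg : Measurable g := measurable_of_countable g
    have hL : Measurable fun ω (t : (Finset.range n).powerset) => count X (W ∩ cell S n t) ω :=
      measurable_pi_lambda _ fun t => measurable_count h.measurable
        (hW.inter (measurableSet_cell hS _ _))
    have hL' : Measurable fun ω (t : (Finset.range n).powerset) => count X' (W ∩ cell S n t) ω :=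
      measurable_pi_lambda _ fun t => measurable_count h'.measurable
        (hW.inter (measurableSet_cell hS _ _))
    have e : (fun ω => I.restrict (cellCount S W X · ω)) =
        g ∘ fun ω (t : (Finset.range n).powerset) => count X (W ∩ cell S n t) ω := by
      funext ω p
      exact cellCount_eq_sum S W X (Finset.le_sup (f := Prod.fst) p.2) ω
    have e' : (fun ω => I.restrict (cellCount S W X' · ω)) =
        g ∘ fun ω (t : (Finset.range n).powerset) => count X' (W ∩ cell S n t) ω := by
      funext ω p
      exact cellCount_eq_sum S W X' (Finset.le_sup (f := Prod.fst) p.2) ω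
    rw [e, e', ← Measure.map_map hg hL, ← Measure.map_map hg hL', h.map_level hS hW hfin,
      h'.map_level hS hW hfin]
  simp_rw [key] at l
  have : ∀ I : Finset (ℕ × Finset ℕ),
      IsFiniteMeasure (P'.map (fun ω => I.restrict (cellCount S W X' · ω))) := fun I =>
    inferInstance
  exact l.unique l'

theorem IsPoissonProcess.indepFun_cellCount (h : IsPoissonProcess P Λ X) {S : ℕ → Set α}
    (hS : ∀ n, MeasurableSet (S n)) {W W' : Set α} (hW : MeasurableSet W) (hW' : MeasurableSet W')
    (hd : Disjoint W W') :
    IndepFun (fun ω p => cellCount S W X p ω) (fun ω p => cellCount S W' X p ω) P := by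
  classical
  have := h.isProbabilityMeasure
  refine Kernel.IndepFun.process_indepFun_process (measurable_cellCount hS hW h.measurable)
    (measurable_cellCount hS hW' h.measurable) fun I J => ?_
  let n := max (I.sup Prod.fst) (J.sup Prod.fst)
  let A : (Finset.range n).powerset ⊕ (Finset.range n).powerset → Set α :=
    Sum.elim (fun t => W ∩ cell S n t) (fun t => W' ∩ cell S n t)
  have hA : ∀ i, MeasurableSet (A i) := by
    rintro (t | t)
    · exact hW.inter (measurableSet_cell hS _ _)
    · exact hW'.inter (measurableSet_cell hS _ _)
  have hi := h.iIndepFun_count A hA (by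
    rintro (t | t) (t' | t') htt'
    · exact (disjoint_cell S t.2 t'.2 fun e => htt' (congrArg Sum.inl (Subtype.ext e))).mono
        inter_subset_right inter_subset_right
    · exact hd.mono inter_subset_left inter_subset_left
    · exact hd.symm.mono inter_subset_left inter_subset_left
    · exact (disjoint_cell S t.2 t'.2 fun e => htt' (congrArg Sum.inr (Subtype.ext e))).mono
        inter_subset_right inter_subset_right)
  let L : Finset ((Finset.range n).powerset ⊕ (Finset.range n).powerset) :=
    Finset.univ.map ⟨Sum.inl, Sum.inl_injective⟩
  let R : Finset ((Finset.range n).powerset ⊕ (Finset.range n).powerset) :=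
    Finset.univ.map ⟨Sum.inr, Sum.inr_injective⟩
  have hLR : Disjoint L R := by
    rw [Finset.disjoint_left]
    rintro (t | t) <;> simp [L, R]
  have hf := hi.indepFun_finset L R hLR (fun i => measurable_count h.measurable (hA i))
  let gL : (L → ℕ∞) → I → ℕ∞ := fun v p => ∑ t : (Finset.range n).powerset,
    if ∀ i < p.1.1, i ∈ (t : Finset ℕ) ↔ i ∈ p.1.2 then v ⟨Sum.inl t, by simp [L]⟩ else 0
  let gR : (R → ℕ∞) → J → ℕ∞ := fun v p => ∑ t : (Finset.range n).powerset,
    if ∀ i < p.1.1, i ∈ (t : Finset ℕ) ↔ i ∈ p.1.2 then v ⟨Sum.inr t, by simp [R]⟩ else 0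
  have := hf.comp (measurable_of_countable gL) (measurable_of_countable gR)
  have e1 : (fun ω (p : I) => cellCount S W X p ω) =
      gL ∘ fun ω (i : L) => count X (A i) ω := by
    funext ω p
    exact cellCount_eq_sum S W X ((Finset.le_sup (f := Prod.fst) p.2).trans (le_max_left _ _)) ω
  have e2 : (fun ω (p : J) => cellCount S W' X p ω) =
      gR ∘ fun ω (i : R) => count X (A i) ω := by
    funext ω p
    exact cellCount_eq_sum S W' X ((Finset.le_sup (f := Prod.fst) p.2).trans (le_max_right _ _)) ω
  rw [← e1, ← e2] at this
  exact this

/-- `Φ` depends only on the set of points in `W`, on simple sequences with finitely many points in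
`W`. -/
def DependsOnWindow {β : Type*} (W : Set α) (Φ : (ℕ → α) → β) : Prop :=
  ∀ x x' : ℕ → α, Function.Injective x → Function.Injective x' → {n | x n ∈ W}.Finite →
    {n | x' n ∈ W}.Finite → (∀ z ∈ W, (∃ n, x n = z) ↔ ∃ n, x' n = z) → Φ x = Φ x'

/-- If `x'` misses `z`, each of its finitely many points in `W` is separated from `z` by some `S i`.
At a level beyond all these indices the cell of `z` contains no point of `x'` in `W`, but it
contains one of `x`, so the counts differ. -/
theorem exists_eq_of_cellCount_eq {S : ℕ → Set α} (hsep : ∀ y z, (∀ n, y ∈ S n ↔ z ∈ S n) → y = z)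
    {W : Set α} {x x' : ℕ → α} (hx' : {n | x' n ∈ W}.Finite)
    (hc : ∀ p, cellCount S W (fun n (x : ℕ → α) => x n) p x =
      cellCount S W (fun n (x : ℕ → α) => x n) p x') {z : α} (hz : z ∈ W) (hzx : ∃ n, x n = z) :
    ∃ n, x' n = z := by
  classical
  by_contra! hne
  have : ∀ n, ∃ i, ¬ (x' n ∈ S i ↔ z ∈ S i) := by
    intro n
    by_contra! hn
    exact hne n (hsep _ _ hn)
  choose i hi using this
  obtain ⟨N, hN⟩ := (hx'.image i).bddAbove
  have h1 := hc (N + 1, (Finset.range (N + 1)).filter fun i => z ∈ S i)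
  have h2 : cellCount S W (fun n (x : ℕ → α) => x n)
      (N + 1, (Finset.range (N + 1)).filter fun i => z ∈ S i) x' = 0 := by
    rw [cellCount, count, encard_eq_zero, eq_empty_iff_forall_notMem]
    rintro n ⟨hnW, hn⟩
    have hle : i n < N + 1 := Nat.lt_succ_of_le (hN ⟨n, hnW, rfl⟩)
    refine hi n ?_
    rw [hn _ hle]
    simp only [Finset.mem_filter, Finset.mem_range, hle, true_and]
  rw [h2, cellCount, count, encard_eq_zero, eq_empty_iff_forall_notMem] at h1
  obtain ⟨n, hn⟩ := hzx
  refine h1 n ⟨?_, ?_⟩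
  · simpa [hn] using hz
  · intro j hj
    simp only at hj
    simp [hn, hj]

theorem measurableSet_injective [StandardBorelSpace α] :
    MeasurableSet {x : ℕ → α | Function.Injective x} := by
  have : {x : ℕ → α | Function.Injective x} = ⋂ i, ⋂ j, ⋂ (_ : i ≠ j), {x | x i = x j}ᶜ := by
    ext x
    simp only [mem_ofPred_eq, mem_iInter, mem_compl_iff, Function.Injective]
    exact ⟨fun h i j hij he => hij (h he), fun h i j he => by_contra fun hij => h i j hij he⟩
  rw [this]
  refine MeasurableSet.iInter fun i => MeasurableSet.iInter fun j => MeasurableSet.iInter fun _ => ?_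
  exact (measurableSet_eq_fun (measurable_pi_apply i) (measurable_pi_apply j)).compl

theorem measurableSet_finite_window {W : Set α} (hW : MeasurableSet W) :
    MeasurableSet {x : ℕ → α | {n | x n ∈ W}.Finite} := by
  have : {x : ℕ → α | {n | x n ∈ W}.Finite} =
      (count (fun n (x : ℕ → α) => x n) W) ⁻¹' (Iio ⊤) := by
    ext x
    rw [mem_ofPred_eq, ← encard_lt_top_iff]
    rfl
  rw [this]
  exact measurable_count (fun n => measurable_pi_apply n) hW MeasurableSet.of_discrete

/-- The cell counts determine the point set in `W`, so `Φ` is constant on the fibres of the count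
map `f`. Measurability of the factor is the delicate point: on a standard Borel space a measurable
set saturated for `f` is the preimage of a measurable set (Lusin separation), so `Φ` is measurable
for the σ-algebra generated by `f`. -/
theorem DependsOnWindow.exists_factor [StandardBorelSpace α] {S : ℕ → Set α}
    (hS : ∀ n, MeasurableSet (S n)) (hsep : ∀ y z, (∀ n, y ∈ S n ↔ z ∈ S n) → y = z)
    {W : Set α} (hW : MeasurableSet W) {Φ : (ℕ → α) → ℝ≥0∞} (hΦ : Measurable Φ)
    (hd : DependsOnWindow W Φ) :
    ∃ F : (ℕ × Finset ℕ → ℕ∞) → ℝ≥0∞, Measurable F ∧ ∀ x : ℕ → α, Function.Injective x →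
      {n | x n ∈ W}.Finite → Φ x = F fun p => cellCount S W (fun n (x : ℕ → α) => x n) p x := by
  let G : Set (ℕ → α) := {x | Function.Injective x} ∩ {x | {n | x n ∈ W}.Finite}
  have hG : MeasurableSet G := measurableSet_injective.inter (measurableSet_finite_window hW)
  have : StandardBorelSpace G := hG.standardBorel
  let f : G → ℕ × Finset ℕ → ℕ∞ := fun x p => cellCount S W (fun n (x : ℕ → α) => x n) p x.1
  have hf : Measurable f := measurable_pi_lambda _ fun p =>
    (measurable_cellCount hS hW (fun n => measurable_pi_apply n) p).comp measurable_subtype_coe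
  have hsat : ∀ x y : G, f x = f y → Φ x = Φ y := by
    intro x y hxy
    refine hd x y x.2.1 y.2.1 x.2.2 y.2.2 fun z hz => ⟨?_, ?_⟩
    · exact exists_eq_of_cellCount_eq hsep y.2.2 (fun p => congrFun hxy p) hz
    · exact exists_eq_of_cellCount_eq hsep x.2.2 (fun p => (congrFun hxy p).symm) hz
  have hm : Measurable[MeasurableSpace.comap f inferInstance] fun x : G => Φ x := by
    intro s hs
    have hA : MeasurableSet ((fun x : G => Φ x) ⁻¹' s) := (hΦ.comp measurable_subtype_coe) hs
    have hAe : (fun x : G => Φ x) ⁻¹' s = f ⁻¹' (f '' ((fun x : G => Φ x) ⁻¹' s)) := by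
      refine subset_antisymm (subset_preimage_image _ _) ?_
      rintro x ⟨y, hy, hxy⟩
      simp only [mem_preimage] at hy ⊢
      rwa [← hsat y x hxy]
    rw [hAe, hf.measurableSet_preimage_iff_preimage_val] at hA
    obtain ⟨T, hT, hTe⟩ := hA
    refine ⟨T, hT, ?_⟩
    rw [hAe]
    ext x
    have := Set.ext_iff.1 hTe ⟨f x, mem_range_self x⟩
    simpa using this
  obtain ⟨F, hF, hFe⟩ := hm.exists_eq_measurable_comp
  exact ⟨F, hF, fun x hx hfin => congrFun hFe ⟨x, hx, hfin⟩⟩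

theorem exists_separating (α : Type*) [MeasurableSpace α] [StandardBorelSpace α] :
    ∃ S : ℕ → Set α, (∀ n, MeasurableSet (S n)) ∧ ∀ y z, (∀ n, y ∈ S n ↔ z ∈ S n) → y = z := by
  obtain ⟨S, hS, h⟩ := exists_seq_separating α MeasurableSet.univ (univ : Set α)
  exact ⟨S, hS, fun y z => h y (mem_univ _) z (mem_univ _)⟩

/-- The law of a functional of the points in a window is determined by the intensity. -/
theorem IsPoissonProcess.lintegral_window_eq [StandardBorelSpace α] (h : IsPoissonProcess P Λ X)
    (h' : IsPoissonProcess P' Λ X') (hinj : ∀ᵐ ω ∂P, Function.Injective fun n => X n ω)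
    (hinj' : ∀ᵐ ω ∂P', Function.Injective fun n => X' n ω) {W : Set α} (hW : MeasurableSet W)
    (hfin : Λ W ≠ ∞) {Φ : (ℕ → α) → ℝ≥0∞} (hΦ : Measurable Φ) (hd : DependsOnWindow W Φ) :
    ∫⁻ ω, Φ (fun n => X n ω) ∂P = ∫⁻ ω, Φ (fun n => X' n ω) ∂P' := by
  obtain ⟨S, hS, hsep⟩ := exists_separating α
  obtain ⟨F, hF, hFe⟩ := hd.exists_factor hS hsep hW hΦ
  have e : ∫⁻ ω, Φ (fun n => X n ω) ∂P = ∫⁻ ω, F (fun p => cellCount S W X p ω) ∂P := by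
    refine lintegral_congr_ae ?_
    filter_upwards [hinj, h.ae_finite hW hfin] with ω h1 h2 using hFe _ h1 h2
  have e' : ∫⁻ ω, Φ (fun n => X' n ω) ∂P' = ∫⁻ ω, F (fun p => cellCount S W X' p ω) ∂P' := by
    refine lintegral_congr_ae ?_
    filter_upwards [hinj', h'.ae_finite hW hfin] with ω h1 h2 using hFe _ h1 h2
  rw [e, e',
    ← lintegral_map hF (measurable_pi_lambda _ (measurable_cellCount hS hW h.measurable)),
    ← lintegral_map hF (measurable_pi_lambda _ (measurable_cellCount hS hW h'.measurable)),
    h.map_cellCount_eq h' hS hW hfin]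

/-- Functionals of the points in disjoint windows are uncorrelated. -/
theorem IsPoissonProcess.lintegral_mul_window [StandardBorelSpace α] (h : IsPoissonProcess P Λ X)
    (hinj : ∀ᵐ ω ∂P, Function.Injective fun n => X n ω) {W W' : Set α} (hW : MeasurableSet W)
    (hW' : MeasurableSet W') (hfin : Λ W ≠ ∞) (hfin' : Λ W' ≠ ∞) (hdisj : Disjoint W W')
    {Φ Φ' : (ℕ → α) → ℝ≥0∞} (hΦ : Measurable Φ) (hΦ' : Measurable Φ')
    (hd : DependsOnWindow W Φ) (hd' : DependsOnWindow W' Φ') :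
    ∫⁻ ω, Φ (fun n => X n ω) * Φ' (fun n => X n ω) ∂P =
      (∫⁻ ω, Φ (fun n => X n ω) ∂P) * ∫⁻ ω, Φ' (fun n => X n ω) ∂P := by
  obtain ⟨S, hS, hsep⟩ := exists_separating α
  obtain ⟨F, hF, hFe⟩ := hd.exists_factor hS hsep hW hΦ
  obtain ⟨F', hF', hFe'⟩ := hd'.exists_factor hS hsep hW' hΦ'
  have e : (fun ω => Φ (fun n => X n ω)) =ᵐ[P] fun ω => F (fun p => cellCount S W X p ω) := by
    filter_upwards [hinj, h.ae_finite hW hfin] with ω h1 h2 using hFe _ h1 h2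
  have e' : (fun ω => Φ' (fun n => X n ω)) =ᵐ[P] fun ω => F' (fun p => cellCount S W' X p ω) := by
    filter_upwards [hinj, h.ae_finite hW' hfin'] with ω h1 h2 using hFe' _ h1 h2
  have e2 : (fun ω => Φ (fun n => X n ω) * Φ' (fun n => X n ω)) =ᵐ[P]
      fun ω => F (fun p => cellCount S W X p ω) * F' (fun p => cellCount S W' X p ω) := e.mul e'
  rw [lintegral_congr_ae e, lintegral_congr_ae e', lintegral_congr_ae e2]
  have hi := (h.indepFun_cellCount hS hW hW' hdisj).comp hF hF'
  exact lintegral_mul_eq_lintegral_mul_lintegral_of_indepFun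
    (hF.comp (measurable_pi_lambda _ (measurable_cellCount hS hW h.measurable)))
    (hF'.comp (measurable_pi_lambda _ (measurable_cellCount hS hW' h.measurable))) hi

end Window

/-! ### The graph with interference restricted to a window: measurability and symmetries. -/

section WindowGraph

variable {d : ℕ} (γ δ β : ℝ)

/-- The graph on the vertices `x 0, x 1, …` with edge variables `u`, where only the points in `W`
interfere. -/
def windowGraph (W : Set (Vertex d)) (x : ℕ → Vertex d) (u : Sym2 ℕ → ℝ) : SimpleGraph ℕ :=
  SimpleGraph.fromRel fun i j =>
    ENNReal.ofReal (u s(i, j)) < connProb d γ δ β (x i) (x j) ((range x ∩ W) \ {x i, x j})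

/-- Adjacency in `windowGraph` between vertices located in `B(c,3r)`. -/
def windowRel (W : Set (Vertex d)) (c : EuclideanSpace ℝ (Fin d)) (r : ℝ)
    (p : (ℕ → Vertex d) × (Sym2 ℕ → ℝ)) (i j : ℕ) : Prop :=
  (windowGraph γ δ β W p.1 p.2).Adj i j ∧ (p.1 i).1 ∈ Metric.ball c (3 * r) ∧
    (p.1 j).1 ∈ Metric.ball c (3 * r)

/-- The local annulus-crossing event, where only the points in `W` interfere. -/
def windowCrossing (W : Set (Vertex d)) (c : EuclideanSpace ℝ (Fin d)) (r : ℝ) :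
    Set ((ℕ → Vertex d) × (Sym2 ℕ → ℝ)) :=
  {p | ∃ i j, (p.1 i).1 ∈ Metric.ball c r ∧ (p.1 j).1 ∉ Metric.ball c (2 * r) ∧
    (p.1 i).1 ∈ Metric.ball c (3 * r) ∧ (p.1 j).1 ∈ Metric.ball c (3 * r) ∧
    Relation.ReflTransGen (windowRel γ δ β W c r p) i j}

theorem graph_eq_windowGraph {Ω : Type*} (X : ℕ → Ω → Vertex d) (U : Sym2 ℕ → Ω → ℝ) (ω : Ω) :
    graph d γ δ β X U ω = windowGraph γ δ β univ (fun n => X n ω) (fun e => U e ω) := by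
  simp [graph, windowGraph, config]

theorem induce_reachable_iff {V : Type*} (G : SimpleGraph V) (S : Set V) (a b : S) :
    (G.induce S).Reachable a b ↔
      Relation.ReflTransGen (fun i j => G.Adj i j ∧ i ∈ S ∧ j ∈ S) (a : V) b := by
  constructor
  · rw [SimpleGraph.reachable_iff_reflTransGen]
    exact fun h => h.lift Subtype.val fun i j hij => ⟨hij, i.2, j.2⟩
  · have key : ∀ c : V, Relation.ReflTransGen (fun i j => G.Adj i j ∧ i ∈ S ∧ j ∈ S) (a : V) c →
        ∀ hc : c ∈ S, (G.induce S).Reachable a ⟨c, hc⟩ := by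
      intro c h
      induction h with
      | refl => exact fun _ => SimpleGraph.Reachable.refl _
      | tail _ hij ih =>
        intro hc
        refine (ih hij.2.1).trans (SimpleGraph.Adj.reachable ?_)
        exact hij.1
    exact fun h => key b h b.2

theorem mem_localCrossing_iff {Ω : Type*} (X : ℕ → Ω → Vertex d) (U : Sym2 ℕ → Ω → ℝ) (ω : Ω)
    (c : EuclideanSpace ℝ (Fin d)) (r : ℝ) :
    ω ∈ localCrossing d γ δ β X U c r ↔
      ((fun n => X n ω, fun e => U e ω) : (ℕ → Vertex d) × (Sym2 ℕ → ℝ)) ∈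
        windowCrossing γ δ β univ c r := by
  simp only [localCrossing, windowCrossing, mem_ofPred_eq, induce_reachable_iff,
    graph_eq_windowGraph]
  constructor
  · rintro ⟨i, j, hi, hj, h⟩
    exact ⟨i, j, hi, hj, i.2, j.2, h⟩
  · rintro ⟨i, j, hi, hj, hi', hj', h⟩
    exact ⟨⟨i, hi'⟩, ⟨j, hj'⟩, hi, hj, h⟩

/-- Interference counts distinct points, not indices. Counting each point at its first index
expresses it by countably many measurable conditions on the sequence, without assuming injectivity.
-/
theorem interference_eq_encard_first (x : ℕ → Vertex d) (z : Vertex d) (η : Set (Vertex d)) :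
    interference d β z (range x ∩ η) =
      {n : ℕ | x n ∈ η ∧ ‖z.1 - (x n).1‖ ^ d ≤ z.2 ^ (-β) ∧ ∀ m < n, x m ≠ x n}.encard := by
  classical
  rw [interference]
  have : {w : Vertex d | w ∈ range x ∩ η ∧ ‖z.1 - w.1‖ ^ d ≤ z.2 ^ (-β)} =
      x '' {n : ℕ | x n ∈ η ∧ ‖z.1 - (x n).1‖ ^ d ≤ z.2 ^ (-β) ∧ ∀ m < n, x m ≠ x n} := by
    ext w
    constructor
    · rintro ⟨⟨⟨n, hn⟩, hη⟩, hw⟩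
      have hex : ∃ n, x n = w := ⟨n, hn⟩
      refine ⟨Nat.find hex, ⟨?_, ?_, fun m hm => ?_⟩, Nat.find_spec hex⟩
      · rwa [Nat.find_spec hex]
      · rwa [Nat.find_spec hex]
      · rw [Nat.find_spec hex]; exact Nat.find_min hex hm
    · rintro ⟨n, ⟨h1, h2, -⟩, rfl⟩
      exact ⟨⟨⟨n, rfl⟩, h1⟩, h2⟩
  rw [this, InjOn.encard_image]
  rintro m ⟨-, -, hm⟩ n ⟨-, -, hn⟩ hmn
  rcases lt_trichotomy m n with h | h | h
  · exact absurd hmn (hn m h)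
  · exact h
  · exact absurd hmn.symm (hm n h)

theorem measurable_interference {W : Set (Vertex d)} (hW : MeasurableSet W) (i j k : ℕ) :
    Measurable fun x : ℕ → Vertex d => interference d β (x k) ((range x ∩ W) \ {x i, x j}) := by
  have : (fun x : ℕ → Vertex d => interference d β (x k) ((range x ∩ W) \ {x i, x j})) =
      fun x => {n : ℕ | (x n ∈ W ∧ x n ≠ x i ∧ x n ≠ x j) ∧
        ‖(x k).1 - (x n).1‖ ^ d ≤ (x k).2 ^ (-β) ∧ ∀ m < n, x m ≠ x n}.encard := by
    funext x
    rw [inter_sdiff_assoc, interference_eq_encard_first]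
    congr! 3
    simp [not_or]
  rw [this]
  refine measurable_encard_setOf fun n => ?_
  have he : ∀ m n : ℕ, MeasurableSet {x : ℕ → Vertex d | x m ≠ x n} := fun m n =>
    (measurableSet_eq_fun (measurable_pi_apply m) (measurable_pi_apply n)).compl
  refine MeasurableSet.inter (MeasurableSet.inter (measurable_pi_apply n hW)
    ((he n i).inter (he n j))) (MeasurableSet.inter ?_ ?_)
  · have h1 : Measurable fun x : ℕ → Vertex d => ‖(x k).1 - (x n).1‖ ^ d := by fun_prop
    have h2 : Measurable fun x : ℕ → Vertex d => (x k).2 ^ (-β) := by fun_prop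
    exact measurableSet_le h1 h2
  · have : {x : ℕ → Vertex d | ∀ m < n, x m ≠ x n} = ⋂ m, ⋂ (_ : m < n), {x | x m ≠ x n} := by
      ext; simp
    change MeasurableSet {x : ℕ → Vertex d | ∀ m < n, x m ≠ x n}
    rw [this]
    exact MeasurableSet.iInter fun m => MeasurableSet.iInter fun _ => he m n

theorem measurable_halfProb {W : Set (Vertex d)} (hW : MeasurableSet W) (i j k l : ℕ) :
    Measurable fun x : ℕ → Vertex d =>
      halfProb d γ δ β (x k) (x l) ((range x ∩ W) \ {x i, x j}) := by
  unfold halfProb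
  have h1 : Measurable fun x : ℕ → Vertex d =>
      ((interference d β (x k) ((range x ∩ W) \ {x i, x j}) : ℕ∞) : ℝ≥0∞) :=
    measurable_from_top.comp (measurable_interference β hW i j k)
  refine Measurable.div (ENNReal.measurable_ofReal.comp ?_) (measurable_const.add h1)
  fun_prop

theorem measurable_connProb {W : Set (Vertex d)} (hW : MeasurableSet W) (i j : ℕ) :
    Measurable fun x : ℕ → Vertex d =>
      connProb d γ δ β (x i) (x j) ((range x ∩ W) \ {x i, x j}) := by
  unfold connProb
  refine Measurable.ite ?_ (measurable_halfProb γ δ β hW i j i j)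
    (measurable_halfProb γ δ β hW i j j i)
  exact measurableSet_lt (by fun_prop) (by fun_prop)

theorem measurableSet_adj {W : Set (Vertex d)} (hW : MeasurableSet W) (i j : ℕ) :
    MeasurableSet {p : (ℕ → Vertex d) × (Sym2 ℕ → ℝ) |
      (windowGraph γ δ β W p.1 p.2).Adj i j} := by
  have h : ∀ i j : ℕ, MeasurableSet {p : (ℕ → Vertex d) × (Sym2 ℕ → ℝ) |
      ENNReal.ofReal (p.2 s(i, j)) <
        connProb d γ δ β (p.1 i) (p.1 j) ((range p.1 ∩ W) \ {p.1 i, p.1 j})} := fun i j =>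
    measurableSet_lt (ENNReal.measurable_ofReal.comp (by fun_prop))
      ((measurable_connProb γ δ β hW i j).comp measurable_fst)
  by_cases hij : i = j
  · simp [hij]
  · convert (h i j).union (h j i) using 1
    ext p
    simp [windowGraph, SimpleGraph.fromRel_adj, hij]

/-- Reachability is the union over `n` of reachability in exactly `n` steps, each a countable union
over the last intermediate index. -/
theorem measurableSet_reflTransGen {Y : Type*} [MeasurableSpace Y] {R : Y → ℕ → ℕ → Prop}
    (hR : ∀ i j, MeasurableSet {p | R p i j}) (i j : ℕ) :
    MeasurableSet {p | Relation.ReflTransGen (R p) i j} := by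
  let A : ℕ → ℕ → Set Y := fun n => n.rec (fun j => {_p | i = j})
    fun _ B j => ⋃ k, B k ∩ {p | R p k j}
  have hA : ∀ n j, MeasurableSet (A n j) := by
    intro n
    induction n with
    | zero => exact fun j => MeasurableSet.const _
    | succ n ih => exact fun j => MeasurableSet.iUnion fun k => (ih k).inter (hR k j)
  have : {p | Relation.ReflTransGen (R p) i j} = ⋃ n, A n j := by
    ext p
    simp only [mem_ofPred_eq, mem_iUnion]
    constructor
    · intro h
      induction h with
      | refl => exact ⟨0, rfl⟩
      | tail _ hkj ih =>
        obtain ⟨n, hn⟩ := ih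
        exact ⟨n + 1, mem_iUnion.2 ⟨_, hn, hkj⟩⟩
    · rintro ⟨n, hn⟩
      induction n generalizing j with
      | zero =>
        have : i = j := hn
        exact this ▸ Relation.ReflTransGen.refl
      | succ n ih =>
        obtain ⟨k, hk, hkj⟩ := mem_iUnion.1 hn
        exact (ih k hk).tail hkj
  rw [this]
  exact MeasurableSet.iUnion fun n => hA n j

theorem measurableSet_windowCrossing {W : Set (Vertex d)} (hW : MeasurableSet W)
    (c : EuclideanSpace ℝ (Fin d)) (r : ℝ) :
    MeasurableSet (windowCrossing γ δ β W c r) := by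
  have hb : ∀ (i : ℕ) (s : ℝ), MeasurableSet {p : (ℕ → Vertex d) × (Sym2 ℕ → ℝ) |
      (p.1 i).1 ∈ Metric.ball c s} := fun i s => by
    have : Measurable fun p : (ℕ → Vertex d) × (Sym2 ℕ → ℝ) => (p.1 i).1 := by fun_prop
    exact this Metric.isOpen_ball.measurableSet
  have : windowCrossing γ δ β W c r = ⋃ i, ⋃ j,
      {p : (ℕ → Vertex d) × (Sym2 ℕ → ℝ) | (p.1 i).1 ∈ Metric.ball c r} ∩
      ({p | (p.1 j).1 ∈ Metric.ball c (2 * r)}ᶜ ∩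
      ({p | (p.1 i).1 ∈ Metric.ball c (3 * r)} ∩ ({p | (p.1 j).1 ∈ Metric.ball c (3 * r)} ∩
      {p | Relation.ReflTransGen (windowRel γ δ β W c r p) i j}))) := by
    ext p
    simp only [windowCrossing, mem_ofPred_eq, mem_iUnion, mem_inter_iff, mem_compl_iff]
  rw [this]
  refine MeasurableSet.iUnion fun i => MeasurableSet.iUnion fun j => (hb i _).inter
    ((hb j _).compl.inter ((hb i _).inter ((hb j _).inter ?_)))
  exact measurableSet_reflTransGen (fun i j =>
    (measurableSet_adj γ δ β hW i j).inter ((hb i _).inter (hb j _))) i j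

variable {γ δ β}

theorem windowCrossing_relabel {W : Set (Vertex d)} {c : EuclideanSpace ℝ (Fin d)} {r : ℝ}
    (π : Equiv.Perm ℕ) {x : ℕ → Vertex d} {u : Sym2 ℕ → ℝ}
    (h : (x ∘ π, u ∘ Sym2.map π) ∈ windowCrossing γ δ β W c r) :
    (x, u) ∈ windowCrossing γ δ β W c r := by
  obtain ⟨i, j, h1, h2, h3, h4, h5⟩ := h
  refine ⟨π i, π j, h1, h2, h3, h4, h5.lift π fun k l hkl => ⟨?_, hkl.2⟩⟩
  have := hkl.1
  simpa [windowGraph, SimpleGraph.fromRel_adj, Set.range_comp, π.range_eq_univ] using this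

theorem windowCrossing_congr {W : Set (Vertex d)} {c : EuclideanSpace ℝ (Fin d)} {r : ℝ}
    (hW : ∀ z : Vertex d, z.1 ∈ Metric.ball c (3 * r) → z ∈ W)
    {x x' : ℕ → Vertex d} {u u' : Sym2 ℕ → ℝ} (hx : ∀ n, x n ∈ W → x' n = x n)
    (hx' : ∀ n, x' n ∈ W → x' n = x n)
    (hu : ∀ i j, x i ∈ W → x j ∈ W → u s(i, j) = u' s(i, j))
    (h : (x, u) ∈ windowCrossing γ δ β W c r) : (x', u') ∈ windowCrossing γ δ β W c r := by
  have hr : range x ∩ W = range x' ∩ W := by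
    ext z
    constructor
    · rintro ⟨⟨n, rfl⟩, hz⟩
      exact ⟨⟨n, hx n hz⟩, hz⟩
    · rintro ⟨⟨n, rfl⟩, hz⟩
      exact ⟨⟨n, (hx' n hz).symm⟩, hz⟩
  obtain ⟨i, j, h1, h2, h3, h4, h5⟩ := h
  have ei := hx i (hW _ h3)
  have ej := hx j (hW _ h4)
  refine ⟨i, j, by simpa only [ei] using h1, by simpa only [ej] using h2,
    by simpa only [ei] using h3, by simpa only [ej] using h4, Relation.ReflTransGen.mono ?_ _ _ h5⟩
  rintro k l ⟨ha, hk, hl⟩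
  have ek := hx k (hW _ hk)
  have el := hx l (hW _ hl)
  refine ⟨?_, by simpa only [ek] using hk, by simpa only [el] using hl⟩
  have hu1 := hu k l (hW _ hk) (hW _ hl)
  have hu2 := hu l k (hW _ hl) (hW _ hk)
  simp only [windowGraph, SimpleGraph.fromRel_adj] at ha ⊢
  rwa [ek, el, ← hr, ← hu1, ← hu2]

/-- Translation of the location by `-c`. -/
def shift (c : EuclideanSpace ℝ (Fin d)) (z : Vertex d) : Vertex d := (z.1 - c, z.2)

theorem shift_injective (c : EuclideanSpace ℝ (Fin d)) : Function.Injective (shift c) := by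
  rintro ⟨a, u⟩ ⟨b, v⟩ h
  simpa [shift] using h

theorem interference_shift (c : EuclideanSpace ℝ (Fin d)) (z : Vertex d) (η : Set (Vertex d)) :
    interference d β (shift c z) (shift c '' η) = interference d β z η := by
  rw [interference, interference]
  conv_rhs => rw [← (shift_injective c).encard_image]
  congr 1
  ext w
  constructor
  · rintro ⟨⟨y, hy, rfl⟩, hw⟩
    exact ⟨y, ⟨hy, by simpa [shift] using hw⟩, rfl⟩
  · rintro ⟨y, ⟨hy, hw⟩, rfl⟩
    exact ⟨⟨y, hy, rfl⟩, by simpa [shift] using hw⟩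

theorem connProb_shift (c : EuclideanSpace ℝ (Fin d)) (y z : Vertex d) (η : Set (Vertex d)) :
    connProb d γ δ β (shift c y) (shift c z) (shift c '' η) = connProb d γ δ β y z η := by
  simp only [connProb, halfProb, interference_shift]
  simp [shift]

theorem windowGraph_shift (c : EuclideanSpace ℝ (Fin d)) {W W' : Set (Vertex d)}
    (hW : shift c ⁻¹' W' = W) (x : ℕ → Vertex d) (u : Sym2 ℕ → ℝ) :
    windowGraph γ δ β W' (shift c ∘ x) u = windowGraph γ δ β W x u := by
  have : ∀ i j, (range (shift c ∘ x) ∩ W') \ {shift c (x i), shift c (x j)} =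
      shift c '' ((range x ∩ W) \ {x i, x j}) := by
    intro i j
    rw [image_sdiff (shift_injective c), image_pair, range_comp, ← hW, image_inter_preimage]
  simp only [windowGraph, Function.comp_apply, this, connProb_shift]

theorem windowCrossing_shift (c : EuclideanSpace ℝ (Fin d)) {W W' : Set (Vertex d)}
    (hW : shift c ⁻¹' W' = W) (r : ℝ) (x : ℕ → Vertex d) (u : Sym2 ℕ → ℝ) :
    (shift c ∘ x, u) ∈ windowCrossing γ δ β W' 0 r ↔ (x, u) ∈ windowCrossing γ δ β W c r := by
  have hb : ∀ (z : Vertex d) (s : ℝ), (shift c z).1 ∈ Metric.ball 0 s ↔ z.1 ∈ Metric.ball c s := by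
    intro z s
    simp [shift, dist_eq_norm]
  have hr : windowRel γ δ β W' 0 r (shift c ∘ x, u) = windowRel γ δ β W c r (x, u) := by
    funext i j
    simp only [windowRel, windowGraph_shift c hW, Function.comp_apply, hb]
  simp only [windowCrossing, mem_ofPred_eq, Function.comp_apply, hb, hr]

end WindowGraph

/-! ### The law of the edge variables: exchangeability and independence. -/

section EdgeVariables

instance : IsProbabilityMeasure (volume.restrict (Icc (0 : ℝ) 1)) :=
  ⟨by rw [Measure.restrict_apply_univ]; simp⟩

/-- The law of the edge variables. -/
def edgeMeasure : Measure (Sym2 ℕ → ℝ) :=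
  Measure.infinitePi fun _ => volume.restrict (Icc (0 : ℝ) 1)

instance : IsProbabilityMeasure edgeMeasure := by unfold edgeMeasure; infer_instance

theorem measurePreserving_relabel (π : Equiv.Perm ℕ) :
    MeasurePreserving (fun u : Sym2 ℕ → ℝ => u ∘ Sym2.map π) edgeMeasure edgeMeasure := by
  refine ⟨measurable_pi_lambda _ fun e => measurable_pi_apply _, ?_⟩
  exact Measure.map_infinitePi_infinitePi_of_inj (P := fun _ : Sym2 ℕ =>
    volume.restrict (Icc (0 : ℝ) 1)) (Sym2.map.injective π.injective)

/-- Setting all coordinates outside `B` to zero is measurable for the σ-algebra of the coordinates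
in `B`, and `T` is its own preimage under that map. -/
theorem measurableSet_iSup_of_dependsOn {B : Set (Sym2 ℕ)} {T : Set (Sym2 ℕ → ℝ)}
    (hT : MeasurableSet T)
    (hd : ∀ u u' : Sym2 ℕ → ℝ, (∀ e ∈ B, u e = u' e) → u ∈ T → u' ∈ T) :
    MeasurableSet[⨆ e ∈ B, MeasurableSpace.comap (fun u : Sym2 ℕ → ℝ => u e) inferInstance] T := by
  classical
  let f : (Sym2 ℕ → ℝ) → Sym2 ℕ → ℝ := fun u e => if e ∈ B then u e else 0
  have hfe : ∀ u, ∀ e ∈ B, f u e = u e := fun u e he => if_pos he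
  have hT' : T = f ⁻¹' T := by
    ext u
    exact ⟨hd _ _ fun e he => (hfe u e he).symm, hd _ _ fun e he => hfe u e he⟩
  have hf : Measurable[⨆ e ∈ B, MeasurableSpace.comap (fun u : Sym2 ℕ → ℝ => u e) inferInstance] f := by
    refine @measurable_pi_lambda _ _ _ (_) _ _ fun e => ?_
    by_cases he : e ∈ B
    · have : (fun u => f u e) = fun u => u e := by funext u; exact hfe u e he
      rw [this]
      refine Measurable.mono ?_ (le_iSup₂_of_le e he le_rfl) le_rfl
      exact comap_measurable _
    · have : (fun u => f u e) = fun _ => 0 := by funext u; exact if_neg he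
      rw [this]
      exact measurable_const
  rw [hT']
  exact hf hT

theorem edgeMeasure_inter {B B' : Set (Sym2 ℕ)} (hBB' : Disjoint B B') {T T' : Set (Sym2 ℕ → ℝ)}
    (hT : MeasurableSet T) (hT' : MeasurableSet T')
    (hd : ∀ u u' : Sym2 ℕ → ℝ, (∀ e ∈ B, u e = u' e) → u ∈ T → u' ∈ T)
    (hd' : ∀ u u' : Sym2 ℕ → ℝ, (∀ e ∈ B', u e = u' e) → u ∈ T' → u' ∈ T') :
    edgeMeasure (T ∩ T') = edgeMeasure T * edgeMeasure T' := by
  have hi : iIndepFun (fun (e : Sym2 ℕ) (u : Sym2 ℕ → ℝ) => u e) edgeMeasure :=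
    iIndepFun_infinitePi (X := fun _ u => u) (fun _ => measurable_id)
  have := indep_iSup_of_disjoint (fun e => (measurable_pi_apply e).comap_le) hi.iIndep hBB'
  rw [Indep_iff] at this
  exact this T T' (measurableSet_iSup_of_dependsOn hT hd) (measurableSet_iSup_of_dependsOn hT' hd')

end EdgeVariables

/-- Injectivity forces a bijection between the indices of points in `W`. These index sets are
finite, so their complements are both countably infinite and can be matched arbitrarily. -/
theorem exists_perm_of_window_eq {α : Type*} {W : Set α} {x x' : ℕ → α}
    (hx : Function.Injective x) (hx' : Function.Injective x') (hf : {n | x n ∈ W}.Finite)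
    (hf' : {n | x' n ∈ W}.Finite) (h : ∀ z ∈ W, (∃ n, x n = z) ↔ ∃ n, x' n = z) :
    ∃ π : Equiv.Perm ℕ, (∀ n, x n ∈ W → x' (π n) = x n) ∧
      ∀ n, x' (π n) ∈ W → x' (π n) = x n := by
  classical
  set I : Set ℕ := {n | x n ∈ W} with hI
  set I' : Set ℕ := {n | x' n ∈ W} with hI'
  have h1 : ∀ n : I, ∃ m, x' m = x n := fun n => (h _ n.2).1 ⟨n, rfl⟩
  choose f hfx using h1
  have hfI : ∀ n : I, f n ∈ I' := fun n => by
    change x' (f n) ∈ W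
    rw [hfx]
    exact n.2
  let F : I → I' := fun n => ⟨f n, hfI n⟩
  have hF : Function.Bijective F := by
    constructor
    · intro m n hmn
      have : f m = f n := congrArg Subtype.val hmn
      exact Subtype.ext (hx (by rw [← hfx, ← hfx, this]))
    · rintro ⟨m, hm⟩
      obtain ⟨n, hn⟩ := (h _ hm).2 ⟨m, rfl⟩
      have hnI : n ∈ I := by change x n ∈ W; rw [hn]; exact hm
      exact ⟨⟨n, hnI⟩, Subtype.ext (hx' (by change x' (f _) = _; rw [hfx, hn]))⟩
  have : Infinite ↥(Iᶜ) := hf.infinite_compl.to_subtype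
  have : Infinite ↥(I'ᶜ) := hf'.infinite_compl.to_subtype
  obtain ⟨G⟩ : Nonempty (↥(Iᶜ) ≃ ↥(I'ᶜ)) := nonempty_equiv_of_countable
  let π : Equiv.Perm ℕ := (Equiv.Set.sumCompl I).symm.trans
    ((Equiv.sumCongr (Equiv.ofBijective F hF) G).trans (Equiv.Set.sumCompl I'))
  have hπ : ∀ n (hn : n ∈ I), π n = f ⟨n, hn⟩ := by
    intro n hn
    simp [π, Equiv.Set.sumCompl_symm_apply_of_mem hn, F]
  have hπ' : ∀ n, n ∉ I → π n ∉ I' := by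
    intro n hn
    simp only [π, Equiv.trans_apply, Equiv.Set.sumCompl_symm_apply_of_notMem hn,
      Equiv.sumCongr_apply, Sum.map_inr, Equiv.Set.sumCompl_apply_inr]
    exact (G _).2
  refine ⟨π, fun n hn => by rw [hπ n hn, hfx], fun n hn => ?_⟩
  by_cases hnI : n ∈ I
  · rw [hπ n hnI, hfx]
  · exact absurd hn (hπ' n hnI)

/-! ### Local crossing events: independence, stationarity, comparison with true crossings. -/

section Sample

variable {d : ℕ} {γ δ β : ℝ}

/-- The window `B(c,4r) × ℝ`. -/
def localWindow (c : EuclideanSpace ℝ (Fin d)) (r : ℝ) : Set (Vertex d) :=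
  Metric.ball c (4 * r) ×ˢ univ

theorem measurableSet_localWindow (c : EuclideanSpace ℝ (Fin d)) (r : ℝ) :
    MeasurableSet (localWindow c r) :=
  Metric.isOpen_ball.measurableSet.prod MeasurableSet.univ

theorem mem_localWindow {c : EuclideanSpace ℝ (Fin d)} {r : ℝ} {z : Vertex d}
    (hz : z.1 ∈ Metric.ball c (3 * r)) : z ∈ localWindow c r := by
  refine ⟨?_, mem_univ _⟩
  rw [Metric.mem_ball] at hz ⊢
  have := dist_nonneg.trans_lt hz
  linarith

/-- The conditional probability of the windowed crossing event given the vertices. -/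
def condCrossing (γ δ β : ℝ) (W : Set (Vertex d)) (c : EuclideanSpace ℝ (Fin d)) (r : ℝ)
    (x : ℕ → Vertex d) : ℝ≥0∞ :=
  edgeMeasure (Prod.mk x ⁻¹' windowCrossing γ δ β W c r)

theorem measurable_condCrossing {W : Set (Vertex d)} (hW : MeasurableSet W)
    (c : EuclideanSpace ℝ (Fin d)) (r : ℝ) : Measurable (condCrossing γ δ β W c r) :=
  measurable_measure_prodMk_left (measurableSet_windowCrossing γ δ β hW c r)

/-- Two sequences with the same points in the window differ there only by a relabelling, and the law
of the edge variables is invariant under relabelling the indices. -/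
theorem dependsOnWindow_condCrossing (c : EuclideanSpace ℝ (Fin d)) (r : ℝ) :
    DependsOnWindow (localWindow c r) (condCrossing γ δ β (localWindow c r) c r) := by
  intro x x' hx hx' hf hf' h
  obtain ⟨π, hπ, hπ'⟩ := exists_perm_of_window_eq hx hx' hf hf' h
  have hms := measurableSet_windowCrossing γ δ β (measurableSet_localWindow c r) c r
  have e : Prod.mk x ⁻¹' windowCrossing γ δ β (localWindow c r) c r =
      (fun u : Sym2 ℕ → ℝ => u ∘ Sym2.map π.symm) ⁻¹'
        (Prod.mk x' ⁻¹' windowCrossing γ δ β (localWindow c r) c r) := by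
    ext u
    simp only [mem_preimage]
    constructor
    · intro hu
      refine windowCrossing_relabel π ?_
      have : (u ∘ Sym2.map π.symm) ∘ Sym2.map π = u := by
        funext e
        simp [Sym2.map_map]
      rw [this]
      exact windowCrossing_congr (fun z hz => mem_localWindow hz) hπ hπ' (fun _ _ _ _ => rfl) hu
    · intro hu
      have h2 : (x' ∘ π, u) ∈ windowCrossing γ δ β (localWindow c r) c r := by
        refine windowCrossing_relabel π.symm ?_
        rwa [Function.comp_assoc, Equiv.self_comp_symm, Function.comp_id]
      exact windowCrossing_congr (fun z hz => mem_localWindow hz)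
        (fun n hn => (hπ' n hn).symm) (fun n hn => (hπ n hn).symm) (fun _ _ _ _ => rfl) h2
  rw [condCrossing, condCrossing, e, (measurePreserving_relabel π.symm).measure_preimage
    (measurable_prodMk_left hms).nullMeasurableSet]

/-- For fixed vertices each event depends only on the edge variables of pairs inside its own window,
and no pair lies in two disjoint windows. -/
theorem edgeMeasure_windowCrossing_inter {c c' : EuclideanSpace ℝ (Fin d)} {r r' : ℝ}
    (hd : Disjoint (localWindow c r) (localWindow c' r')) (x : ℕ → Vertex d) :
    edgeMeasure (Prod.mk x ⁻¹' (windowCrossing γ δ β (localWindow c r) c r ∩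
      windowCrossing γ δ β (localWindow c' r') c' r')) =
    condCrossing γ δ β (localWindow c r) c r x *
      condCrossing γ δ β (localWindow c' r') c' r' x := by
  have hms := fun (c : EuclideanSpace ℝ (Fin d)) r => measurable_prodMk_left (x := x)
    (measurableSet_windowCrossing γ δ β (measurableSet_localWindow c r) c r)
  have hdep : ∀ (c : EuclideanSpace ℝ (Fin d)) (r : ℝ) (u u' : Sym2 ℕ → ℝ),
      (∀ e ∈ {e : Sym2 ℕ | ∀ i ∈ e, x i ∈ localWindow c r}, u e = u' e) →
      u ∈ Prod.mk x ⁻¹' windowCrossing γ δ β (localWindow c r) c r →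
      u' ∈ Prod.mk x ⁻¹' windowCrossing γ δ β (localWindow c r) c r := by
    intro c r u u' huu' hu
    refine windowCrossing_congr (fun z hz => mem_localWindow hz) (fun _ _ => rfl)
      (fun _ _ => rfl) (fun i j hi hj => huu' _ ?_) hu
    intro k hk
    rcases Sym2.mem_iff.1 hk with rfl | rfl <;> assumption
  rw [preimage_inter, edgeMeasure_inter ?_ (hms c r) (hms c' r') (hdep c r) (hdep c' r')]
  · rfl
  · rw [disjoint_left] at hd ⊢
    intro e he he'
    induction e with
    | _ i j => exact hd (he i (by simp)) (he' i (by simp))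

variable {Ω : Type*} [MeasurableSpace Ω] {l : ℝ} {P : Measure Ω} {X : ℕ → Ω → Vertex d}
  {U : Sym2 ℕ → Ω → ℝ}

/-- The vertices and edge variables as a random element of the canonical space. -/
def sample (X : ℕ → Ω → Vertex d) (U : Sym2 ℕ → Ω → ℝ) (ω : Ω) :
    (ℕ → Vertex d) × (Sym2 ℕ → ℝ) :=
  (fun n => X n ω, fun e => U e ω)

theorem IsSample.measurable_sample (h : IsSample d l P X U) : Measurable (sample X U) :=
  (measurable_pi_lambda _ h.vertices.measurable).prodMk (measurable_pi_lambda _ h.measurable_unif)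

theorem IsSample.map_unif (h : IsSample d l P X U) :
    P.map (fun ω e => U e ω) = edgeMeasure := by
  rw [h.indep_unif.map_fun_eq_infinitePi_map h.measurable_unif]
  simp_rw [h.unif]
  rfl

theorem IsSample.measure_sample_preimage (h : IsSample d l P X U)
    {A : Set ((ℕ → Vertex d) × (Sym2 ℕ → ℝ))} (hA : MeasurableSet A) :
    P (sample X U ⁻¹' A) = ∫⁻ ω, edgeMeasure (Prod.mk (fun n => X n ω) ⁻¹' A) ∂P := by
  have := h.vertices.isProbabilityMeasure
  have mX : Measurable fun ω n => X n ω := measurable_pi_lambda _ h.vertices.measurable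
  have mU : Measurable fun ω e => U e ω := measurable_pi_lambda _ h.measurable_unif
  have := (indepFun_iff_map_prod_eq_prod_map_map mX.aemeasurable mU.aemeasurable).1 h.indep
  rw [← Measure.map_apply h.measurable_sample hA]
  change (P.map fun ω => ((fun n => X n ω), fun e => U e ω)) A = _
  rw [this, h.map_unif, Measure.prod_apply hA, lintegral_map (measurable_measure_prodMk_left hA) mX]

/-- The local annulus-crossing event in which only the points of `B(c,4r)` interfere. -/
def localEvent (γ δ β : ℝ) (X : ℕ → Ω → Vertex d) (U : Sym2 ℕ → Ω → ℝ)
    (c : EuclideanSpace ℝ (Fin d)) (r : ℝ) : Set Ω :=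
  sample X U ⁻¹' windowCrossing γ δ β (localWindow c r) c r

theorem localCrossing_eq_preimage (c : EuclideanSpace ℝ (Fin d)) (r : ℝ) :
    localCrossing d γ δ β X U c r = sample X U ⁻¹' windowCrossing γ δ β univ c r := by
  ext ω
  exact mem_localCrossing_iff γ δ β X U ω c r

theorem IsSample.measurableSet_localCrossing (h : IsSample d l P X U)
    (c : EuclideanSpace ℝ (Fin d)) (r : ℝ) : MeasurableSet (localCrossing d γ δ β X U c r) := by
  rw [localCrossing_eq_preimage]
  exact h.measurable_sample (measurableSet_windowCrossing γ δ β MeasurableSet.univ c r)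

theorem intensity_localWindow_ne_top (c : EuclideanSpace ℝ (Fin d)) (r : ℝ) :
    intensity d l (localWindow c r) ≠ ∞ :=
  intensity_cylinder_ne_top measure_ball_lt_top.ne

/-- Conditioning on the vertices splits the edge randomness; the conditional probabilities are
functionals of disjoint windows, hence uncorrelated. -/
theorem IsSample.measure_localEvent_inter (h : IsSample d l P X U)
    {c c' : EuclideanSpace ℝ (Fin d)} {r r' : ℝ}
    (hd : Disjoint (localWindow c r) (localWindow c' r')) :
    P (localEvent γ δ β X U c r ∩ localEvent γ δ β X U c' r') =
      P (localEvent γ δ β X U c r) * P (localEvent γ δ β X U c' r') := by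
  have hms := fun (c : EuclideanSpace ℝ (Fin d)) r =>
    measurableSet_windowCrossing γ δ β (measurableSet_localWindow c r) c r
  rw [localEvent, localEvent, ← preimage_inter,
    h.measure_sample_preimage ((hms c r).inter (hms c' r')),
    h.measure_sample_preimage (hms c r), h.measure_sample_preimage (hms c' r')]
  simp_rw [edgeMeasure_windowCrossing_inter hd]
  exact h.vertices.lintegral_mul_window (ae_injective h.vertices) (measurableSet_localWindow c r)
    (measurableSet_localWindow c' r') (intensity_localWindow_ne_top c r)
    (intensity_localWindow_ne_top c' r') hd
    (measurable_condCrossing (measurableSet_localWindow c r) c r)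
    (measurable_condCrossing (measurableSet_localWindow c' r') c' r')
    (dependsOnWindow_condCrossing c r) (dependsOnWindow_condCrossing c' r')

theorem measurePreserving_shift (c : EuclideanSpace ℝ (Fin d)) :
    MeasurePreserving (shift c) (intensity d l) (intensity d l) := by
  have h : MeasurePreserving (Prod.map (fun x : EuclideanSpace ℝ (Fin d) => x - c) (id : ℝ → ℝ))
      ((volume : Measure (EuclideanSpace ℝ (Fin d))).prod (volume.restrict (Ioo (0 : ℝ) 1)))
      ((volume : Measure (EuclideanSpace ℝ (Fin d))).prod (volume.restrict (Ioo (0 : ℝ) 1))) :=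
    (measurePreserving_sub_right volume c).prod (MeasurePreserving.id _)
  exact h.smul_measure (ENNReal.ofReal l)

theorem IsPoissonProcess.shift (h : IsPoissonProcess P (intensity d l) X)
    (c : EuclideanSpace ℝ (Fin d)) :
    IsPoissonProcess P (intensity d l) fun n ω => SoftBoolean.shift c (X n ω) := by
  have hs := measurePreserving_shift (l := l) c
  refine ⟨fun n => hs.measurable.comp (h.measurable n), fun A hA hfin k => ?_, fun m A hA hd => ?_⟩
  · have := h.poisson (SoftBoolean.shift c ⁻¹' A) (hs.measurable hA)
      (by rwa [hs.measure_preimage hA.nullMeasurableSet]) k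
    rwa [hs.measure_preimage hA.nullMeasurableSet] at this
  · exact h.indep m (fun i => SoftBoolean.shift c ⁻¹' A i) (fun i => hs.measurable (hA i))
      fun i j hij => (hd hij).preimage _

theorem shift_preimage_localWindow (c : EuclideanSpace ℝ (Fin d)) (r : ℝ) :
    shift c ⁻¹' localWindow 0 r = localWindow c r := by
  ext z
  simp [localWindow, shift, dist_eq_norm]

/-- The edge variables are attached to indices, so only the vertices move under translation. The
translated process has the same intensity, which determines the law of window functionals. -/
theorem IsSample.measure_localEvent_eq (h : IsSample d l P X U) (c : EuclideanSpace ℝ (Fin d))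
    (r : ℝ) : P (localEvent γ δ β X U c r) = P (localEvent γ δ β X U 0 r) := by
  have hms := fun (c : EuclideanSpace ℝ (Fin d)) r =>
    measurableSet_windowCrossing γ δ β (measurableSet_localWindow c r) c r
  rw [localEvent, localEvent, h.measure_sample_preimage (hms c r),
    h.measure_sample_preimage (hms 0 r)]
  have hs := h.vertices.shift c
  have e : ∀ ω, edgeMeasure (Prod.mk (fun n => X n ω) ⁻¹'
      windowCrossing γ δ β (localWindow c r) c r) =
      condCrossing γ δ β (localWindow 0 r) 0 r fun n => SoftBoolean.shift c (X n ω) := by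
    intro ω
    rw [condCrossing]
    congr 1
    ext u
    exact (windowCrossing_shift c (shift_preimage_localWindow c r) r (fun n => X n ω) u).symm
  simp_rw [e]
  exact hs.lintegral_window_eq h.vertices (ae_injective hs) (ae_injective h.vertices)
    (measurableSet_localWindow 0 r) (intensity_localWindow_ne_top 0 r)
    (measurable_condCrossing (measurableSet_localWindow 0 r) 0 r)
    (dependsOnWindow_condCrossing 0 r)

theorem interference_inter_eq {z : Vertex d} {r : ℝ} (hd : d ≠ 0) (hr : 0 ≤ r)
    {c : EuclideanSpace ℝ (Fin d)}
    (hz : z.1 ∈ Metric.ball c (3 * r)) (hu : z.2 ^ (-β) ≤ r ^ d) (η η' : Set (Vertex d)) :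
    interference d β z ((η ∩ localWindow c r) \ η') = interference d β z (η \ η') := by
  unfold interference
  congr 1
  ext w
  simp only [mem_ofPred_eq, Set.mem_sdiff, mem_inter_iff]
  constructor
  · rintro ⟨⟨⟨h1, -⟩, h2⟩, h3⟩
    exact ⟨⟨h1, h2⟩, h3⟩
  · rintro ⟨⟨h1, h2⟩, h3⟩
    refine ⟨⟨⟨h1, ⟨?_, mem_univ _⟩⟩, h2⟩, h3⟩
    have h4 : ‖z.1 - w.1‖ ≤ r := le_of_pow_le_pow_left₀ hd hr (h3.trans hu)
    rw [Metric.mem_ball] at hz ⊢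
    have := dist_triangle w.1 z.1 c
    rw [dist_comm w.1 z.1, dist_eq_norm z.1 w.1] at this
    linarith

/-- Off the event that a vertex in `B(c,3r)` has a sphere of interference of radius above `r`, the
local event is the local annulus-crossing event. -/
theorem mem_localEvent_iff {c : EuclideanSpace ℝ (Fin d)} {r : ℝ} (hd : d ≠ 0) (hr : 0 ≤ r) {ω : Ω}
    (hω : ∀ n, (X n ω).1 ∈ Metric.ball c (3 * r) → (X n ω).2 ^ (-β) ≤ r ^ d) :
    ω ∈ localEvent γ δ β X U c r ↔ ω ∈ localCrossing d γ δ β X U c r := by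
  rw [localCrossing_eq_preimage, localEvent, mem_preimage, mem_preimage]
  have hrel : windowRel γ δ β (localWindow c r) c r (sample X U ω) =
      windowRel γ δ β univ c r (sample X U ω) := by
    funext i j
    simp only [windowRel, eq_iff_iff]
    refine and_congr_left fun ⟨hi, hj⟩ => ?_
    have key : ∀ i j, (X i ω).1 ∈ Metric.ball c (3 * r) → (X j ω).1 ∈ Metric.ball c (3 * r) →
        connProb d γ δ β (X i ω) (X j ω)
          ((range (fun n => X n ω) ∩ localWindow c r) \ {X i ω, X j ω}) =
        connProb d γ δ β (X i ω) (X j ω) ((range fun n => X n ω) \ {X i ω, X j ω}) := by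
      intro i j hi hj
      simp only [connProb, halfProb, interference_inter_eq hd hr hi (hω i hi),
        interference_inter_eq hd hr hj (hω j hj)]
    simp only [windowGraph, SimpleGraph.fromRel_adj, inter_univ]
    have k1 := key i j hi hj
    have k2 := key j i hj hi
    simp only [sample] at k1 k2 ⊢
    rw [k1, k2]
  simp only [windowCrossing, mem_ofPred_eq, hrel]

end Sample

/-! ### Logarithmic limits of power bounds. -/

section LogLimits

/-- The prefactor contributes `log C / (k log r)`, which vanishes. The parameter `k` covers both
normalisations in use, `log r` and `d log r`. -/
theorem limsup_log_le_of_eventually_le {f : ℝ → ℝ≥0∞} {C a k : ℝ} (hC : 0 < C) (hk : 0 < k)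
    (hf : ∀ᶠ r in atTop, f r ≤ ENNReal.ofReal (C * r ^ a)) :
    limsup (fun r : ℝ => ENNReal.log (f r) / ((k * Real.log r : ℝ) : EReal)) atTop ≤
      ((a / k : ℝ) : EReal) := by
  have ht : Tendsto (fun r : ℝ => ((Real.log C / (k * Real.log r) + a / k : ℝ) : EReal)) atTop
      (𝓝 ((a / k : ℝ) : EReal)) := by
    refine (continuous_coe_real_ereal.tendsto _).comp ?_
    have h1 : Tendsto (fun r : ℝ => k * Real.log r) atTop atTop :=
      Real.tendsto_log_atTop.const_mul_atTop hk
    simpa using (h1.const_div_atTop (Real.log C)).add_const (a / k)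
  refine (limsup_le_limsup ?_).trans ht.limsup_eq.le
  filter_upwards [hf, eventually_gt_atTop 1] with r hr h1
  have hl : 0 < Real.log r := Real.log_pos h1
  have h0 : 0 < r := one_pos.trans h1
  calc ENNReal.log (f r) / ((k * Real.log r : ℝ) : EReal)
      ≤ ENNReal.log (ENNReal.ofReal (C * r ^ a)) / ((k * Real.log r : ℝ) : EReal) :=
        EReal.div_le_div_right_of_nonneg (by exact_mod_cast (mul_pos hk hl).le)
          (ENNReal.log_monotone hr)
    _ = ((Real.log C / (k * Real.log r) + a / k : ℝ) : EReal) := by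
        rw [ENNReal.log_ofReal_of_pos (by positivity), ← EReal.coe_div,
          Real.log_mul hC.ne' (by positivity), Real.log_rpow h0, add_div]
        congr 2
        field_simp

theorem le_limsup_log_of_eventually_ge {f : ℝ → ℝ≥0∞} {C a k : ℝ} (hC : 0 < C) (hk : 0 < k)
    (hf : ∀ᶠ r in atTop, ENNReal.ofReal (C * r ^ a) ≤ f r) :
    ((a / k : ℝ) : EReal) ≤
      limsup (fun r : ℝ => ENNReal.log (f r) / ((k * Real.log r : ℝ) : EReal)) atTop := by
  have ht : Tendsto (fun r : ℝ => ((Real.log C / (k * Real.log r) + a / k : ℝ) : EReal)) atTop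
      (𝓝 ((a / k : ℝ) : EReal)) := by
    refine (continuous_coe_real_ereal.tendsto _).comp ?_
    have h1 : Tendsto (fun r : ℝ => k * Real.log r) atTop atTop :=
      Real.tendsto_log_atTop.const_mul_atTop hk
    simpa using (h1.const_div_atTop (Real.log C)).add_const (a / k)
  refine ht.limsup_eq.ge.trans (limsup_le_limsup ?_)
  filter_upwards [hf, eventually_gt_atTop 1] with r hr h1
  have hl : 0 < Real.log r := Real.log_pos h1
  have h0 : 0 < r := one_pos.trans h1
  calc ((Real.log C / (k * Real.log r) + a / k : ℝ) : EReal)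
      = ENNReal.log (ENNReal.ofReal (C * r ^ a)) / ((k * Real.log r : ℝ) : EReal) := by
        rw [ENNReal.log_ofReal_of_pos (by positivity), ← EReal.coe_div,
          Real.log_mul hC.ne' (by positivity), Real.log_rpow h0, add_div]
        congr 2
        field_simp
    _ ≤ ENNReal.log (f r) / ((k * Real.log r : ℝ) : EReal) :=
        EReal.div_le_div_right_of_nonneg (by exact_mod_cast (mul_pos hk hl).le)
          (ENNReal.log_monotone hr)

theorem limsup_log_eq_bot {f : ℝ → ℝ≥0∞} (hf : ∀ᶠ r in atTop, f r = 0) :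
    limsup (fun r : ℝ => ENNReal.log (f r) / ((Real.log r : ℝ) : EReal)) atTop = ⊥ := by
  have : (fun r : ℝ => ENNReal.log (f r) / ((Real.log r : ℝ) : EReal)) =ᶠ[atTop]
      fun _ => (⊥ : EReal) := by
    filter_upwards [hf, eventually_gt_atTop 1] with r hr h1
    rw [hr, ENNReal.log_zero, EReal.bot_div_of_pos_ne_top
      (by exact_mod_cast Real.log_pos h1) (EReal.coe_ne_top _)]
  rw [limsup_congr this, limsup_const]

end LogLimits

/-! ### Polynomial mixing. -/

section Mixing

variable {d : ℕ} {γ δ β : ℝ}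

/-- The volume of the unit ball. -/
def ballVolume (d : ℕ) : ℝ := (volume (Metric.ball (0 : EuclideanSpace ℝ (Fin d)) 1)).toReal

theorem ballVolume_pos (d : ℕ) : 0 < ballVolume d :=
  ENNReal.toReal_pos (Metric.measure_ball_pos _ _ one_pos).ne' measure_ball_lt_top.ne

theorem volume_ball_eq [NeZero d] (c : EuclideanSpace ℝ (Fin d)) {R : ℝ} (hR : 0 ≤ R) :
    volume (Metric.ball c R) = ENNReal.ofReal (ballVolume d * R ^ d) := by
  rw [Measure.addHaar_ball _ _ hR, ballVolume, mul_comm, ENNReal.ofReal_mul (by positivity),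
    ENNReal.ofReal_toReal measure_ball_lt_top.ne, finrank_euclideanSpace_fin]

variable {Ω : Type*} [MeasurableSpace Ω] {l : ℝ} {P : Measure Ω} {X : ℕ → Ω → Vertex d}
  {U : Sym2 ℕ → Ω → ℝ}

theorem measure_lowMark_le [NeZero d] (h : IsPoissonProcess P (intensity d l) X) (hl : 0 ≤ l)
    (c : EuclideanSpace ℝ (Fin d)) {R a : ℝ} (hR : 0 ≤ R) :
    P {ω | ∃ n, (X n ω).1 ∈ Metric.ball c R ∧ (X n ω).2 < a} ≤
      ENNReal.ofReal (l * (ballVolume d * R ^ d) * a) := by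
  have hκ := ballVolume_pos d
  have : {ω | ∃ n, (X n ω).1 ∈ Metric.ball c R ∧ (X n ω).2 < a} =
      {ω | ∃ n, X n ω ∈ Metric.ball c R ×ˢ Iio a} := by
    ext ω; simp
  rw [this]
  refine (h.measure_exists_mem_le (Metric.isOpen_ball.measurableSet.prod measurableSet_Iio)).trans ?_
  rw [intensity_prod, volume_ball_eq c hR, mul_assoc l, ENNReal.ofReal_mul hl,
    ENNReal.ofReal_mul (p := ballVolume d * R ^ d) (by positivity)]
  gcongr
  rw [Measure.restrict_apply measurableSet_Iio]
  calc volume (Iio a ∩ Ioo 0 1) ≤ volume (Ioo 0 a) := measure_mono fun x hx => ⟨hx.2.1, hx.1⟩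
    _ = ENNReal.ofReal a := by simp

/-- A vertex located in `B(c,R)` has a sphere of interference of radius above `r`. -/
def highInterference (β : ℝ) (X : ℕ → Ω → Vertex d) (c : EuclideanSpace ℝ (Fin d)) (R r : ℝ) :
    Set Ω :=
  {ω | ∃ n, (X n ω).1 ∈ Metric.ball c R ∧ r ^ d < (X n ω).2 ^ (-β)}

/-- An upper bound for the probability of `highInterference`. -/
def interferenceBound (d : ℕ) (β l R r : ℝ) : ℝ :=
  if β = 0 then 0 else l * (ballVolume d * R ^ d) * r ^ (-(d : ℝ) / β)

theorem interferenceBound_nonneg (β : ℝ) (hl : 0 ≤ l) {R r : ℝ} (hR : 0 ≤ R) (hr : 0 ≤ r) :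
    0 ≤ interferenceBound d β l R r := by
  have := ballVolume_pos d
  unfold interferenceBound
  split_ifs
  · exact le_rfl
  · positivity

/-- A sphere of interference of radius above `r` means a mark below `r ^ (-d / β)`. For `β = 0` all
these spheres have radius one, so the event is empty for `r ≥ 1`; this is the source of the mixing
exponent `-∞`. -/
theorem measure_highInterference_le [NeZero d] (h : IsPoissonProcess P (intensity d l) X)
    (hl : 0 ≤ l) (hβ : 0 ≤ β) (c : EuclideanSpace ℝ (Fin d)) {R r : ℝ} (hR : 0 ≤ R) (hr : 1 ≤ r) :
    P (highInterference β X c R r) ≤ ENNReal.ofReal (interferenceBound d β l R r) := by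
  have hr0 : 0 < r := one_pos.trans_le hr
  rcases hβ.eq_or_lt with rfl | hβ
  · have : highInterference (0 : ℝ) X c R r = ∅ := by
      rw [eq_empty_iff_forall_notMem]
      rintro ω ⟨n, -, hn⟩
      rw [neg_zero, Real.rpow_zero] at hn
      exact absurd hn (not_lt.2 (one_le_pow₀ hr))
    rw [this, measure_empty]
    exact zero_le
  rw [interferenceBound, if_neg hβ.ne']
  refine (measure_mono_ae ?_).trans (measure_lowMark_le h hl c (a := r ^ (-(d : ℝ) / β)) hR)
  filter_upwards [ae_mark_mem h] with ω hω
  rintro ⟨n, hn, hn'⟩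
  refine ⟨n, hn, ?_⟩
  by_contra! hcon
  have h2 := Real.rpow_le_rpow_of_nonpos (by positivity) hcon (neg_nonpos.2 hβ.le)
  rw [← Real.rpow_mul hr0.le] at h2
  have : -(d : ℝ) / β * -β = (d : ℝ) := by field_simp
  rw [this, Real.rpow_natCast] at h2
  exact absurd hn' (not_lt.2 h2)

theorem mem_localEvent_iff_of_notMem [NeZero d] {c : EuclideanSpace ℝ (Fin d)} {r : ℝ} (hr : 0 ≤ r)
    {ω : Ω} (hω : ω ∉ highInterference β X c (3 * r) r) :
    ω ∈ localEvent γ δ β X U c r ↔ ω ∈ localCrossing d γ δ β X U c r := by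
  refine mem_localEvent_iff (NeZero.ne d) hr fun n hn => ?_
  by_contra! hcon
  exact hω ⟨n, hn, hcon⟩

theorem disjoint_localWindow {c c' : EuclideanSpace ℝ (Fin d)} {r : ℝ} (h : 8 * r ≤ dist c c') :
    Disjoint (localWindow c r) (localWindow c' r) :=
  Disjoint.set_prod_left (Metric.ball_disjoint_ball (by linarith)) _ _

theorem abs_measureReal_sub_le {A A' B : Set Ω} [IsFiniteMeasure P] (h : A ⊆ A' ∪ B)
    (h' : A' ⊆ A ∪ B) : |P.real A - P.real A'| ≤ P.real B := by
  have h1 := (measureReal_mono h).trans (measureReal_union_le (μ := P) A' B)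
  have h2 := (measureReal_mono h').trans (measureReal_union_le (μ := P) A B)
  rw [abs_le]
  constructor <;> linarith

/-- The local versions have covariance zero. Passing to the true events changes the probability of
the intersection by at most `2 b` and the product of the probabilities by at most `2 b`. -/
theorem IsSample.abs_cov_le [NeZero d] (h : IsSample d l P X U) (hl : 0 ≤ l) (hβ : 0 ≤ β)
    {c c' : EuclideanSpace ℝ (Fin d)} {r : ℝ} (hr : 1 ≤ r) (hc : 8 * r ≤ dist c c') :
    |cov[(localCrossing d γ δ β X U c r).indicator (fun _ => (1 : ℝ)),
      (localCrossing d γ δ β X U c' r).indicator (fun _ => (1 : ℝ)); P]| ≤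
      4 * interferenceBound d β l (3 * r) r := by
  have := h.vertices.isProbabilityMeasure
  have hr0 : 0 ≤ r := zero_le_one.trans hr
  set A := localCrossing d γ δ β X U c r
  set B := localCrossing d γ δ β X U c' r
  set A' := localEvent γ δ β X U c r
  set B' := localEvent γ δ β X U c' r
  set D := highInterference β X c (3 * r) r
  set E := highInterference β X c' (3 * r) r
  set b := interferenceBound d β l (3 * r) r
  have hb : 0 ≤ b := interferenceBound_nonneg β hl (by positivity) hr0
  have hA : MeasurableSet A := h.measurableSet_localCrossing c r
  have hB : MeasurableSet B := h.measurableSet_localCrossing c' r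
  have hD : P.real D ≤ b := ENNReal.toReal_le_of_le_ofReal hb
    (measure_highInterference_le h.vertices hl hβ c (by positivity) hr)
  have hE : P.real E ≤ b := ENNReal.toReal_le_of_le_ofReal hb
    (measure_highInterference_le h.vertices hl hβ c' (by positivity) hr)
  have hAA' : ∀ ω, ω ∉ D → (ω ∈ A' ↔ ω ∈ A) := fun ω hω => mem_localEvent_iff_of_notMem hr0 hω
  have hBB' : ∀ ω, ω ∉ E → (ω ∈ B' ↔ ω ∈ B) := fun ω hω => mem_localEvent_iff_of_notMem hr0 hω
  have h1 : |P.real A - P.real A'| ≤ P.real D := by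
    refine abs_measureReal_sub_le (fun ω hω => ?_) fun ω hω => ?_ <;> by_cases hωD : ω ∈ D
    · exact Or.inr hωD
    · exact Or.inl ((hAA' ω hωD).2 hω)
    · exact Or.inr hωD
    · exact Or.inl ((hAA' ω hωD).1 hω)
  have h2 : |P.real B - P.real B'| ≤ P.real E := by
    refine abs_measureReal_sub_le (fun ω hω => ?_) fun ω hω => ?_ <;> by_cases hωD : ω ∈ E
    · exact Or.inr hωD
    · exact Or.inl ((hBB' ω hωD).2 hω)
    · exact Or.inr hωD
    · exact Or.inl ((hBB' ω hωD).1 hω)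
  have h3 : |P.real (A ∩ B) - P.real (A' ∩ B')| ≤ P.real (D ∪ E) := by
    refine abs_measureReal_sub_le (fun ω hω => ?_) fun ω hω => ?_ <;>
      by_cases hωD : ω ∈ D <;> by_cases hωE : ω ∈ E <;>
      simp only [mem_union, mem_inter_iff, hωD, hωE, or_true, or_false]
    · exact ⟨(hAA' ω hωD).2 hω.1, (hBB' ω hωE).2 hω.2⟩
    · exact ⟨(hAA' ω hωD).1 hω.1, (hBB' ω hωE).1 hω.2⟩
  have h4 : P.real (A' ∩ B') = P.real A' * P.real B' := by
    rw [measureReal_def, h.measure_localEvent_inter (disjoint_localWindow hc), ENNReal.toReal_mul]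
    rfl
  have h5 : P.real (D ∪ E) ≤ P.real D + P.real E := measureReal_union_le _ _
  have hmA : MemLp (A.indicator fun _ => (1 : ℝ)) 2 P :=
    memLp_indicator_const 2 hA 1 (Or.inr (measure_ne_top _ _))
  have hmB : MemLp (B.indicator fun _ => (1 : ℝ)) 2 P :=
    memLp_indicator_const 2 hB 1 (Or.inr (measure_ne_top _ _))
  have hcov : cov[A.indicator (fun _ => (1 : ℝ)), B.indicator (fun _ => (1 : ℝ)); P] =
      P.real (A ∩ B) - P.real A * P.real B := by
    rw [covariance_eq_sub hmA hmB]
    have e : (A.indicator (fun _ => (1 : ℝ)) * B.indicator fun _ => (1 : ℝ)) =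
        (A ∩ B).indicator fun _ => (1 : ℝ) := by
      funext ω
      by_cases h1 : ω ∈ A <;> by_cases h2 : ω ∈ B <;> simp [h1, h2]
    rw [e, integral_indicator_const _ (hA.inter hB), integral_indicator_const _ hA,
      integral_indicator_const _ hB]
    simp
  rw [hcov]
  rw [h4] at h3
  rw [abs_le] at h1 h2 h3 ⊢
  have a1 : P.real A' ≤ 1 := measureReal_le_one
  have a2 : P.real B ≤ 1 := measureReal_le_one
  have a3 : 0 ≤ P.real A' := measureReal_nonneg
  have a4 : 0 ≤ P.real B := measureReal_nonneg
  have k1 : P.real A' * P.real B' - P.real A * P.real B =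
    P.real A' * (P.real B' - P.real B) + (P.real A' - P.real A) * P.real B := by ring
  have k2 : P.real A' * (P.real B' - P.real B) ≤ b := by nlinarith
  have k3 : -b ≤ P.real A' * (P.real B' - P.real B) := by nlinarith
  have k4 : (P.real A' - P.real A) * P.real B ≤ b := by nlinarith
  have k5 : -b ≤ (P.real A' - P.real A) * P.real B := by nlinarith
  constructor <;> linarith

theorem mixingExponent_neg [NeZero d] (hβ : β ∈ Ico (0 : ℝ) 1) : mixingExponent d β < 0 := by
  unfold mixingExponent
  split_ifs with h
  · exact EReal.bot_lt_zero
  · have h0 : 0 < β := lt_of_le_of_ne hβ.1 (Ne.symm h)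
    have h1 : 1 < 1 / β := by rw [lt_div_iff₀ h0]; linarith [hβ.2]
    have hd : (0 : ℝ) < d := by exact_mod_cast Nat.pos_of_ne_zero (NeZero.ne d)
    exact_mod_cast mul_neg_of_pos_of_neg hd (by linarith)

theorem IsSample.polynomiallyMixing [NeZero d] (h : IsSample d l P X U) (hl : 0 < l)
    (hβ : β ∈ Ico (0 : ℝ) 1) : PolynomiallyMixing d γ δ β X U P (mixingExponent d β) := by
  refine ⟨mixingExponent_neg hβ, fun x hx => ?_⟩
  have hκ := ballVolume_pos d
  have hev : ∀ᶠ r : ℝ in atTop, ENNReal.ofReal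
      |cov[(localCrossing d γ δ β X U 0 r).indicator (fun _ => (1 : ℝ)),
        (localCrossing d γ δ β X U (r • x) r).indicator (fun _ => (1 : ℝ)); P]| ≤
      ENNReal.ofReal (4 * interferenceBound d β l (3 * r) r) := by
    filter_upwards [eventually_ge_atTop 1] with r hr
    -- The centres are at distance at least `10 r`, more than the `8 r` that makes windows of radius
    -- `4 r` disjoint.
    refine ENNReal.ofReal_le_ofReal (h.abs_cov_le hl.le hβ.1 hr ?_)
    rw [dist_zero_left, norm_smul, Real.norm_eq_abs, abs_of_pos (by linarith)]
    nlinarith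
  by_cases h0 : β = 0
  · rw [mixingExponent, if_pos h0]
    refine (limsup_log_eq_bot ?_).le
    filter_upwards [hev] with r hr
    rw [interferenceBound, if_pos h0] at hr
    simpa using hr
  · have h0' : 0 < β := lt_of_le_of_ne hβ.1 (Ne.symm h0)
    rw [mixingExponent, if_neg h0]
    have := limsup_log_le_of_eventually_le (C := 4 * (l * (ballVolume d * 3 ^ d)))
      (a := (d : ℝ) * (1 - 1 / β)) (k := 1) (by positivity) one_pos (f := fun r => ENNReal.ofReal
        |cov[(localCrossing d γ δ β X U 0 r).indicator (fun _ => (1 : ℝ)),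
          (localCrossing d γ δ β X U (r • x) r).indicator (fun _ => (1 : ℝ)); P]|) ?_
    · simpa only [one_mul, div_one] using this
    · filter_upwards [hev, eventually_ge_atTop 1] with r hr h1
      refine hr.trans (ENNReal.ofReal_le_ofReal (le_of_eq ?_))
      rw [interferenceBound, if_neg h0, mul_pow]
      have : r ^ ((d : ℝ) * (1 - 1 / β)) = r ^ d * r ^ (-(d : ℝ) / β) := by
        rw [← Real.rpow_natCast, ← Real.rpow_add (by linarith)]
        congr 1
        ring
      rw [this]
      ring

end Mixing

/-! ### The annealed connection function. -/

section Annealed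

variable {d : ℕ} {γ δ β : ℝ} {Ω : Type*} [MeasurableSpace Ω] {l : ℝ} {P : Measure Ω}
  {X : ℕ → Ω → Vertex d}

/-- The sphere of interference of `z`. -/
def interferenceSet (d : ℕ) (β : ℝ) (z : Vertex d) : Set (Vertex d) :=
  {w | ‖z.1 - w.1‖ ^ d ≤ z.2 ^ (-β)}

theorem interferenceSet_eq [NeZero d] {z : Vertex d} (hz : 0 ≤ z.2 ^ (-β)) :
    interferenceSet d β z = Metric.closedBall z.1 ((z.2 ^ (-β)) ^ (d : ℝ)⁻¹) ×ˢ univ := by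
  ext w
  have hd : (0 : ℝ) < d := by exact_mod_cast Nat.pos_of_ne_zero (NeZero.ne d)
  simp only [interferenceSet, mem_ofPred_eq, mem_prod, Metric.mem_closedBall, mem_univ, and_true]
  rw [Real.le_rpow_inv_iff_of_pos dist_nonneg hz hd, Real.rpow_natCast, dist_comm, dist_eq_norm]

theorem intensity_interferenceSet [NeZero d] (hl : 0 ≤ l) {z : Vertex d} (hz : 0 ≤ z.2 ^ (-β)) :
    intensity d l (interferenceSet d β z) = ENNReal.ofReal (l * ballVolume d * z.2 ^ (-β)) := by
  have hd : (d : ℝ) ≠ 0 := by exact_mod_cast NeZero.ne d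
  rw [interferenceSet_eq hz, intensity_cylinder, Measure.addHaar_closedBall_eq_addHaar_ball,
    volume_ball_eq _ (by positivity), ← Real.rpow_natCast, ← Real.rpow_mul hz, inv_mul_cancel₀ hd,
    Real.rpow_one, ← ENNReal.ofReal_mul hl, mul_assoc]

theorem measurableSet_interferenceSet [NeZero d] {z : Vertex d} (hz : 0 ≤ z.2 ^ (-β)) :
    MeasurableSet (interferenceSet d β z) := by
  rw [interferenceSet_eq hz]
  exact Metric.isClosed_closedBall.measurableSet.prod MeasurableSet.univ

theorem interference_config_eq {z : Vertex d} {ω : Ω} (hω : Function.Injective fun n => X n ω) :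
    interference d β z (config d X ω) = count X (interferenceSet d β z) ω := by
  rw [interference, count, ← hω.encard_image]
  congr 1
  ext w
  constructor
  · rintro ⟨⟨n, rfl⟩, hw⟩
    exact ⟨n, hw, rfl⟩
  · rintro ⟨n, hn, rfl⟩
    exact ⟨⟨n, rfl⟩, hn⟩

/-- `E[1/(1+N)]` for `N` Poisson distributed with mean `m`. -/
def invPoissonMean (m : ℝ) : ℝ := (1 - Real.exp (-m)) / m

theorem lintegral_halfProb [NeZero d] (h : IsPoissonProcess P (intensity d l) X) (hl : 0 < l)
    (y z : Vertex d) (hz : 0 < z.2) :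
    ∫⁻ ω, halfProb d γ δ β z y (config d X ω) ∂P =
      ENNReal.ofReal (min 1 (z.2 ^ (-(γ * δ)) * ‖z.1 - y.1‖ ^ (-((d : ℝ) * δ)))) *
        ENNReal.ofReal (invPoissonMean (l * ballVolume d * z.2 ^ (-β))) := by
  have hκ := ballVolume_pos d
  have hz0 : 0 < z.2 ^ (-β) := by positivity
  have hD := measurableSet_interferenceSet (d := d) (β := β) hz0.le
  have hm : 0 < l * ballVolume d * z.2 ^ (-β) := by positivity
  have hI := intensity_interferenceSet (d := d) (l := l) (β := β) hl.le hz0.le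
  have key := h.mul_lintegral_inv_one_add_count hD (by rw [hI]; exact ENNReal.ofReal_ne_top)
  rw [hI, ENNReal.toReal_ofReal hm.le] at key
  have hE : ∫⁻ ω, (1 + ((count X (interferenceSet d β z) ω : ℕ∞) : ℝ≥0∞))⁻¹ ∂P =
      ENNReal.ofReal (invPoissonMean (l * ballVolume d * z.2 ^ (-β))) := by
    rw [invPoissonMean, ENNReal.ofReal_div_of_pos hm, ← key,
      mul_comm, ENNReal.mul_div_cancel_right (by simpa using hm) ENNReal.ofReal_ne_top]
  rw [← hE, ← lintegral_const_mul']
  · refine lintegral_congr_ae ?_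
    filter_upwards [ae_injective h] with ω hω
    rw [halfProb, interference_config_eq hω, ENNReal.div_eq_inv_mul, mul_comm]
  · exact ENNReal.ofReal_ne_top

theorem lintegral_connProb [NeZero d] (h : IsPoissonProcess P (intensity d l) X) (hl : 0 < l)
    (x y : EuclideanSpace ℝ (Fin d)) {u v : ℝ} (hu : 0 < u) (hv : 0 < v) :
    ∫⁻ ω, connProb d γ δ β (x, u) (y, v) (config d X ω) ∂P =
      ENNReal.ofReal (min 1 (min u v ^ (-(γ * δ)) * ‖x - y‖ ^ (-((d : ℝ) * δ)))) *
        ENNReal.ofReal (invPoissonMean (l * ballVolume d * min u v ^ (-β))) := by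
  unfold connProb
  by_cases huv : u < v
  · simp only [huv, if_true]
    rw [lintegral_halfProb h hl (y, v) (x, u) hu, min_eq_left huv.le]
  · simp only [huv, if_false]
    rw [lintegral_halfProb h hl (x, u) (y, v) hv, min_eq_right (not_lt.1 huv), norm_sub_rev]

theorem norm_single_rpow [NeZero d] {t : ℝ} (ht : 0 ≤ t) :
    ‖(0 : EuclideanSpace ℝ (Fin d)) -
      EuclideanSpace.single (0 : Fin d) (t ^ (1 / (d : ℝ)))‖ = t ^ (1 / (d : ℝ)) := by
  rw [zero_sub, norm_neg, PiLp.norm_single, Real.norm_of_nonneg (by positivity)]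

theorem annealed_eq [NeZero d] (h : IsPoissonProcess P (intensity d l) X) (hl : 0 < l)
    {u v t : ℝ} (hu : 0 < u) (hv : 0 < v) (ht : 0 ≤ t) :
    annealed d γ δ β X P u v t =
      ENNReal.ofReal (min 1 (min u v ^ (-(γ * δ)) * t ^ (-δ))) *
        ENNReal.ofReal (invPoissonMean (l * ballVolume d * min u v ^ (-β))) := by
  have hd : (d : ℝ) ≠ 0 := by exact_mod_cast NeZero.ne d
  rw [annealed, lintegral_connProb h hl _ _ hu hv, norm_single_rpow ht, ← Real.rpow_mul ht]
  congr 5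
  field_simp

theorem lintegral_connProb_eq_annealed [NeZero d] (h : IsPoissonProcess P (intensity d l) X)
    (hl : 0 < l) (x y : EuclideanSpace ℝ (Fin d)) {u v : ℝ} (hu : 0 < u) (hv : 0 < v) :
    ∫⁻ ω, connProb d γ δ β (x, u) (y, v) (config d X ω) ∂P =
      annealed d γ δ β X P u v (‖x - y‖ ^ d) := by
  rw [annealed_eq h hl hu hv (by positivity), lintegral_connProb h hl x y hu hv,
    ← Real.rpow_natCast, ← Real.rpow_mul (norm_nonneg _), mul_neg]

theorem invPoissonMean_le {m : ℝ} (hm : 0 < m) : invPoissonMean m ≤ m⁻¹ := by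
  rw [invPoissonMean, ← one_div]
  gcongr
  have := Real.exp_pos (-m)
  linarith

/-- With `invPoissonMean_le` this makes `E[1/(1+N)]` comparable to `1/m` for `m` bounded away from
zero, as is the mean `l * ballVolume d * u ^ (-β)` for marks `u ≤ 1`. -/
theorem le_invPoissonMean {m m₀ : ℝ} (h0 : 0 < m₀) (hm : m₀ ≤ m) :
    (1 - Real.exp (-m₀)) * m⁻¹ ≤ invPoissonMean m := by
  rw [invPoissonMean, div_eq_mul_inv]
  have : 0 < m := h0.trans_le hm
  gcongr

end Annealed

/-! ### Upper and lower bounds for `ψ`. -/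

section Psi

variable {d : ℕ} {γ δ β : ℝ} {Ω : Type*} [MeasurableSpace Ω] {l : ℝ} {P : Measure Ω}
  {X : ℕ → Ω → Vertex d}

/-- The factor `m ^ (η - 1)` is set aside because it is integrable at zero; the rest is bounded at
the worst mark. For `m ≥ R ^ (-k)` the polynomial branch of the minimum is used, and `m ^ (-(e +
η))` is largest at `m = R ^ (-k)`. Smaller marks can occur only when `k = 1/γ`, where the minimum is
bounded by one and `m ^ (1 + β - η)` is at most its value at `R ^ (-1/γ)`. -/
theorem mark_profile_le (hγ : 0 < γ) (hβ : 0 ≤ β) {μ η R m : ℝ} (hη : 0 < η)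
    (hη1 : η < 1) (hR : 1 < R) (hm : R ^ (-(1 - μ)) < m) (hm1 : m < 1) :
    m ^ β * min 1 (m ^ (-(γ * δ)) * R ^ (-δ)) ≤
      R ^ (-δ + min (1 - μ) (1 / γ) * (max (γ * δ - β - 1) 0 + η)) * m ^ (η - 1) := by
  have hR0 : 0 < R := one_pos.trans hR
  have hm0 : 0 < m := (by positivity : 0 < R ^ (-(1 - μ))).trans hm
  set e := max (γ * δ - β - 1) 0
  have he0 : 0 ≤ e := le_max_right _ _
  have he : γ * δ - β - 1 ≤ e := le_max_left _ _
  set k := min (1 - μ) (1 / γ) with hk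
  have main : ∀ k' : ℝ, 0 ≤ e + η → R ^ (-k') ≤ m → k' ≤ k →
      m ^ β * (m ^ (-(γ * δ)) * R ^ (-δ)) ≤ R ^ (-δ + k * (e + η)) * m ^ (η - 1) := by
    intro k' hen hkm hkk
    have h1 : m ^ β * (m ^ (-(γ * δ)) * R ^ (-δ)) ≤ m ^ (-(e + η)) * R ^ (-δ) * m ^ (η - 1) := by
      have : m ^ β * m ^ (-(γ * δ)) ≤ m ^ (-(e + η)) * m ^ (η - 1) := by
        rw [← Real.rpow_add hm0, ← Real.rpow_add hm0]
        exact Real.rpow_le_rpow_of_exponent_ge hm0 hm1.le (by linarith)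
      calc m ^ β * (m ^ (-(γ * δ)) * R ^ (-δ)) = (m ^ β * m ^ (-(γ * δ))) * R ^ (-δ) := by ring
        _ ≤ (m ^ (-(e + η)) * m ^ (η - 1)) * R ^ (-δ) := by gcongr
        _ = _ := by ring
    refine h1.trans ?_
    gcongr
    have h2 : m ^ (-(e + η)) ≤ (R ^ (-k')) ^ (-(e + η)) :=
      Real.rpow_le_rpow_of_nonpos (by positivity) hkm (by linarith)
    rw [← Real.rpow_mul hR0.le] at h2
    have h3 : R ^ (-k' * -(e + η)) ≤ R ^ (k * (e + η)) :=
      Real.rpow_le_rpow_of_exponent_le hR.le (by nlinarith)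
    rw [Real.rpow_add hR0, mul_comm]
    gcongr
    exact h2.trans h3
  by_cases hc : R ^ (-k) ≤ m
  · refine le_trans ?_ (main k (by linarith) hc le_rfl)
    gcongr
    exact min_le_right _ _
  · have hlt : m < R ^ (-k) := not_le.1 hc
    have hk' : k = 1 / γ := by
      rcases min_choice (1 - μ) (1 / γ) with h | h
      · rw [hk, h] at hlt
        exact absurd hlt (not_lt.2 hm.le)
      · rw [hk, h]
    rw [hk'] at hlt ⊢
    calc m ^ β * min 1 (m ^ (-(γ * δ)) * R ^ (-δ)) ≤ m ^ β * 1 := by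
          gcongr; exact min_le_left _ _
      _ = m ^ (1 + β - η) * m ^ (η - 1) := by
          rw [mul_one, ← Real.rpow_add hm0]; congr 1; ring
      _ ≤ (R ^ (-(1 / γ))) ^ (1 + β - η) * m ^ (η - 1) := by
          gcongr
          linarith
      _ ≤ R ^ (-δ + 1 / γ * (e + η)) * m ^ (η - 1) := by
          gcongr
          rw [← Real.rpow_mul hR0.le]
          refine Real.rpow_le_rpow_of_exponent_le hR.le ?_
          have : -(1 / γ) * (1 + β - η) = -δ + 1 / γ * (γ * δ - β - 1 + η) := by
            field_simp; ring
          rw [this]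
          gcongr

theorem lintegral_lintegral_min_le {a : ℝ} (ha : 0 ≤ a) (F : ℝ → ℝ≥0∞) (hF : Measurable F) :
    ∫⁻ u in Ioo a 1, ∫⁻ v in Ioo a 1, F (min u v) ≤ 2 * ∫⁻ m in Ioo a 1, F m := by
  have hv : volume (Ioo a 1) ≤ 1 := by
    rw [Real.volume_Ioo, ENNReal.ofReal_le_one]; linarith
  calc ∫⁻ u in Ioo a 1, ∫⁻ v in Ioo a 1, F (min u v)
      ≤ ∫⁻ u in Ioo a 1, ∫⁻ v in Ioo a 1, (F u + F v) := by
        refine lintegral_mono fun u => lintegral_mono fun v => ?_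
        rcases min_choice u v with h | h <;> simp only [h]
        · exact le_self_add
        · exact le_add_self
    _ = ∫⁻ u in Ioo a 1, (F u * volume (Ioo a 1) + ∫⁻ v in Ioo a 1, F v) := by
        refine lintegral_congr fun u => ?_
        rw [lintegral_add_left measurable_const, setLIntegral_const]
    _ ≤ ∫⁻ u in Ioo a 1, (F u + ∫⁻ v in Ioo a 1, F v) := by
        refine lintegral_mono fun u => ?_
        gcongr
        exact mul_le_of_le_one_right zero_le hv
    _ = (∫⁻ u in Ioo a 1, F u) + (∫⁻ v in Ioo a 1, F v) * volume (Ioo a 1) := by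
        rw [lintegral_add_left hF, setLIntegral_const]
    _ ≤ (∫⁻ u in Ioo a 1, F u) + ∫⁻ v in Ioo a 1, F v := by
        gcongr
        exact mul_le_of_le_one_right zero_le hv
    _ = 2 * ∫⁻ m in Ioo a 1, F m := by rw [two_mul]

theorem rpow_threshold (d : ℕ) {r : ℝ} (hr : 0 < r) (μ : ℝ) :
    r ^ (-(d : ℝ) + d * μ) = (r ^ d) ^ (-(1 - μ)) := by
  rw [← Real.rpow_natCast, ← Real.rpow_mul hr.le]
  congr 1
  ring

theorem psi_le [NeZero d] (h : IsPoissonProcess P (intensity d l) X) (hl : 0 < l) (hγ : 0 < γ)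
    (hβ : 0 ≤ β) {μ η : ℝ} (hη : 0 < η) (hη1 : η < 1) :
    psi d γ δ β X P μ ≤
      ((-δ + min (1 - μ) (1 / γ) * (max (γ * δ - β - 1) 0 + η) : ℝ) : EReal) := by
  have hκ := ballVolume_pos d
  have hd : (0 : ℝ) < d := by exact_mod_cast Nat.pos_of_ne_zero (NeZero.ne d)
  set E := -δ + min (1 - μ) (1 / γ) * (max (γ * δ - β - 1) 0 + η)
  have hint : IntegrableOn (fun m : ℝ => m ^ (η - 1)) (Ioo 0 1) :=
    (intervalIntegral.integrableOn_Ioo_rpow_iff one_pos).2 (by linarith)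
  set K := ∫ m in Ioo (0 : ℝ) 1, m ^ (η - 1)
  have hKnn : 0 ≤ K := setIntegral_nonneg measurableSet_Ioo fun m hm => by
    have := hm.1; positivity
  have hK : ∫⁻ m in Ioo (0 : ℝ) 1, ENNReal.ofReal (m ^ (η - 1)) = ENNReal.ofReal K := by
    rw [ofReal_integral_eq_lintegral_ofReal hint]
    refine (ae_restrict_iff' measurableSet_Ioo).2 (ae_of_all _ fun m hm => ?_)
    have := hm.1
    simp only [Pi.zero_apply]
    positivity
  set c := (l * ballVolume d)⁻¹
  have hc : 0 < c := by positivity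
  -- Using `K + 1` instead of `K` makes the constant positive from `0 ≤ K` alone.
  have := limsup_log_le_of_eventually_le (C := 2 * (c * (K + 1))) (a := d * E) (k := d)
    (by positivity) hd (f := fun r : ℝ =>
      ∫⁻ u in Ioo (r ^ (-(d : ℝ) + d * μ)) 1, ∫⁻ v in Ioo (r ^ (-(d : ℝ) + d * μ)) 1,
        annealed d γ δ β X P u v (r ^ d)) ?_
  · rw [mul_div_cancel_left₀ _ hd.ne'] at this
    exact this
  filter_upwards [eventually_gt_atTop 1] with r hr
  have hr0 : 0 < r := one_pos.trans hr
  set R : ℝ := r ^ d with hRdef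
  have hR : 1 < R := one_lt_pow₀ hr (NeZero.ne d)
  have hR0 : 0 < R := one_pos.trans hR
  rw [rpow_threshold d hr0 μ, ← hRdef]
  set a : ℝ := R ^ (-(1 - μ))
  have ha : 0 < a := by positivity
  let F : ℝ → ℝ≥0∞ := fun m => ENNReal.ofReal (c * (R ^ E * m ^ (η - 1)))
  have hF : Measurable F := by fun_prop
  have hptw : ∀ u ∈ Ioo a 1, ∀ v ∈ Ioo a 1, annealed d γ δ β X P u v R ≤ F (min u v) := by
    intro u hu v hv
    have hm0 : 0 < min u v := lt_min (ha.trans hu.1) (ha.trans hv.1)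
    rw [annealed_eq h hl (ha.trans hu.1) (ha.trans hv.1) hR0.le,
      ← ENNReal.ofReal_mul (by positivity)]
    refine ENNReal.ofReal_le_ofReal ?_
    calc min 1 (min u v ^ (-(γ * δ)) * R ^ (-δ)) *
          invPoissonMean (l * ballVolume d * min u v ^ (-β))
        ≤ min 1 (min u v ^ (-(γ * δ)) * R ^ (-δ)) * (l * ballVolume d * min u v ^ (-β))⁻¹ := by
          gcongr
          exact invPoissonMean_le (by positivity)
      _ = c * (min u v ^ β * min 1 (min u v ^ (-(γ * δ)) * R ^ (-δ))) := by
          rw [mul_inv, Real.rpow_neg hm0.le β, inv_inv]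
          ring
      _ ≤ c * (R ^ E * min u v ^ (η - 1)) := by
          exact mul_le_mul_of_nonneg_left (mark_profile_le hγ hβ hη hη1 hR (lt_min hu.1 hv.1)
            ((min_le_left _ _).trans_lt hu.2)) hc.le
  calc ∫⁻ u in Ioo a 1, ∫⁻ v in Ioo a 1, annealed d γ δ β X P u v R
      ≤ ∫⁻ u in Ioo a 1, ∫⁻ v in Ioo a 1, F (min u v) :=
        setLIntegral_mono' measurableSet_Ioo fun u hu =>
          setLIntegral_mono' measurableSet_Ioo fun v hv => hptw u hu v hv
    _ ≤ 2 * ∫⁻ m in Ioo a 1, F m := lintegral_lintegral_min_le ha.le F hF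
    _ ≤ 2 * ∫⁻ m in Ioo 0 1, F m := by
        gcongr
    _ = 2 * (ENNReal.ofReal (c * R ^ E) * ENNReal.ofReal K) := by
        rw [← hK, ← lintegral_const_mul' _ _ ENNReal.ofReal_ne_top]
        congr 1
        refine lintegral_congr fun m => ?_
        rw [← ENNReal.ofReal_mul (by positivity), mul_assoc]
    _ = ENNReal.ofReal (2 * (c * R ^ E * K)) := by
        rw [ENNReal.ofReal_mul (by norm_num : (0 : ℝ) ≤ 2),
          ENNReal.ofReal_mul (p := c * R ^ E) (by positivity)]
        simp
    _ ≤ ENNReal.ofReal (2 * (c * (K + 1)) * r ^ (d * E)) := by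
        refine ENNReal.ofReal_le_ofReal ?_
        rw [Real.rpow_mul hr0.le, Real.rpow_natCast, ← hRdef]
        have : 0 < c * R ^ E := by positivity
        nlinarith

/-- The integral is restricted to pairs of one mark of order `s = R ^ (-k)` and one of order one.
Since `k ≤ 1/γ`, the exponent `k γδ - δ` of the connection strength is nonpositive, so the minimum
with one loses no power of `R`. The bound `k < 1 - μ` is strict so that the box eventually clears
the cutoff. -/
theorem le_psi [NeZero d] (h : IsPoissonProcess P (intensity d l) X) (hl : 0 < l) (hγ : 0 < γ)
    (hδ : 0 < δ) (hβ : 0 ≤ β) (hβ1 : β < 1) {μ k : ℝ} (hk : 0 ≤ k) (hkμ : k < 1 - μ)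
    (hkγ : k ≤ 1 / γ) :
    ((-δ + k * (γ * δ - β - 1) : ℝ) : EReal) ≤ psi d γ δ β X P μ := by
  have hκ := ballVolume_pos d
  have hd : (0 : ℝ) < d := by exact_mod_cast Nat.pos_of_ne_zero (NeZero.ne d)
  set E := -δ + k * (γ * δ - β - 1) with hE
  set m₀ := l * ballVolume d with hm₀def
  have hm₀ : 0 < m₀ := by positivity
  have he : 0 < 1 - Real.exp (-m₀) := by
    have : Real.exp (-m₀) < 1 := Real.exp_lt_one_iff.2 (by linarith)
    linarith
  set c := (1 - Real.exp (-m₀)) * m₀⁻¹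
  have hc : 0 < c := by positivity
  -- The integrand is at least `c / 4 * R ^ (E + k)` on a box with sides `s / 4` and `1 / 2`.
  have := le_limsup_log_of_eventually_ge (C := c / 32) (a := d * E) (k := d)
    (by positivity) hd (f := fun r : ℝ =>
      ∫⁻ u in Ioo (r ^ (-(d : ℝ) + d * μ)) 1, ∫⁻ v in Ioo (r ^ (-(d : ℝ) + d * μ)) 1,
        annealed d γ δ β X P u v (r ^ d)) ?_
  · rw [mul_div_cancel_left₀ _ hd.ne'] at this
    exact this
  have hR4 : ∀ᶠ r : ℝ in atTop, 4 ≤ (r ^ d) ^ (1 - μ - k) :=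
    (((tendsto_rpow_atTop (by linarith : 0 < 1 - μ - k)).comp
      (tendsto_pow_atTop (NeZero.ne d))).eventually_ge_atTop 4)
  filter_upwards [eventually_gt_atTop 1, hR4] with r hr hr4
  have hr0 : 0 < r := one_pos.trans hr
  set R : ℝ := r ^ d with hRdef
  have hR : 1 < R := one_lt_pow₀ hr (NeZero.ne d)
  have hR0 : 0 < R := one_pos.trans hR
  rw [rpow_threshold d hr0 μ, ← hRdef]
  set a : ℝ := R ^ (-(1 - μ)) with hadef
  have ha : 0 < a := by positivity
  set s : ℝ := R ^ (-k) with hsdef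
  have hs : 0 < s := by positivity
  have hs1 : s ≤ 1 := Real.rpow_le_one_of_one_le_of_nonpos hR.le (by linarith)
  have has : a ≤ s / 4 := by
    have : a * R ^ (1 - μ - k) = s := by
      rw [hadef, hsdef, ← Real.rpow_add hR0]
      congr 1
      ring
    rw [← this]
    nlinarith
  have hptw : ∀ u ∈ Ioo (s / 4) (s / 2), ∀ v ∈ Ioo (1 / 2 : ℝ) 1,
      ENNReal.ofReal (c / 4 * R ^ (E + k)) ≤ annealed d γ δ β X P u v R := by
    intro u hu v hv
    have hu0 : 0 < u := (by positivity : 0 < s / 4).trans hu.1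
    have hv0 : 0 < v := (by norm_num : (0 : ℝ) < 1 / 2).trans hv.1
    have hu1 : u ≤ 1 := by linarith [hu.2]
    have hmin : min u v = u := min_eq_left (by linarith [hu.2, hv.1])
    rw [annealed_eq h hl hu0 hv0 hR0.le, hmin, ← ENNReal.ofReal_mul (by positivity)]
    refine ENNReal.ofReal_le_ofReal ?_
    have h1 : R ^ (k * (γ * δ) - δ) ≤ min 1 (u ^ (-(γ * δ)) * R ^ (-δ)) := by
      refine le_min (Real.rpow_le_one_of_one_le_of_nonpos hR.le ?_) ?_
      · have : k * γ ≤ 1 := by rwa [le_div_iff₀ hγ] at hkγ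
        nlinarith
      · rw [sub_eq_add_neg, Real.rpow_add hR0]
        gcongr
        have : s ^ (-(γ * δ)) ≤ u ^ (-(γ * δ)) :=
          Real.rpow_le_rpow_of_nonpos hu0 (by linarith [hu.2]) (by nlinarith [mul_pos hγ hδ])
        rwa [hsdef, ← Real.rpow_mul hR0.le, neg_mul_neg] at this
    have h2 : c / 4 * R ^ (-(k * β)) ≤ invPoissonMean (m₀ * u ^ (-β)) := by
      have hu' : 1 ≤ u ^ (-β) := Real.one_le_rpow_of_pos_of_le_one_of_nonpos hu0 hu1 (by linarith)
      refine le_trans ?_ (le_invPoissonMean hm₀ (le_mul_of_one_le_right hm₀.le hu'))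
      rw [mul_inv, Real.rpow_neg hu0.le, inv_inv, ← mul_assoc]
      have h3 : (s / 4) ^ β ≤ u ^ β := Real.rpow_le_rpow (by positivity) hu.1.le hβ
      have h4 : R ^ (-(k * β)) / 4 ≤ (s / 4) ^ β := by
        rw [Real.div_rpow hs.le (by norm_num), hsdef, ← Real.rpow_mul hR0.le, neg_mul]
        gcongr
        calc (4 : ℝ) ^ β ≤ 4 ^ (1 : ℝ) :=
              Real.rpow_le_rpow_of_exponent_le (by norm_num) hβ1.le
          _ = 4 := Real.rpow_one 4
      calc c / 4 * R ^ (-(k * β)) = c * (R ^ (-(k * β)) / 4) := by ring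
        _ ≤ c * u ^ β := by gcongr; exact h4.trans h3
    calc c / 4 * R ^ (E + k) = R ^ (k * (γ * δ) - δ) * (c / 4 * R ^ (-(k * β))) := by
          have : R ^ (E + k) = R ^ (k * (γ * δ) - δ) * R ^ (-(k * β)) := by
            rw [← Real.rpow_add hR0]
            congr 1
            rw [hE]
            ring
          rw [this]
          ring
      _ ≤ _ := by
          gcongr
  calc ENNReal.ofReal (c / 32 * r ^ (d * E))
      = ENNReal.ofReal (c / 4 * R ^ (E + k)) * volume (Ioo (1 / 2 : ℝ) 1) *
          volume (Ioo (s / 4) (s / 2)) := by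
        rw [Real.volume_Ioo, Real.volume_Ioo, ← ENNReal.ofReal_mul (by positivity),
          ← ENNReal.ofReal_mul (by positivity), Real.rpow_mul hr0.le, Real.rpow_natCast, ← hRdef]
        congr 1
        have : R ^ E = R ^ (E + k) * s := by
          rw [hsdef, ← Real.rpow_add hR0]
          congr 1
          ring
        rw [this]
        ring
    _ = ∫⁻ _ in Ioo (s / 4) (s / 2), ∫⁻ _ in Ioo (1 / 2 : ℝ) 1,
          ENNReal.ofReal (c / 4 * R ^ (E + k)) := by
        simp only [setLIntegral_const]
    _ ≤ ∫⁻ u in Ioo (s / 4) (s / 2), ∫⁻ v in Ioo (1 / 2 : ℝ) 1, annealed d γ δ β X P u v R :=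
        setLIntegral_mono' measurableSet_Ioo fun u hu =>
          setLIntegral_mono' measurableSet_Ioo fun v hv => hptw u hu v hv
    _ ≤ ∫⁻ u in Ioo (s / 4) (s / 2), ∫⁻ v in Ioo a 1, annealed d γ δ β X P u v R :=
        lintegral_mono fun u => lintegral_mono_set (Ioo_subset_Ioo_left (by linarith))
    _ ≤ ∫⁻ u in Ioo a 1, ∫⁻ v in Ioo a 1, annealed d γ δ β X P u v R :=
        lintegral_mono_set (Ioo_subset_Ioo has (by linarith))

end Psi

/-! ### The fixed point equation for the coefficient. -/

section Zeta

variable {d : ℕ} {γ δ β : ℝ} {Ω : Type*} [MeasurableSpace Ω] {l : ℝ} {P : Measure Ω}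
  {X : ℕ → Ω → Vertex d}

theorem le_of_mem_zeta_set [NeZero d] (h : IsPoissonProcess P (intensity d l) X) (hl : 0 < l)
    (hγ : 0 < γ) (hβ : 0 ≤ β) {μ : ℝ}
    (hμ : (μ : EReal) < 2 + psi d γ δ β X P μ) :
    μ ≤ 2 - δ + min (1 - μ) (1 / γ) * max (γ * δ - β - 1) 0 := by
  have key : ∀ η ∈ Ioo (0 : ℝ) 1,
      μ ≤ 2 - δ + min (1 - μ) (1 / γ) * (max (γ * δ - β - 1) 0 + η) := by
    intro η hη
    have h1 := hμ.le.trans (add_le_add_right (psi_le h hl hγ hβ (μ := μ) hη.1 hη.2) 2)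
    have h2 : (μ : EReal) ≤
        ((2 + (-δ + min (1 - μ) (1 / γ) * (max (γ * δ - β - 1) 0 + η)) : ℝ) : EReal) := by
      rw [EReal.coe_add]
      exact h1
    have h3 := EReal.coe_le_coe_iff.1 h2
    linarith
  have ht : Tendsto (fun η : ℝ => 2 - δ + min (1 - μ) (1 / γ) * (max (γ * δ - β - 1) 0 + η))
      (𝓝[>] 0) (𝓝 (2 - δ + min (1 - μ) (1 / γ) * (max (γ * δ - β - 1) 0 + 0))) := by
    refine Tendsto.mono_left ?_ nhdsWithin_le_nhds
    exact Continuous.tendsto (by fun_prop) 0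
  rw [add_zero] at ht
  refine ge_of_tendsto ht ?_
  filter_upwards [Ioo_mem_nhdsGT (one_pos : (0 : ℝ) < 1)] with η hη using key η hη

theorem mem_zeta_set [NeZero d] (h : IsPoissonProcess P (intensity d l) X) (hl : 0 < l)
    (hγ : 0 < γ) (hδ : 0 < δ) (hβ : 0 ≤ β) (hβ1 : β < 1) {μ k : ℝ} (hk : 0 ≤ k) (hkμ : k < 1 - μ)
    (hkγ : k ≤ 1 / γ) (hμ : μ < 2 - δ + k * (γ * δ - β - 1)) :
    (μ : EReal) < 2 + psi d γ δ β X P μ := by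
  refine lt_of_lt_of_le ?_ (add_le_add_right (le_psi h hl hγ hδ hβ hβ1 hk hkμ hkγ) 2)
  have : (μ : EReal) < ((2 + (-δ + k * (γ * δ - β - 1)) : ℝ) : EReal) := by
    exact_mod_cast (by linarith : μ < 2 + (-δ + k * (γ * δ - β - 1)))
  rw [EReal.coe_add] at this
  exact this

theorem sSup_coe_image_eq {A : Set ℝ} {z : ℝ} (h1 : Iio z ⊆ A) (h2 : A ⊆ Iic z) :
    sSup ((fun μ : ℝ => (μ : EReal)) '' A) = z := by
  refine le_antisymm (sSup_le ?_) ?_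
  · rintro _ ⟨μ, hμ, rfl⟩
    exact EReal.coe_le_coe_iff.2 (h2 hμ)
  · refine le_of_forall_lt fun y hy => ?_
    obtain ⟨q, hyq, hqz⟩ := EReal.lt_iff_exists_real_btwn.1 hy
    exact hyq.trans_le (le_sSup ⟨q, h1 (EReal.coe_lt_coe_iff.1 hqz), rfl⟩)

/-- If `γδ ≤ 1 + β`, small marks bring no gain and the fixed point is `2 - δ`. Otherwise, with `s =
γδ - β > 1`, the equation `μ = 2 - δ + (1 - μ)(s - 1)` has the solution `z = (1 - δ + s) / s`, which
exceeds `2 - δ`; the cap `1/γ` is not exceeded at `z` because `β ≤ γ`. -/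
theorem zeta_eq_longEdgeExponent [NeZero d] (h : IsPoissonProcess P (intensity d l) X) (hl : 0 < l)
    (hγ : γ ∈ Ioo (0 : ℝ) 1) (hδ : 1 < δ) (hβ : β ∈ Ico (0 : ℝ) 1)
    (hc : β ≤ γ ∨ γ * δ ≤ 1 + β) :
    zeta d γ δ β X P = (longEdgeExponent γ δ β : EReal) := by
  have hδ0 : 0 < δ := by linarith
  have hγi : 0 < 1 / γ := one_div_pos.2 hγ.1
  by_cases hs : γ * δ ≤ 1 + β
  · have hZ : longEdgeExponent γ δ β = 2 - δ := by
      unfold longEdgeExponent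
      split_ifs with hlt
      · refine max_eq_left ?_
        rw [div_le_iff₀ (by linarith)]
        nlinarith
      · rfl
    have he : max (γ * δ - β - 1) 0 = 0 := max_eq_right (by linarith)
    rw [hZ]
    refine sSup_coe_image_eq (fun μ hμ => ?_) fun μ hμ => ?_
    · rw [mem_Iio] at hμ
      exact ⟨by linarith, mem_zeta_set h hl hγ.1 hδ0 hβ.1 hβ.2 le_rfl (by linarith) hγi.le
        (by linarith)⟩
    · have := le_of_mem_zeta_set h hl hγ.1 hβ.1 hμ.2
      rw [he, mul_zero, add_zero] at this
      exact this
  · have hβγ : β ≤ γ := hc.resolve_right hs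
    have hs' : 1 < γ * δ - β := by linarith [not_le.1 hs]
    set s := γ * δ - β with hsdef
    have he : max (γ * δ - β - 1) 0 = s - 1 := max_eq_left (by linarith)
    set z := (1 - δ * (1 - γ) - β) / s with hzdef
    have hzs : z * s = 1 - δ + s := by
      rw [hzdef, div_mul_cancel₀ _ (by linarith)]
      rw [hsdef]; ring
    have hz1 : z < 1 := by nlinarith
    have hZ : longEdgeExponent γ δ β = z := by
      unfold longEdgeExponent
      rw [if_pos (by linarith)]
      refine max_eq_right ?_
      rw [le_div_iff₀ (by linarith)]
      nlinarith
    rw [hZ]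
    refine sSup_coe_image_eq (fun μ hμ => ?_) fun μ hμ => ?_
    · rw [mem_Iio] at hμ
      refine ⟨by linarith, mem_zeta_set h hl hγ.1 hδ0 hβ.1 hβ.2 (k := 1 - z) (by linarith)
        (by linarith) ?_ ?_⟩
      -- As `(1 - z) s = δ - 1`, the claim is `γ (δ - 1) ≤ γδ - β`, that is `β ≤ γ`.
      · rw [le_div_iff₀ hγ.1]
        have h1 : (1 - z) * s = δ - 1 := by linarith
        have h2 : (1 - z) * γ * s ≤ 1 * s := by nlinarith
        exact le_of_mul_le_mul_right h2 (by linarith)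
      · rw [← hsdef]
        nlinarith
    · have h1 := le_of_mem_zeta_set h hl hγ.1 hβ.1 hμ.2
      rw [he] at h1
      have h2 : min (1 - μ) (1 / γ) * (s - 1) ≤ (1 - μ) * (s - 1) := by
        exact mul_le_mul_of_nonneg_right (min_le_left _ _) (by linarith)
      have h3 : μ * s ≤ z * s := by nlinarith
      exact le_of_mul_le_mul_right h3 (by linarith)

/-- Now the cap is active: the best marks are of order `R ^ (-1/γ)`, below which connection
probabilities no longer increase except through interference. The resulting value is less than `1 -
1/γ` exactly because `γ < β`, so these marks lie above the cutoff. -/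
theorem zeta_eq_of_lt [NeZero d] (h : IsPoissonProcess P (intensity d l) X) (hl : 0 < l)
    (hγ : γ ∈ Ioo (0 : ℝ) 1) (hδ : 1 < δ) (hβ : β ∈ Ico (0 : ℝ) 1)
    (hγβ : γ < β) (hs : 1 + β < γ * δ) :
    zeta d γ δ β X P = ((2 - (1 + β) / γ : ℝ) : EReal) := by
  have hδ0 : 0 < δ := by linarith
  have hγi : 0 < 1 / γ := one_div_pos.2 hγ.1
  have he : max (γ * δ - β - 1) 0 = γ * δ - β - 1 := max_eq_left (by linarith)
  have hz : 2 - (1 + β) / γ = 2 - δ + 1 / γ * (γ * δ - β - 1) := by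
    have := hγ.1.ne'
    field_simp
    ring
  have hz1 : 2 - (1 + β) / γ < 1 - 1 / γ := by
    have : 1 < β / γ := by rw [lt_div_iff₀ hγ.1]; linarith
    rw [add_div]
    linarith
  refine sSup_coe_image_eq (fun μ hμ => ?_) fun μ hμ => ?_
  · rw [mem_Iio] at hμ
    refine ⟨by linarith, mem_zeta_set h hl hγ.1 hδ0 hβ.1 hβ.2 (k := 1 / γ) hγi.le
      (by linarith) le_rfl ?_⟩
    rwa [← hz]
  · have h1 := le_of_mem_zeta_set h hl hγ.1 hβ.1 hμ.2
    rw [he] at h1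
    have h2 : min (1 - μ) (1 / γ) * (γ * δ - β - 1) ≤ 1 / γ * (γ * δ - β - 1) := by
      exact mul_le_mul_of_nonneg_right (min_le_right _ _) (by linarith)
    rw [mem_Iic, hz]
    linarith

theorem zetaBar_eq [NeZero d] {P : ℝ → Measure Ω} {z : EReal} (hl : 0 < l)
    (h : ∀ l', 0 < l' → zeta d γ δ β X (P l') = z) : zetaBar d γ δ β X P l = z := by
  have : (fun l' : ℝ => zeta d γ δ β X (P l')) '' Ioo 0 l = {z} := by
    ext y
    constructor
    · rintro ⟨l', hl', rfl⟩
      exact h l' hl'.1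
    · rintro rfl
      exact ⟨l / 2, ⟨by linarith, by linarith⟩, h _ (by linarith)⟩
  rw [zetaBar, this, sSup_singleton]

end Zeta

/-! ### Grid cubes: volume and diameter. -/

section Cubes

variable {d : ℕ}

/-- The half-open cube of side `s` with index `q` in the grid `s ℤ^d`. -/
def gridCube (s : ℝ) (q : Fin d → ℤ) : Set (EuclideanSpace ℝ (Fin d)) :=
  {x | ∀ i, ⌊x i / s⌋ = q i}

theorem measurableSet_gridCube (s : ℝ) (q : Fin d → ℤ) : MeasurableSet (gridCube s q) := by
  have : gridCube s q = ⋂ i, (fun x : EuclideanSpace ℝ (Fin d) => ⌊x i / s⌋) ⁻¹' {q i} := by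
    ext x
    simp [gridCube]
  rw [this]
  refine MeasurableSet.iInter fun i => ?_
  have hm : Measurable fun x : EuclideanSpace ℝ (Fin d) => ⌊x i / s⌋ :=
    Int.measurable_floor.comp (by fun_prop)
  exact hm (measurableSet_singleton _)

theorem pairwise_disjoint_gridCube (s : ℝ) :
    Pairwise (Function.onFun Disjoint (gridCube (d := d) s)) := by
  intro q q' hq
  refine Set.disjoint_left.2 fun x hx hx' => hq ?_
  funext i
  rw [← hx i, hx' i]

theorem volume_gridCube {s : ℝ} (hs : 0 < s) (q : Fin d → ℤ) :
    volume (gridCube s q) = ENNReal.ofReal (s ^ d) := by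
  have : gridCube s q = (WithLp.ofLp : EuclideanSpace ℝ (Fin d) → Fin d → ℝ) ⁻¹'
      univ.pi fun i => Ico (q i * s) ((q i + 1) * s) := by
    ext x
    simp only [gridCube, mem_ofPred_eq, mem_preimage, mem_univ_pi, mem_Ico, Int.floor_eq_iff,
      le_div_iff₀ hs, div_lt_iff₀ hs]
  rw [this, (PiLp.volume_preserving_ofLp (Fin d)).measure_preimage
    (MeasurableSet.univ_pi fun _ => measurableSet_Ico).nullMeasurableSet, Real.volume_pi_Ico]
  have h1 : ∀ i : Fin d, ((q i : ℝ) + 1) * s - q i * s = s := fun i => by ring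
  simp only [h1, Finset.prod_const, Finset.card_univ, Fintype.card_fin, ENNReal.ofReal_pow hs.le]

theorem norm_sub_le_of_mem_gridCube {s : ℝ} (hs : 0 < s) {q : Fin d → ℤ}
    {x y : EuclideanSpace ℝ (Fin d)} (hx : x ∈ gridCube s q) (hy : y ∈ gridCube s q) :
    ‖x - y‖ ≤ d * s := by
  have hi : ∀ i, ‖(x - y) i‖ ≤ s := by
    intro i
    have h1 := Int.floor_eq_iff.1 (hx i)
    have h2 := Int.floor_eq_iff.1 (hy i)
    rw [le_div_iff₀ hs, div_lt_iff₀ hs] at h1 h2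
    rw [PiLp.sub_apply, Real.norm_eq_abs, abs_le]
    constructor <;> linarith [h1.1, h1.2, h2.1, h2.2]
  have h3 : ‖x - y‖ ≤ ∑ i, ‖(x - y) i‖ := by
    rw [EuclideanSpace.norm_eq]
    refine Real.sqrt_le_iff.2 ⟨by positivity, ?_⟩
    exact Finset.sum_sq_le_sq_sum_of_nonneg fun i _ => norm_nonneg _
  calc ‖x - y‖ ≤ ∑ i, ‖(x - y) i‖ := h3
    _ ≤ ∑ _i : Fin d, s := Finset.sum_le_sum fun i _ => hi i
    _ = d * s := by simp

end Cubes

/-! ### Long edges: the first moment with independent interference. -/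

section LongEdges

variable {d : ℕ} {γ δ β : ℝ} {Ω : Type*} [MeasurableSpace Ω] {l : ℝ} {P : Measure Ω}
  {X : ℕ → Ω → Vertex d} {U : Sym2 ℕ → Ω → ℝ}

theorem edgeMeasure_ofReal_lt_le (e : Sym2 ℕ) (a : ℝ≥0∞) :
    edgeMeasure {u | ENNReal.ofReal (u e) < a} ≤ a := by
  have hm : MeasurableSet {t : ℝ | ENNReal.ofReal t < a} :=
    measurableSet_lt ENNReal.measurable_ofReal measurable_const
  have h1 : edgeMeasure {u | ENNReal.ofReal (u e) < a} =
      volume.restrict (Icc (0 : ℝ) 1) {t : ℝ | ENNReal.ofReal t < a} := by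
    rw [← Measure.infinitePi_map_eval (fun _ : Sym2 ℕ => volume.restrict (Icc (0 : ℝ) 1)) e,
      Measure.map_apply (measurable_pi_apply e) hm]
    rfl
  rw [h1, Measure.restrict_apply hm]
  rcases eq_or_ne a ∞ with rfl | ha
  · exact le_top
  calc volume ({t : ℝ | ENNReal.ofReal t < a} ∩ Icc 0 1) ≤ volume (Icc 0 a.toReal) := by
        refine measure_mono fun t ht => ⟨ht.2.1, ?_⟩
        exact (ENNReal.ofReal_le_iff_le_toReal ha).1 (le_of_lt ht.1)
    _ = a := by simp [ha]

/-- There are vertices `X i` in `A` and `X j` in `B` at distance at least `ρ` whose edge variable is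
below the connection probability computed with the interference at `X i`. -/
def halfEdge (γ δ β : ℝ) (X : ℕ → Ω → Vertex d) (U : Sym2 ℕ → Ω → ℝ) (A B : Set (Vertex d))
    (ρ : ℝ) : Set Ω :=
  {ω | ∃ i j, X i ω ∈ A ∧ X j ω ∈ B ∧ ρ ≤ ‖(X i ω).1 - (X j ω).1‖ ∧
    ENNReal.ofReal (U s(i, j) ω) <
      halfProb d γ δ β (X i ω) (X j ω) (config d X ω \ {X i ω, X j ω})}

theorem count_le_interference {A B D : Set (Vertex d)} (hAD : Disjoint A D) (hBD : Disjoint B D)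
    (hint : ∀ x ∈ A, ∀ z ∈ D, ‖x.1 - z.1‖ ^ d ≤ x.2 ^ (-β)) {ω : Ω}
    (hω : Function.Injective fun n => X n ω) {i j : ℕ} (hi : X i ω ∈ A) (hj : X j ω ∈ B) :
    count X D ω ≤ interference d β (X i ω) (config d X ω \ {X i ω, X j ω}) := by
  rw [count, interference, ← hω.encard_image]
  refine encard_le_encard ?_
  rintro _ ⟨n, hn, rfl⟩
  refine ⟨⟨⟨n, rfl⟩, ?_⟩, hint _ hi _ hn⟩
  rintro (h | h)
  · exact Set.disjoint_left.1 hAD hi (h ▸ hn)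
  · exact Set.disjoint_left.1 hBD hj (h ▸ hn)

theorem IsSample.measure_halfEdge_le_lintegral (h : IsSample d l P X U) {A B : Set (Vertex d)}
    (hA : MeasurableSet A) (hB : MeasurableSet B) (ρ : ℝ) :
    P (halfEdge γ δ β X U A B ρ) ≤ ∑' i, ∑' j, ∫⁻ ω,
      {ω | X i ω ∈ A ∧ X j ω ∈ B ∧ ρ ≤ ‖(X i ω).1 - (X j ω).1‖}.indicator (fun ω =>
        halfProb d γ δ β (X i ω) (X j ω) (config d X ω \ {X i ω, X j ω})) ω ∂P := by
  have hset : halfEdge γ δ β X U A B ρ = ⋃ i, ⋃ j, sample X U ⁻¹'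
      {p | p.1 i ∈ A ∧ p.1 j ∈ B ∧ ρ ≤ ‖(p.1 i).1 - (p.1 j).1‖ ∧ ENNReal.ofReal (p.2 s(i, j)) <
        halfProb d γ δ β (p.1 i) (p.1 j) ((range p.1 ∩ univ) \ {p.1 i, p.1 j})} := by
    ext ω
    simp [halfEdge, sample, config]
  rw [hset]
  refine (measure_iUnion_le _).trans (ENNReal.tsum_le_tsum fun i =>
    (measure_iUnion_le _).trans (ENNReal.tsum_le_tsum fun j => ?_))
  have hm : MeasurableSet {p : (ℕ → Vertex d) × (Sym2 ℕ → ℝ) |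
      p.1 i ∈ A ∧ p.1 j ∈ B ∧ ρ ≤ ‖(p.1 i).1 - (p.1 j).1‖ ∧ ENNReal.ofReal (p.2 s(i, j)) <
        halfProb d γ δ β (p.1 i) (p.1 j) ((range p.1 ∩ univ) \ {p.1 i, p.1 j})} := by
    have m1 : Measurable fun p : (ℕ → Vertex d) × (Sym2 ℕ → ℝ) => p.1 i := by fun_prop
    have m2 : Measurable fun p : (ℕ → Vertex d) × (Sym2 ℕ → ℝ) => p.1 j := by fun_prop
    refine (m1 hA).inter ((m2 hB).inter (MeasurableSet.inter ?_ ?_))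
    · have m3 : Measurable fun p : (ℕ → Vertex d) × (Sym2 ℕ → ℝ) => ‖(p.1 i).1 - (p.1 j).1‖ := by
        fun_prop
      exact measurableSet_le measurable_const m3
    · exact measurableSet_lt (ENNReal.measurable_ofReal.comp
        ((measurable_pi_apply s(i, j)).comp measurable_snd))
        ((measurable_halfProb γ δ β MeasurableSet.univ i j i j).comp measurable_fst)
  rw [h.measure_sample_preimage hm]
  refine lintegral_mono fun ω => ?_
  by_cases hω : X i ω ∈ A ∧ X j ω ∈ B ∧ ρ ≤ ‖(X i ω).1 - (X j ω).1‖
  · rw [indicator_of_mem (by exact hω)]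
    refine (measure_mono fun u hu => ?_).trans (edgeMeasure_ofReal_lt_le s(i, j) _)
    have := hu.2.2.2
    simpa [config] using this
  · rw [indicator_of_notMem (by exact hω), nonpos_iff_eq_zero]
    convert measure_empty (μ := edgeMeasure)
    ext u
    simp only [mem_preimage, mem_ofPred_eq, mem_empty_iff_false, iff_false]
    exact fun hu => hω ⟨hu.1, hu.2.1, hu.2.2.1⟩

theorem IsPoissonProcess.tsum_lintegral_indicator {α : Type*} [MeasurableSpace α] {Λ : Measure α}
    {X : ℕ → Ω → α} (h : IsPoissonProcess P Λ X) {A B : Set α} (hA : MeasurableSet A)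
    (hB : MeasurableSet B) {f : Ω → ℝ≥0∞} (hf : Measurable f) :
    ∑' i, ∑' j, ∫⁻ ω, (X i ⁻¹' A).indicator (fun _ => 1) ω *
        (X j ⁻¹' B).indicator (fun _ => 1) ω * f ω ∂P =
      ∫⁻ ω, ((count X A ω : ℕ∞) : ℝ≥0∞) * ((count X B ω : ℕ∞) : ℝ≥0∞) * f ω ∂P := by
  have hind : ∀ n : ℕ, ∀ S : Set α, MeasurableSet S →
      Measurable ((X n ⁻¹' S).indicator (fun _ => (1 : ℝ≥0∞))) := fun n S hS =>
    measurable_const.indicator (h.measurable n hS)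
  have hmeas : ∀ i j, Measurable fun ω => (X i ⁻¹' A).indicator (fun _ => (1 : ℝ≥0∞)) ω *
      (X j ⁻¹' B).indicator (fun _ => (1 : ℝ≥0∞)) ω * f ω := fun i j =>
    ((hind i A hA).mul (hind j B hB)).mul hf
  have h1 : ∀ i, ∑' j, ∫⁻ ω, (X i ⁻¹' A).indicator (fun _ => 1) ω *
      (X j ⁻¹' B).indicator (fun _ => 1) ω * f ω ∂P =
      ∫⁻ ω, (X i ⁻¹' A).indicator (fun _ => 1) ω * ((count X B ω : ℕ∞) : ℝ≥0∞) * f ω ∂P := by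
    intro i
    rw [← lintegral_tsum fun j => (hmeas i j).aemeasurable]
    refine lintegral_congr fun ω => ?_
    rw [ENNReal.tsum_mul_right, ENNReal.tsum_mul_left, ← coe_count_eq_tsum]
  have hcB : Measurable fun ω => ((count X B ω : ℕ∞) : ℝ≥0∞) :=
    measurable_from_top.comp (measurable_count h.measurable hB)
  have h2 : ∀ i, Measurable fun ω => (X i ⁻¹' A).indicator (fun _ => (1 : ℝ≥0∞)) ω *
      ((count X B ω : ℕ∞) : ℝ≥0∞) * f ω := fun i => ((hind i A hA).mul hcB).mul hf
  simp_rw [h1]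
  rw [← lintegral_tsum fun i => (h2 i).aemeasurable]
  refine lintegral_congr fun ω => ?_
  rw [ENNReal.tsum_mul_right, ENNReal.tsum_mul_right, ← coe_count_eq_tsum]

/-- Every point of `D` interferes at every vertex of `A`, so the denominator is at least `1 + #D`.
The three counts are independent, and the union bound over pairs becomes `b Λ(A) Λ(B) E[1/(1+#D)] ≤
b Λ(A) Λ(B) / Λ(D)`. -/
theorem IsSample.measure_halfEdge_le (h : IsSample d l P X U) {A B D : Set (Vertex d)}
    (hA : MeasurableSet A) (hB : MeasurableSet B) (hD : MeasurableSet D) (hAB : Disjoint A B)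
    (hAD : Disjoint A D) (hBD : Disjoint B D) (hA' : intensity d l A ≠ ∞)
    (hB' : intensity d l B ≠ ∞) (hD' : intensity d l D ≠ ∞)
    {b ρ : ℝ} (hb : ∀ x ∈ A, ∀ y ∈ B, ρ ≤ ‖x.1 - y.1‖ →
      min 1 (x.2 ^ (-(γ * δ)) * ‖x.1 - y.1‖ ^ (-((d : ℝ) * δ))) ≤ b)
    (hint : ∀ x ∈ A, ∀ z ∈ D, ‖x.1 - z.1‖ ^ d ≤ x.2 ^ (-β)) :
    P (halfEdge γ δ β X U A B ρ) ≤
      ENNReal.ofReal b * (intensity d l A * intensity d l B * (intensity d l D)⁻¹) := by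
  have hv := h.vertices
  have hcD0 : Measurable fun ω => ((count X D ω : ℕ∞) : ℝ≥0∞) :=
    measurable_from_top.comp (measurable_count hv.measurable hD)
  have hcD : Measurable fun ω => (1 + ((count X D ω : ℕ∞) : ℝ≥0∞))⁻¹ :=
    (hcD0.const_add 1).inv
  have hle : ∀ i j, ∫⁻ ω, {ω | X i ω ∈ A ∧ X j ω ∈ B ∧ ρ ≤ ‖(X i ω).1 - (X j ω).1‖}.indicator
        (fun ω => halfProb d γ δ β (X i ω) (X j ω) (config d X ω \ {X i ω, X j ω})) ω ∂P ≤
      ∫⁻ ω, (X i ⁻¹' A).indicator (fun _ => 1) ω * (X j ⁻¹' B).indicator (fun _ => 1) ω *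
        (ENNReal.ofReal b * (1 + ((count X D ω : ℕ∞) : ℝ≥0∞))⁻¹) ∂P := by
    intro i j
    refine lintegral_mono_ae ?_
    filter_upwards [ae_injective hv] with ω hω
    by_cases hij : X i ω ∈ A ∧ X j ω ∈ B ∧ ρ ≤ ‖(X i ω).1 - (X j ω).1‖
    · rw [indicator_of_mem (by exact hij), indicator_of_mem (by exact hij.1),
        indicator_of_mem (by exact hij.2.1), one_mul, one_mul, halfProb, div_eq_mul_inv]
      gcongr
      · exact hb _ hij.1 _ hij.2.1 hij.2.2
      · exact count_le_interference hAD hBD hint hω hij.1 hij.2.1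
    · rw [indicator_of_notMem (by exact hij)]
      exact zero_le
  refine (h.measure_halfEdge_le_lintegral hA hB ρ).trans ?_
  refine (ENNReal.tsum_le_tsum fun i => ENNReal.tsum_le_tsum fun j => hle i j).trans ?_
  rw [hv.tsum_lintegral_indicator hA hB
    (f := fun ω => ENNReal.ofReal b * (1 + ((count X D ω : ℕ∞) : ℝ≥0∞))⁻¹) (hcD.const_mul _)]
  simp_rw [mul_left_comm _ (ENNReal.ofReal b)]
  rw [lintegral_const_mul' _ _ ENNReal.ofReal_ne_top,
    hv.lintegral_prod_three hA hB hD hAB hAD hBD (fun n => (n : ℝ≥0∞))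
      (fun n => (n : ℝ≥0∞)) (fun n => (1 + (n : ℝ≥0∞))⁻¹), hv.lintegral_count hA hA',
    hv.lintegral_count hB hB']
  gcongr
  have h1 := hv.mul_lintegral_inv_one_add_count hD hD'
  rw [ENNReal.le_inv_iff_mul_le, mul_comm, h1]
  have : (0 : ℝ) ≤ Real.exp (-(intensity d l D).toReal) := (Real.exp_pos _).le
  exact ENNReal.ofReal_le_one.2 (by linarith)

end LongEdges

/-! ### Long edges with prescribed mark: cubes and dyadic bins. -/

section LongEdges

variable {d : ℕ} {γ δ β : ℝ} {Ω : Type*} [MeasurableSpace Ω] {l : ℝ} {P : Measure Ω}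
  {X : ℕ → Ω → Vertex d} {U : Sym2 ℕ → Ω → ℝ}

/-- The interfering set is the same cube with marks outside the bin: it avoids the first endpoint by
its marks and the second by its location, while `hst` places the whole cube within the sphere of
interference. -/
theorem IsSample.measure_halfEdge_gridCube_le [NeZero d] (h : IsSample d l P X U) (hl : 0 < l)
    (hγδ : 0 ≤ γ * δ) (hδ : 0 ≤ δ) (hβ : 0 ≤ β) {s ρ R t : ℝ} (hs : 0 < s) (hρ : 0 < ρ)
    (ht : 0 < t) (ht1 : t ≤ 1) (hst : (d * s) ^ d ≤ t ^ (-β)) (q : Fin d → ℤ) :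
    P (halfEdge γ δ β X U ((gridCube s q ∩ Metric.ball 0 R) ×ˢ Ioc (t / 2) t)
      (((gridCube s q)ᶜ ∩ Metric.ball 0 R) ×ˢ univ) ρ) ≤
      volume (gridCube s q ∩ Metric.ball (0 : EuclideanSpace ℝ (Fin d)) R) *
        (ENNReal.ofReal ((t / 2) ^ (-(γ * δ)) * ρ ^ (-((d : ℝ) * δ)) * t / s ^ d * l) *
          volume (Metric.ball (0 : EuclideanSpace ℝ (Fin d)) R)) := by
  have hQ := measurableSet_gridCube s q
  have hball : MeasurableSet (Metric.ball (0 : EuclideanSpace ℝ (Fin d)) R) :=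
    Metric.isOpen_ball.measurableSet
  have hA1 : intensity d l ((gridCube s q ∩ Metric.ball 0 R) ×ˢ Ioc (t / 2) t) ≤
      ENNReal.ofReal l * (volume (gridCube s q ∩ Metric.ball 0 R) * ENNReal.ofReal (t / 2)) := by
    rw [intensity_prod]
    gcongr
    refine (Measure.restrict_apply_le _ _).trans ?_
    rw [Real.volume_Ioc]
    exact ENNReal.ofReal_le_ofReal (by linarith)
  have hB1 : intensity d l (((gridCube s q)ᶜ ∩ Metric.ball 0 R) ×ˢ univ) ≤
      ENNReal.ofReal l * volume (Metric.ball (0 : EuclideanSpace ℝ (Fin d)) R) := by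
    rw [intensity_cylinder]
    gcongr
    exact inter_subset_right
  -- The bin has length `t / 2 ≤ 1 / 2`, so discarding it keeps at least half of the interfering
  -- points on average.
  have hmarks : ENNReal.ofReal (1 / 2) ≤ volume.restrict (Ioo (0 : ℝ) 1) (Ioc (t / 2) t)ᶜ := by
    rw [Measure.restrict_apply measurableSet_Ioc.compl]
    have h1 : volume (Ioo (0 : ℝ) 1 \ Ioc (t / 2) t) = volume ((Ioc (t / 2) t)ᶜ ∩ Ioo (0 : ℝ) 1) := by
      rw [Set.sdiff_eq, inter_comm]
    rw [← h1]
    refine le_trans ?_ (le_measure_sdiff)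
    rw [Real.volume_Ioo, Real.volume_Ioc, ← ENNReal.ofReal_sub _ (by linarith)]
    exact ENNReal.ofReal_le_ofReal (by linarith)
  have hD1 : ENNReal.ofReal (l * s ^ d / 2) ≤
      intensity d l (gridCube s q ×ˢ (Ioc (t / 2) t)ᶜ) := by
    rw [intensity_prod, volume_gridCube hs]
    calc ENNReal.ofReal (l * s ^ d / 2) =
          ENNReal.ofReal l * (ENNReal.ofReal (s ^ d) * ENNReal.ofReal (1 / 2)) := by
          rw [← ENNReal.ofReal_mul (by positivity), ← ENNReal.ofReal_mul (by positivity)]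
          congr 1
          ring
      _ ≤ _ := by gcongr
  have hfin : volume (Metric.ball (0 : EuclideanSpace ℝ (Fin d)) R) ≠ ∞ := measure_ball_lt_top.ne
  have hfin' : volume (gridCube s q ∩ Metric.ball (0 : EuclideanSpace ℝ (Fin d)) R) ≠ ∞ :=
    ((measure_mono inter_subset_right).trans_lt measure_ball_lt_top).ne
  refine (h.measure_halfEdge_le (D := gridCube s q ×ˢ (Ioc (t / 2) t)ᶜ)
    (b := (t / 2) ^ (-(γ * δ)) * ρ ^ (-((d : ℝ) * δ)))
    ((hQ.inter hball).prod measurableSet_Ioc) ((hQ.compl.inter hball).prod MeasurableSet.univ)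
    (hQ.prod measurableSet_Ioc.compl) ?_ ?_ ?_ ?_ ?_ ?_ ?_ ?_).trans ?_
  · exact Disjoint.set_prod_left (Set.disjoint_left.2 fun x hx hx' => hx'.1 hx.1) _ _
  · exact Disjoint.set_prod_right disjoint_compl_right _ _
  · exact Disjoint.set_prod_left (Set.disjoint_left.2 fun x hx hx' => hx.1 hx') _ _
  · exact ne_top_of_le_ne_top (by finiteness) hA1
  · exact ne_top_of_le_ne_top (by finiteness) hB1
  · refine ne_top_of_le_ne_top (intensity_cylinder_ne_top (l := l) (s := gridCube s q) ?_)
      (measure_mono (prod_mono_right (subset_univ _)))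
    rw [volume_gridCube hs]
    exact ENNReal.ofReal_ne_top
  · rintro x ⟨-, hx⟩ y - hxy
    refine (min_le_right _ _).trans ?_
    have h1 : x.2 ^ (-(γ * δ)) ≤ (t / 2) ^ (-(γ * δ)) :=
      Real.rpow_le_rpow_of_nonpos (by positivity) hx.1.le (by linarith)
    have h2 : ‖x.1 - y.1‖ ^ (-((d : ℝ) * δ)) ≤ ρ ^ (-((d : ℝ) * δ)) :=
      Real.rpow_le_rpow_of_nonpos hρ hxy (by
        have := mul_nonneg (Nat.cast_nonneg (α := ℝ) d) hδ
        linarith)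
    exact mul_le_mul h1 h2 (by positivity) (by positivity)
  · rintro x ⟨hx, hx2⟩ z ⟨hz, -⟩
    have h1 : ‖x.1 - z.1‖ ^ d ≤ (d * s) ^ d :=
      pow_le_pow_left₀ (norm_nonneg _) (norm_sub_le_of_mem_gridCube hs hx.1 hz) _
    refine (h1.trans hst).trans ?_
    exact Real.rpow_le_rpow_of_nonpos ((by positivity : 0 < t / 2).trans hx2.1) hx2.2 (by linarith)
  · have h3 : (intensity d l (gridCube s q ×ˢ (Ioc (t / 2) t)ᶜ))⁻¹ ≤
        ENNReal.ofReal ((l * s ^ d / 2)⁻¹) := by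
      rw [ENNReal.ofReal_inv_of_pos (by positivity)]
      exact ENNReal.inv_le_inv.2 hD1
    calc _ ≤ ENNReal.ofReal ((t / 2) ^ (-(γ * δ)) * ρ ^ (-((d : ℝ) * δ))) *
          ((ENNReal.ofReal l * (volume (gridCube s q ∩ Metric.ball 0 R) * ENNReal.ofReal (t / 2))) *
          (ENNReal.ofReal l * volume (Metric.ball (0 : EuclideanSpace ℝ (Fin d)) R)) *
            ENNReal.ofReal ((l * s ^ d / 2)⁻¹)) := by gcongr
      _ = volume (gridCube s q ∩ Metric.ball (0 : EuclideanSpace ℝ (Fin d)) R) *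
          ((ENNReal.ofReal ((t / 2) ^ (-(γ * δ)) * ρ ^ (-((d : ℝ) * δ))) * ENNReal.ofReal l *
            ENNReal.ofReal (t / 2) * ENNReal.ofReal l * ENNReal.ofReal ((l * s ^ d / 2)⁻¹)) *
          volume (Metric.ball (0 : EuclideanSpace ℝ (Fin d)) R)) := by ring
      _ = _ := by
        rw [← ENNReal.ofReal_mul (by positivity), ← ENNReal.ofReal_mul (by positivity),
          ← ENNReal.ofReal_mul (by positivity), ← ENNReal.ofReal_mul (by positivity)]
        congr 3
        field_simp

/-- The constant in the bound on the number of long edges at a vertex with given mark. -/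
def halfEdgeConst (d : ℕ) (γ δ : ℝ) : ℝ := 2 ^ (γ * δ) * (2 * d) ^ d * ballVolume d ^ 2

theorem halfEdgeConst_pos (d : ℕ) [NeZero d] (γ δ : ℝ) : 0 < halfEdgeConst d γ δ := by
  have := ballVolume_pos d
  have hd : (0 : ℝ) < d := by exact_mod_cast Nat.pos_of_ne_zero (NeZero.ne d)
  unfold halfEdgeConst
  positivity

theorem IsSample.measure_halfEdge_bin_le [NeZero d] (h : IsSample d l P X U) (hl : 0 < l)
    (hγδ : 0 ≤ γ * δ) (hδ : 0 ≤ δ) (hβ : 0 ≤ β) {ρ R t : ℝ} (hρ : 0 < ρ) (hR : 0 ≤ R)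
    (ht : 0 < t) (ht1 : t ≤ 1) (htρ : t ^ (-β / d) ≤ ρ) :
    P (halfEdge γ δ β X U (Metric.ball 0 R ×ˢ Ioc (t / 2) t) (Metric.ball 0 R ×ˢ univ) ρ) ≤
      ENNReal.ofReal (halfEdgeConst d γ δ * l * R ^ (2 * d) * ρ ^ (-((d : ℝ) * δ)) *
        t ^ (1 - (γ * δ - β))) := by
  have hκ := ballVolume_pos d
  have hd : (0 : ℝ) < d := by exact_mod_cast Nat.pos_of_ne_zero (NeZero.ne d)
  -- The diameter bound `d * s` is half the interference radius at mark `t`. The cube thus lies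
  -- within every sphere of interference of the bin, and an edge of length at least `ρ ≥ t ^ (-β /
  -- d)` leaves it.
  set s : ℝ := t ^ (-β / d) / (2 * d) with hsdef
  have hs : 0 < s := by positivity
  have hds : d * s = t ^ (-β / d) / 2 := by
    rw [hsdef]; field_simp
  have hpow : (t ^ (-β / (d : ℝ))) ^ d = t ^ (-β) := by
    rw [← Real.rpow_natCast, ← Real.rpow_mul ht.le]
    congr 1
    field_simp
  have hst : (d * s) ^ d ≤ t ^ (-β) := by
    rw [← hpow, hds]
    exact pow_le_pow_left₀ (by positivity) (by linarith [Real.rpow_pos_of_pos ht (-β / d)]) _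
  have hsub : halfEdge γ δ β X U (Metric.ball 0 R ×ˢ Ioc (t / 2) t) (Metric.ball 0 R ×ˢ univ) ρ ⊆
      ⋃ q, halfEdge γ δ β X U ((gridCube s q ∩ Metric.ball 0 R) ×ˢ Ioc (t / 2) t)
        (((gridCube s q)ᶜ ∩ Metric.ball 0 R) ×ˢ univ) ρ := by
    rintro ω ⟨i, j, hi, hj, hij, hU⟩
    refine mem_iUnion.2 ⟨fun k => ⌊(X i ω).1 k / s⌋, i, j, ⟨⟨fun k => rfl, hi.1⟩, hi.2⟩,
      ⟨⟨fun hmem => ?_, hj.1⟩, hj.2⟩, hij, hU⟩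
    have := norm_sub_le_of_mem_gridCube hs (fun k => rfl : (X i ω).1 ∈ gridCube s _) hmem
    rw [hds] at this
    have hpos : 0 < t ^ (-β / (d : ℝ)) := by positivity
    linarith
  refine (measure_mono hsub).trans ((measure_iUnion_le _).trans ?_)
  refine (ENNReal.tsum_le_tsum fun q =>
    h.measure_halfEdge_gridCube_le hl hγδ hδ hβ hs hρ ht ht1 hst q).trans ?_
  rw [ENNReal.tsum_mul_right]
  have hvol : ∑' q, volume (gridCube s q ∩ Metric.ball (0 : EuclideanSpace ℝ (Fin d)) R) ≤
      volume (Metric.ball (0 : EuclideanSpace ℝ (Fin d)) R) := by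
    refine (tsum_meas_le_meas_iUnion_of_disjoint volume
      (fun q => (measurableSet_gridCube s q).inter Metric.isOpen_ball.measurableSet)
      fun q q' hq => ?_).trans (measure_mono (iUnion_subset fun q => inter_subset_right))
    exact (pairwise_disjoint_gridCube s hq).mono inter_subset_left inter_subset_left
  refine (mul_le_mul_left hvol _).trans ?_
  rw [volume_ball_eq 0 hR, ← ENNReal.ofReal_mul (by positivity), ← ENNReal.ofReal_mul (by positivity)]
  refine ENNReal.ofReal_le_ofReal (le_of_eq ?_)
  have hsd : s ^ d = t ^ (-β) / (2 * d) ^ d := by rw [hsdef, div_pow, hpow]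
  have h2 : (t / 2) ^ (-(γ * δ)) = t ^ (-(γ * δ)) * 2 ^ (γ * δ) := by
    rw [Real.div_rpow ht.le (by norm_num), Real.rpow_neg (by norm_num : (0 : ℝ) ≤ 2), div_inv_eq_mul]
  have h3 : t ^ (1 - (γ * δ - β)) = t ^ (-(γ * δ)) * t / t ^ (-β) := by
    rw [← Real.rpow_add_one ht.ne', ← Real.rpow_sub ht]
    congr 1
    ring
  rw [hsd, h2, h3, halfEdgeConst]
  have : 0 < t ^ (-β) := by positivity
  field_simp
  ring

/-- Marks below `a` are excluded by a first moment. Above `a`, `haρ` makes the bin estimate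
applicable, and `t ^ (1 - (γδ - β)) ≤ a ^ (-e) * t ^ η` turns the sum over dyadic `t` into a
geometric series. -/
theorem IsSample.measure_halfEdge_ball_le [NeZero d] (h : IsSample d l P X U) (hl : 0 < l)
    (hγδ : 0 ≤ γ * δ) (hδ : 0 ≤ δ) (hβ : 0 ≤ β) {ρ R a e η : ℝ} (hρ : 0 < ρ) (hR : 0 ≤ R)
    (ha : 0 < a) (haρ : a ^ (-β / d) ≤ ρ) (he : 0 ≤ e) (hη : 0 < η) (heη : γ * δ - β - 1 + η ≤ e) :
    P (halfEdge γ δ β X U (Metric.ball 0 R ×ˢ univ) (Metric.ball 0 R ×ˢ univ) ρ) ≤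
      ENNReal.ofReal (l * (ballVolume d * R ^ d) * a) +
      ENNReal.ofReal (halfEdgeConst d γ δ * l * R ^ (2 * d) * ρ ^ (-((d : ℝ) * δ)) * a ^ (-e) *
        (1 - (1 / 2 : ℝ) ^ η)⁻¹) := by
  have hC := halfEdgeConst_pos d γ δ
  set c : ℝ := halfEdgeConst d γ δ * l * R ^ (2 * d) * ρ ^ (-((d : ℝ) * δ)) with hc
  have hc0 : 0 ≤ c := by positivity
  have hx1 : (1 / 2 : ℝ) ^ η < 1 := Real.rpow_lt_one (by norm_num) (by norm_num) hη
  have hx0 : (0 : ℝ) ≤ (1 / 2 : ℝ) ^ η := by positivity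
  -- The condition `a ≤ (1 / 2) ^ k` is part of the event, so bins below the cutoff contribute
  -- nothing and the sum may run over all `k`.
  have hbin : ∀ k : ℕ, P {ω | ω ∈ halfEdge γ δ β X U (Metric.ball 0 R ×ˢ
      Ioc ((1 / 2 : ℝ) ^ k / 2) ((1 / 2 : ℝ) ^ k)) (Metric.ball 0 R ×ˢ univ) ρ ∧ a ≤ (1 / 2 : ℝ) ^ k} ≤
      ENNReal.ofReal (c * a ^ (-e) * ((1 / 2 : ℝ) ^ η) ^ k) := by
    intro k
    by_cases hk : a ≤ (1 / 2 : ℝ) ^ k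
    swap
    · exact (measure_mono (t := ∅) fun ω hω => absurd hω.2 hk).trans (by simp)
    set t : ℝ := (1 / 2 : ℝ) ^ k with ht
    have ht0 : 0 < t := by positivity
    have ht1 : t ≤ 1 := pow_le_one₀ (by norm_num) (by norm_num)
    have htρ : t ^ (-β / d) ≤ ρ :=
      (Real.rpow_le_rpow_of_nonpos ha hk
        (div_nonpos_of_nonpos_of_nonneg (by linarith) (by positivity))).trans haρ
    refine (measure_mono fun ω hω => hω.1).trans
      ((h.measure_halfEdge_bin_le hl hγδ hδ hβ hρ hR ht0 ht1 htρ).trans ?_)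
    refine ENNReal.ofReal_le_ofReal ?_
    rw [← hc, mul_assoc c (a ^ (-e))]
    refine mul_le_mul_of_nonneg_left ?_ hc0
    have h1 : ((1 / 2 : ℝ) ^ η) ^ k = t ^ η := by
      rw [ht, ← Real.rpow_natCast, ← Real.rpow_natCast, ← Real.rpow_mul (by norm_num),
        ← Real.rpow_mul (by norm_num), mul_comm]
    calc t ^ (1 - (γ * δ - β)) ≤ t ^ (-e + η) :=
          Real.rpow_le_rpow_of_exponent_ge ht0 ht1 (by linarith)
      _ = t ^ (-e) * t ^ η := Real.rpow_add ht0 _ _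
      _ ≤ a ^ (-e) * ((1 / 2 : ℝ) ^ η) ^ k := by
          rw [h1]
          exact mul_le_mul_of_nonneg_right (Real.rpow_le_rpow_of_nonpos ha hk (by linarith))
            (by positivity)
  have hsub : ∀ᵐ ω ∂P, ω ∈ halfEdge γ δ β X U (Metric.ball 0 R ×ˢ univ) (Metric.ball 0 R ×ˢ univ) ρ →
      ω ∈ {ω | ∃ n, (X n ω).1 ∈ Metric.ball 0 R ∧ (X n ω).2 < a} ∪
        ⋃ k : ℕ, {ω | ω ∈ halfEdge γ δ β X U (Metric.ball 0 R ×ˢ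
          Ioc ((1 / 2 : ℝ) ^ k / 2) ((1 / 2 : ℝ) ^ k)) (Metric.ball 0 R ×ˢ univ) ρ ∧
            a ≤ (1 / 2 : ℝ) ^ k} := by
    filter_upwards [ae_mark_mem h.vertices] with ω hω
    rintro ⟨i, j, hi, hj, hij, hU⟩
    by_cases hlow : (X i ω).2 < a
    · exact Or.inl ⟨i, hi.1, hlow⟩
    · obtain ⟨k, hk1, hk2⟩ := exists_nat_pow_near_of_lt_one (hω i).1 (hω i).2.le
        (by norm_num : (0 : ℝ) < 1 / 2) (by norm_num)
      refine Or.inr (mem_iUnion.2 ⟨k, ⟨i, j, ⟨hi.1, ?_, hk2⟩, hj, hij, hU⟩,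
        (not_lt.1 hlow).trans hk2⟩)
      rw [pow_succ] at hk1
      linarith
  refine (measure_mono_ae hsub).trans ((measure_union_le _ _).trans (add_le_add
    (measure_lowMark_le h.vertices hl.le 0 hR) ?_))
  refine (measure_iUnion_le _).trans ((ENNReal.tsum_le_tsum hbin).trans (le_of_eq ?_))
  rw [← ENNReal.ofReal_tsum_of_nonneg (fun k => by positivity)
    ((summable_geometric_of_lt_one hx0 hx1).mul_left _), tsum_mul_left,
    tsum_geometric_of_lt_one hx0 hx1]

end LongEdges

/-! ### Long edges at all lengths. -/

section LongEdges

variable {d : ℕ} {γ δ β : ℝ} {Ω : Type*} [MeasurableSpace Ω] {X : ℕ → Ω → Vertex d}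
  {U : Sym2 ℕ → Ω → ℝ}

/-- A vertex located in `B(0,R)` is the end of an edge of length at least `r`. -/
def longEdge (γ δ β : ℝ) (X : ℕ → Ω → Vertex d) (U : Sym2 ℕ → Ω → ℝ) (R r : ℝ) : Set Ω :=
  {ω | ∃ i j, (graph d γ δ β X U ω).Adj i j ∧ (X i ω).1 ∈ Metric.ball 0 R ∧
    r ≤ ‖(X i ω).1 - (X j ω).1‖}

theorem lt_halfProb_of_adj {ω : Ω} {i j : ℕ} (h : (graph d γ δ β X U ω).Adj i j) :
    ENNReal.ofReal (U s(i, j) ω) <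
        halfProb d γ δ β (X i ω) (X j ω) (config d X ω \ {X i ω, X j ω}) ∨
      ENNReal.ofReal (U s(j, i) ω) <
        halfProb d γ δ β (X j ω) (X i ω) (config d X ω \ {X j ω, X i ω}) := by
  rw [graph, SimpleGraph.fromRel_adj] at h
  rcases h.2 with h | h <;> unfold connProb at h <;> split_ifs at h
  · exact Or.inl h
  · rw [Sym2.eq_swap, Set.pair_comm]; exact Or.inr (by rwa [Sym2.eq_swap, Set.pair_comm] at h)
  · exact Or.inr h
  · exact Or.inl (by rwa [Sym2.eq_swap, Set.pair_comm] at h)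

/-- An edge of length in `[2 ^ k r, 2 ^ (k + 1) r)` from `B(0, M r)` has both ends in `B(0, (M + 2)
2 ^ k r)`. The half-edge is attached to whichever end controls the interference. -/
theorem longEdge_subset {M r : ℝ} (hM : 0 ≤ M) (hr : 0 < r) :
    longEdge γ δ β X U (M * r) r ⊆ ⋃ k : ℕ, halfEdge γ δ β X U
      (Metric.ball 0 ((M + 2) * (2 ^ k * r)) ×ˢ univ)
      (Metric.ball 0 ((M + 2) * (2 ^ k * r)) ×ˢ univ) (2 ^ k * r) := by
  rintro ω ⟨i, j, hij, hi, hlen⟩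
  obtain ⟨k, hk1, hk2⟩ := exists_nat_pow_near (x := ‖(X i ω).1 - (X j ω).1‖ / r) (y := (2 : ℝ))
    (by rwa [one_le_div hr]) (by norm_num)
  rw [le_div_iff₀ hr] at hk1
  rw [div_lt_iff₀ hr, pow_succ] at hk2
  have hkr : r ≤ 2 ^ k * r := le_mul_of_one_le_left hr.le (one_le_pow₀ (by norm_num))
  rw [mem_ball_zero_iff] at hi
  have hi' : ‖(X i ω).1‖ < (M + 2) * (2 ^ k * r) := by nlinarith
  have hj' : ‖(X j ω).1‖ < (M + 2) * (2 ^ k * r) := by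
    have := norm_sub_le (X i ω).1 ((X i ω).1 - (X j ω).1)
    rw [sub_sub_cancel] at this
    nlinarith
  refine mem_iUnion.2 ⟨k, ?_⟩
  rcases lt_halfProb_of_adj hij with h | h
  · exact ⟨i, j, ⟨mem_ball_zero_iff.2 hi', mem_univ _⟩, ⟨mem_ball_zero_iff.2 hj', mem_univ _⟩,
      hk1, h⟩
  · exact ⟨j, i, ⟨mem_ball_zero_iff.2 hj', mem_univ _⟩, ⟨mem_ball_zero_iff.2 hi', mem_univ _⟩,
      by rwa [norm_sub_rev], h⟩

/-- At length `ρ` the mark cutoff is `ρ ^ (-d (1 - μ))`, so that low marks cost `ρ ^ (dμ)`; `e` is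
chosen to give the remaining marks the same order. Then `hμδ` yields `e ≥ 0`, `hμs` yields `η > 0`,
and `hμβ` says that spheres of interference above the cutoff have radius at most `ρ`. As `μ < 0`,
dyadic lengths sum geometrically. The bound is linear in `l` with `C` uniform, as needed at small
intensity. -/
theorem exists_measure_longEdge_le [NeZero d] (hγδ : 0 ≤ γ * δ) (hδ : 0 ≤ δ) (hβ : 0 ≤ β)
    {μ M : ℝ} (hμ : μ < 0) (hμδ : 2 - δ < μ) (hμs : 2 - δ + (1 - μ) * (γ * δ - β - 1) < μ)
    (hμβ : β * (1 - μ) ≤ 1) (hM : 0 ≤ M) :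
    ∃ C : ℝ, 0 < C ∧ ∀ (l : ℝ) (P : Measure Ω), 0 < l → IsSample d l P X U → ∀ r : ℝ, 1 ≤ r →
      P (longEdge γ δ β X U (M * r) r) ≤ ENNReal.ofReal (l * C * r ^ (d * μ)) := by
  have hκ := ballVolume_pos d
  have hC0 := halfEdgeConst_pos d γ δ
  have hd : (0 : ℝ) < d := by exact_mod_cast Nat.pos_of_ne_zero (NeZero.ne d)
  have h1μ : 0 < 1 - μ := by linarith
  set e : ℝ := (μ - 2 + δ) / (1 - μ) with hedef
  have he : 0 ≤ e := div_nonneg (by linarith) h1μ.le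
  have he' : (1 - μ) * e = μ - 2 + δ := by rw [hedef]; field_simp
  set η : ℝ := e - (γ * δ - β - 1) with hηdef
  have hη : 0 < η := by
    have : γ * δ - β - 1 < e := by rw [hedef, lt_div_iff₀ h1μ]; linarith
    linarith
  have hx1 : (1 / 2 : ℝ) ^ η < 1 := Real.rpow_lt_one (by norm_num) (by norm_num) hη
  have hKη : 0 < (1 - (1 / 2 : ℝ) ^ η)⁻¹ := inv_pos.2 (by linarith)
  set Kη : ℝ := (1 - (1 / 2 : ℝ) ^ η)⁻¹
  set g : ℝ := (2 : ℝ) ^ ((d : ℝ) * μ) with hg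
  have hg0 : 0 < g := by positivity
  have hg1 : g < 1 := Real.rpow_lt_one_of_one_lt_of_neg (by norm_num) (by nlinarith)
  have hgi : 0 < (1 - g)⁻¹ := inv_pos.2 (by linarith)
  set D : ℝ := ballVolume d * (M + 2) ^ d + halfEdgeConst d γ δ * (M + 2) ^ (2 * d) * Kη with hDdef
  have hD : 0 < D := by positivity
  refine ⟨D * (1 - g)⁻¹, by positivity, fun l P hl h r hr => ?_⟩
  have hr0 : 0 < r := one_pos.trans_le hr
  have hscale : ∀ ρ : ℝ, 1 ≤ ρ → P (halfEdge γ δ β X U (Metric.ball 0 ((M + 2) * ρ) ×ˢ univ)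
      (Metric.ball 0 ((M + 2) * ρ) ×ˢ univ) ρ) ≤ ENNReal.ofReal (l * D * ρ ^ ((d : ℝ) * μ)) := by
    intro ρ hρ
    have hρ0 : 0 < ρ := one_pos.trans_le hρ
    have ha : 0 < ρ ^ (-((d : ℝ) * (1 - μ))) := by positivity
    have haρ : (ρ ^ (-((d : ℝ) * (1 - μ)))) ^ (-β / (d : ℝ)) ≤ ρ := by
      rw [← Real.rpow_mul hρ0.le]
      calc ρ ^ (-((d : ℝ) * (1 - μ)) * (-β / d)) ≤ ρ ^ (1 : ℝ) := by
            refine Real.rpow_le_rpow_of_exponent_le hρ ?_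
            have : -((d : ℝ) * (1 - μ)) * (-β / d) = β * (1 - μ) := by field_simp
            rw [this]
            exact hμβ
        _ = ρ := Real.rpow_one ρ
    refine (h.measure_halfEdge_ball_le hl hγδ hδ hβ hρ0 (by positivity) ha haρ he hη
      (by linarith)).trans ?_
    rw [← ENNReal.ofReal_add (by positivity) (by positivity)]
    refine ENNReal.ofReal_le_ofReal (le_of_eq ?_)
    have e1 : ρ ^ d * ρ ^ (-((d : ℝ) * (1 - μ))) = ρ ^ ((d : ℝ) * μ) := by
      rw [← Real.rpow_natCast, ← Real.rpow_add hρ0]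
      congr 1
      ring
    have e2 : ρ ^ (2 * d) * ρ ^ (-((d : ℝ) * δ)) * (ρ ^ (-((d : ℝ) * (1 - μ)))) ^ (-e) =
        ρ ^ ((d : ℝ) * μ) := by
      rw [← Real.rpow_mul hρ0.le, ← Real.rpow_natCast, ← Real.rpow_add hρ0, ← Real.rpow_add hρ0]
      congr 1
      push_cast
      linear_combination (d : ℝ) * he'
    rw [mul_pow, mul_pow]
    calc _ = l * ballVolume d * (M + 2) ^ d * (ρ ^ d * ρ ^ (-((d : ℝ) * (1 - μ)))) +
          halfEdgeConst d γ δ * l * (M + 2) ^ (2 * d) * Kη * (ρ ^ (2 * d) * ρ ^ (-((d : ℝ) * δ)) *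
            (ρ ^ (-((d : ℝ) * (1 - μ)))) ^ (-e)) := by ring
      _ = _ := by rw [e1, e2, hDdef]; ring
  refine (measure_mono (longEdge_subset hM hr0)).trans ((measure_iUnion_le _).trans ?_)
  calc _ ≤ ∑' k : ℕ, ENNReal.ofReal (l * D * r ^ ((d : ℝ) * μ) * g ^ k) := by
        refine ENNReal.tsum_le_tsum fun k => ?_
        have h2k : (1 : ℝ) ≤ 2 ^ k := one_le_pow₀ (by norm_num)
        refine (hscale _ (one_le_mul_of_one_le_of_one_le h2k hr)).trans
          (ENNReal.ofReal_le_ofReal (le_of_eq ?_))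
        rw [Real.mul_rpow (by positivity) hr0.le, hg, ← Real.rpow_natCast, ← Real.rpow_natCast,
          ← Real.rpow_mul (by norm_num), ← Real.rpow_mul (by norm_num), mul_comm (k : ℝ)]
        ring
    _ = ENNReal.ofReal (l * (D * (1 - g)⁻¹) * r ^ ((d : ℝ) * μ)) := by
        rw [← ENNReal.ofReal_tsum_of_nonneg (fun k => by positivity)
          ((summable_geometric_of_lt_one hg0.le hg1).mul_left _), tsum_mul_left,
          tsum_geometric_of_lt_one hg0.le hg1]
        congr 1
        ring

end LongEdges

/-! ### Renormalisation: one large crossing contains two distant small ones. -/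

section Renormalisation

theorem exists_first_exit {V : Type*} {R : V → V → Prop} {p : V → Prop} {a b : V}
    (h : Relation.ReflTransGen R a b) (ha : p a) (hb : ¬p b) :
    ∃ u v, Relation.ReflTransGen (fun i j => R i j ∧ p i ∧ p j) a u ∧ p u ∧ ¬p v ∧ R u v ∧
      Relation.ReflTransGen R v b := by
  induction h using Relation.ReflTransGen.head_induction_on with
  | refl => exact absurd ha hb
  | @head a c hac hcb ih =>
    by_cases hc : p c
    · obtain ⟨u, v, h1, h2⟩ := ih hc
      exact ⟨u, v, Relation.ReflTransGen.head ⟨hac, ha, hc⟩ h1, h2⟩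
    · exact ⟨a, c, Relation.ReflTransGen.refl, ha, hc, hac, hcb⟩

variable {d : ℕ} {γ δ β : ℝ} {Ω : Type*} {X : ℕ → Ω → Vertex d} {U : Sym2 ℕ → Ω → ℝ}

theorem mem_localCrossing_iff_reflTransGen {ω : Ω} {c : EuclideanSpace ℝ (Fin d)} {r : ℝ} :
    ω ∈ localCrossing d γ δ β X U c r ↔ ∃ i j, (X i ω).1 ∈ Metric.ball c r ∧
      (X j ω).1 ∉ Metric.ball c (2 * r) ∧ (X i ω).1 ∈ Metric.ball c (3 * r) ∧
      (X j ω).1 ∈ Metric.ball c (3 * r) ∧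
      Relation.ReflTransGen (fun i j => (graph d γ δ β X U ω).Adj i j ∧
        (X i ω).1 ∈ Metric.ball c (3 * r) ∧ (X j ω).1 ∈ Metric.ball c (3 * r)) i j := by
  simp only [localCrossing, mem_ofPred_eq, induce_reachable_iff]
  constructor
  · rintro ⟨i, j, hi, hj, h⟩
    exact ⟨i, j, hi, hj, i.2, j.2, h⟩
  · rintro ⟨i, j, hi, hj, hi', hj', h⟩
    exact ⟨⟨i, hi'⟩, ⟨j, hj'⟩, hi, hj, h⟩

/-- With steps shorter than `r`, the first vertex outside `B(c,2r)` still lies in `B(c,3r)`, so the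
path can be stopped there. -/
theorem mem_localCrossing_of_path {ω : Ω} {c : EuclideanSpace ℝ (Fin d)} {r : ℝ}
    {R : ℕ → ℕ → Prop} (hR : ∀ a b, R a b → (graph d γ δ β X U ω).Adj a b ∧
      ‖(X a ω).1 - (X b ω).1‖ < r) {i j : ℕ} (hi : (X i ω).1 ∈ Metric.ball c r)
    (hj : (X j ω).1 ∉ Metric.ball c (2 * r)) (h : Relation.ReflTransGen R i j) :
    ω ∈ localCrossing d γ δ β X U c r := by
  have hr : 0 < r := dist_nonneg.trans_lt hi
  have h23 : Metric.ball c (2 * r) ⊆ Metric.ball c (3 * r) := Metric.ball_subset_ball (by linarith)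
  have h12 : Metric.ball c r ⊆ Metric.ball c (2 * r) := Metric.ball_subset_ball (by linarith)
  obtain ⟨u, v, h1, hu, hv, huv, -⟩ :=
    exists_first_exit (p := fun n => (X n ω).1 ∈ Metric.ball c (2 * r)) h (h12 hi) hj
  have hv3 : (X v ω).1 ∈ Metric.ball c (3 * r) := by
    have h2 := (hR u v huv).2
    rw [Metric.mem_ball] at hu ⊢
    rw [← dist_eq_norm, dist_comm] at h2
    linarith [dist_triangle (X v ω).1 (X u ω).1 c]
  refine mem_localCrossing_iff_reflTransGen.2 ⟨i, v, hi, hv, h23 (h12 hi), hv3, ?_⟩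
  refine Relation.ReflTransGen.tail (b := u) ?_ ⟨(hR u v huv).1, h23 hu, hv3⟩
  exact Relation.ReflTransGen.mono (fun a b hab => ⟨(hR a b hab.1).1, h23 hab.2.1, h23 hab.2.2⟩) _ _ h1

theorem crossing_subset (r : ℝ) :
    crossing d γ δ β X U r ⊆
      localCrossing d γ δ β X U 0 r ∪ longEdge γ δ β X U (2 * r) r := by
  rintro ω ⟨i, j, hi, hj, h⟩
  by_cases hlong : ω ∈ longEdge γ δ β X U (2 * r) r
  · exact Or.inr hlong
  refine Or.inl ?_
  have hr : 0 < r := dist_nonneg.trans_lt hi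
  rw [SimpleGraph.reachable_iff_reflTransGen] at h
  obtain ⟨u, v, h1, hu, hv, huv, -⟩ :=
    exists_first_exit (p := fun n => (X n ω).1 ∈ Metric.ball 0 (2 * r)) h
      (Metric.ball_subset_ball (by linarith) hi) hj
  have hlen : ∀ a b, (graph d γ δ β X U ω).Adj a b → (X a ω).1 ∈ Metric.ball 0 (2 * r) →
      ‖(X a ω).1 - (X b ω).1‖ < r := by
    intro a b hab ha
    by_contra! hcon
    exact hlong ⟨a, b, hab, ha, hcon⟩
  refine mem_localCrossing_of_path (R := fun a b => (graph d γ δ β X U ω).Adj a b ∧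
    (X a ω).1 ∈ Metric.ball 0 (2 * r)) (fun a b hab => ⟨hab.1, hlen a b hab.1 hab.2⟩) hi hv ?_
  refine Relation.ReflTransGen.tail (b := u) ?_ ⟨huv, hu⟩
  exact Relation.ReflTransGen.mono (fun a b hab => ⟨hab.1, hab.2.1⟩) _ _ h1

theorem localCrossing_subset_crossing (r : ℝ) :
    localCrossing d γ δ β X U 0 r ⊆ crossing d γ δ β X U r := by
  intro ω hω
  obtain ⟨i, j, hi, hj, -, -, h⟩ := mem_localCrossing_iff_reflTransGen.1 hω
  refine ⟨i, j, hi, hj, ?_⟩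
  rw [SimpleGraph.reachable_iff_reflTransGen]
  exact Relation.ReflTransGen.mono (fun a b hab => hab.1) _ _ h

/-- Without long edges the path visits a shell of width `r` just outside `B(0, K r)` and another
just outside `B(0, 2 K r)`. Followed onwards from the first and backwards from the second, it
travels at least `(K - 1) r`, so it crosses an annulus around a covering ball at each place. -/
theorem localCrossing_subset_of_cover {t : Finset (EuclideanSpace ℝ (Fin d))} {K r : ℝ}
    (hK : 11 ≤ K) (hr : 0 < r)
    (ht : Metric.closedBall (0 : EuclideanSpace ℝ (Fin d)) (2 * K + 1) ⊆ ⋃ y ∈ t, Metric.ball y 1) :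
    localCrossing d γ δ β X U 0 (K * r) ⊆ longEdge γ δ β X U (3 * K * r) r ∪
      ⋃ y ∈ t, ⋃ z ∈ t, {ω | 8 * r ≤ dist (r • y) (r • z) ∧
        ω ∈ localCrossing d γ δ β X U (r • y) r ∧ ω ∈ localCrossing d γ δ β X U (r • z) r} := by
  intro ω hω
  by_cases hlong : ω ∈ longEdge γ δ β X U (3 * K * r) r
  · exact Or.inl hlong
  refine Or.inr ?_
  obtain ⟨i, j, hi, hj, -, -, h⟩ := mem_localCrossing_iff_reflTransGen.1 hω
  set R : ℕ → ℕ → Prop := fun i j => (graph d γ δ β X U ω).Adj i j ∧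
    (X i ω).1 ∈ Metric.ball 0 (3 * (K * r)) ∧ (X j ω).1 ∈ Metric.ball 0 (3 * (K * r)) with hRdef
  have hR : ∀ a b, R a b → (graph d γ δ β X U ω).Adj a b ∧ ‖(X a ω).1 - (X b ω).1‖ < r := by
    intro a b hab
    refine ⟨hab.1, ?_⟩
    by_contra! hcon
    exact hlong ⟨a, b, hab.1, by rw [mul_assoc]; exact hab.2.1, hcon⟩
  have hsymm : Std.Symm R := ⟨fun a b hab => ⟨hab.1.symm, hab.2.2, hab.2.1⟩⟩
  have hKr : 11 * r ≤ K * r := mul_le_mul_of_nonneg_right hK hr.le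
  have hcov : ∀ x : EuclideanSpace ℝ (Fin d), ‖x‖ ≤ (2 * K + 1) * r →
      ∃ y ∈ t, x ∈ Metric.ball (r • y) r := by
    intro x hx
    have : r⁻¹ • x ∈ Metric.closedBall (0 : EuclideanSpace ℝ (Fin d)) (2 * K + 1) := by
      rw [mem_closedBall_zero_iff, norm_smul, norm_inv, Real.norm_eq_abs, abs_of_pos hr,
        inv_mul_le_iff₀ hr, mul_comm]
      exact hx
    obtain ⟨y, hy, hxy⟩ := mem_iUnion₂.1 (ht this)
    refine ⟨y, hy, ?_⟩
    rw [mem_ball_iff_norm] at hxy ⊢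
    have e : x - r • y = r • (r⁻¹ • x - y) := by rw [smul_sub, smul_inv_smul₀ hr.ne']
    rw [e, norm_smul, Real.norm_eq_abs, abs_of_pos hr]
    nlinarith
  rw [mem_ball_zero_iff] at hi hj
  rw [not_lt] at hj
  -- a vertex just outside `B(0, K r)`, from which the path goes on to the outside of `B(0, 2 K r)`
  obtain ⟨u, b, -, hu, hb, hub, hbj⟩ :=
    exists_first_exit (p := fun n => ‖(X n ω).1‖ < K * r) h hi (by linarith)
  rw [not_lt] at hb
  have hb' : ‖(X b ω).1‖ < (K + 1) * r := by
    have h1 := (hR u b hub).2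
    have h2 := norm_sub_le (X u ω).1 ((X u ω).1 - (X b ω).1)
    rw [sub_sub_cancel] at h2
    linarith
  -- a vertex just outside `B(0, 2 K r)`, which is reached from the inside of `B(0, K r)`
  obtain ⟨w, e, hiw, hw, he, hwe, -⟩ :=
    exists_first_exit (p := fun n => ‖(X n ω).1‖ < 2 * (K * r)) h (by linarith) (by linarith)
  rw [not_lt] at he
  have he' : ‖(X e ω).1‖ < (2 * K + 1) * r := by
    have h1 := (hR w e hwe).2
    have h2 := norm_sub_le (X w ω).1 ((X w ω).1 - (X e ω).1)
    rw [sub_sub_cancel] at h2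
    linarith
  have hie : Relation.ReflTransGen R i e :=
    Relation.ReflTransGen.tail (Relation.ReflTransGen.mono (fun _ _ hab => hab.1) _ _ hiw) hwe
  obtain ⟨y, hyt, hy⟩ := hcov (X b ω).1 (by nlinarith)
  obtain ⟨z, hzt, hz⟩ := hcov (X e ω).1 he'.le
  rw [mem_ball_iff_norm] at hy hz
  refine mem_iUnion₂.2 ⟨y, hyt, mem_iUnion₂.2 ⟨z, hzt, ?_, ?_, ?_⟩⟩
  -- The two vertices are at distance at least `(2 K - (K + 1)) r` and each is within `r` of its
  -- centre, so the centres are `(K - 3) r` apart. This is where `K ≥ 11` comes from.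
  · have h1 := norm_sub_norm_le (X e ω).1 (X b ω).1
    have h2 : ‖(X e ω).1 - (X b ω).1‖ ≤
        ‖(X e ω).1 - r • z‖ + dist (r • y) (r • z) + ‖(X b ω).1 - r • y‖ := by
      rw [dist_comm, dist_eq_norm, norm_sub_rev (X b ω).1]
      refine le_trans (le_of_eq ?_) (norm_add₃_le)
      congr 1
      abel
    nlinarith
  · refine mem_localCrossing_of_path hR (mem_ball_iff_norm.2 hy) ?_ hbj
    rw [mem_ball_iff_norm, not_lt]
    have h1 := norm_sub_norm_le (X j ω).1 (X b ω).1
    have h2 : ‖(X j ω).1 - (X b ω).1‖ ≤ ‖(X j ω).1 - r • y‖ + ‖(X b ω).1 - r • y‖ := by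
      rw [norm_sub_rev (X b ω).1]
      exact norm_sub_le_norm_sub_add_norm_sub _ _ _
    nlinarith
  · refine mem_localCrossing_of_path hR (mem_ball_iff_norm.2 hz) ?_
      (Relation.ReflTransGen.stdSymm.symm _ _ hie)
    rw [mem_ball_iff_norm, not_lt]
    have h1 := norm_sub_norm_le (X e ω).1 (X i ω).1
    have h2 : ‖(X e ω).1 - (X i ω).1‖ ≤ ‖(X e ω).1 - r • z‖ + ‖(X i ω).1 - r • z‖ := by
      rw [norm_sub_rev (X i ω).1]
      exact norm_sub_le_norm_sub_add_norm_sub _ _ _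
    nlinarith

end Renormalisation

/-! ### Recursive inequalities across scales. -/

section Recursion

theorem exists_le_rpow_of_recursion {g : ℝ → ℝ} {K a c r₀ : ℝ} (hK : 1 < K) (ha : 0 < a)
    (hr₀ : 0 < r₀) (h1 : ∀ r, g r ≤ 1)
    (hg : ∀ r, r₀ ≤ r → g (K * r) ≤ K ^ (-a) / 2 * g r + c * r ^ (-a)) :
    ∃ C, 0 < C ∧ ∀ r, r₀ ≤ r → g r ≤ C * r ^ (-a) := by
  have hK0 : 0 < K := one_pos.trans hK
  have hKa : 0 < K ^ a := by positivity
  -- The first entry covers the scales in `[r₀, K r₀]` through `g ≤ 1`; the second lets the error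
  -- term use only half of `C`, the contraction using the other half.
  set C : ℝ := max ((K * r₀) ^ a) (2 * c * K ^ a)
  have hC : 0 < C := lt_max_of_lt_left (by positivity)
  have key : ∀ n : ℕ, ∀ r, r₀ ≤ r → r ≤ K ^ (n + 1) * r₀ → g r ≤ C * r ^ (-a) := by
    intro n
    induction n with
    | zero =>
      intro r hr hr'
      have hr0 : 0 < r := hr₀.trans_le hr
      rw [zero_add, pow_one] at hr'
      calc g r ≤ 1 := h1 r
        _ = r ^ a * r ^ (-a) := by rw [← Real.rpow_add hr0, add_neg_cancel, Real.rpow_zero]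
        _ ≤ C * r ^ (-a) := by
            gcongr
            exact (Real.rpow_le_rpow hr0.le hr' ha.le).trans (le_max_left _ _)
    | succ n ih =>
      intro r hr hr'
      by_cases hrK : r ≤ K * r₀
      · refine ih r hr (hrK.trans ?_)
        gcongr
        exact le_self_pow₀ hK.le (by omega)
      rw [not_le] at hrK
      have hr0 : 0 < r := hr₀.trans_le hr
      have hs : r = K * (r / K) := by field_simp
      have hs1 : r₀ ≤ r / K := by rw [le_div_iff₀ hK0, mul_comm]; exact hrK.le
      have hs2 : r / K ≤ K ^ (n + 1) * r₀ := by
        rw [div_le_iff₀ hK0]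
        refine hr'.trans (le_of_eq ?_)
        ring
      have h2 := hg (r / K) hs1
      rw [← hs] at h2
      have h3 := ih (r / K) hs1 hs2
      have hp : (r / K) ^ (-a) = r ^ (-a) * K ^ a := by
        rw [Real.div_rpow hr0.le hK0.le, Real.rpow_neg hK0.le, div_inv_eq_mul]
      rw [hp] at h2 h3
      have hKK : K ^ (-a) * K ^ a = 1 := by
        rw [← Real.rpow_add hK0, neg_add_cancel, Real.rpow_zero]
      calc g r ≤ K ^ (-a) / 2 * g (r / K) + c * (r ^ (-a) * K ^ a) := h2
        _ ≤ K ^ (-a) / 2 * (C * (r ^ (-a) * K ^ a)) + c * (r ^ (-a) * K ^ a) := by gcongr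
        _ = (C * (K ^ (-a) * K ^ a) + 2 * c * K ^ a) / 2 * r ^ (-a) := by ring
        _ ≤ C * r ^ (-a) := by
            rw [hKK, mul_one]
            gcongr
            linarith [le_max_right ((K * r₀) ^ a) (2 * c * K ^ a)]
  refine ⟨C, hC, fun r hr => ?_⟩
  obtain ⟨n, hn⟩ := ((tendsto_pow_atTop_atTop_of_one_lt hK).eventually_ge_atTop (r / r₀)).exists
  refine key n r hr ?_
  rw [← div_le_iff₀ hr₀]
  exact hn.trans (pow_le_pow_right₀ hK.le (by omega))

/-- The level `η` reproduces itself: `A η^2 ≤ η / 2` and `c ≤ η / 2`. -/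
theorem le_of_quadratic_recursion {g : ℝ → ℝ} {K A c η : ℝ} (hK : 1 < K)
    (hg0 : ∀ r, 0 ≤ g r) (hA : 0 ≤ A) (hAη : A * η ≤ 1 / 2) (hcη : c ≤ η / 2) (hη : 0 ≤ η)
    (hbase : ∀ r, 1 ≤ r → r ≤ K → g r ≤ η) (hg : ∀ r, 1 ≤ r → g (K * r) ≤ A * g r ^ 2 + c) :
    ∀ r, 1 ≤ r → g r ≤ η := by
  have hK0 : 0 < K := one_pos.trans hK
  have key : ∀ n : ℕ, ∀ r, 1 ≤ r → r ≤ K ^ (n + 1) → g r ≤ η := by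
    intro n
    induction n with
    | zero => intro r hr hr'; exact hbase r hr (by simpa using hr')
    | succ n ih =>
      intro r hr hr'
      by_cases hrK : r ≤ K
      · exact hbase r hr hrK
      rw [not_le] at hrK
      have hs : r = K * (r / K) := by field_simp
      have hs1 : 1 ≤ r / K := by rw [le_div_iff₀ hK0, one_mul]; exact hrK.le
      have hs2 : r / K ≤ K ^ (n + 1) := by
        rw [div_le_iff₀ hK0]
        exact hr'.trans (le_of_eq (pow_succ _ _))
      have h2 := hg (r / K) hs1
      rw [← hs] at h2
      have h3 := ih (r / K) hs1 hs2
      have h4 : g (r / K) ^ 2 ≤ η ^ 2 := pow_le_pow_left₀ (hg0 _) h3 2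
      nlinarith [mul_le_mul_of_nonneg_left h4 hA]
  intro r hr
  obtain ⟨n, hn⟩ := ((tendsto_pow_atTop_atTop_of_one_lt hK).eventually_ge_atTop r).exists
  exact key n r hr (hn.trans (pow_le_pow_right₀ hK.le (by omega)))

variable {d : ℕ} {γ δ β : ℝ} {Ω : Type*} [MeasurableSpace Ω] {l : ℝ} {P : Measure Ω}
  {X : ℕ → Ω → Vertex d} {U : Sym2 ℕ → Ω → ℝ}

theorem interferenceBound_le [NeZero d] (hβ : 0 ≤ β) {μ r : ℝ} (hμβ : β * (1 - μ) ≤ 1)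
    (hl : 0 ≤ l) (hr : 1 ≤ r) :
    interferenceBound d β l (3 * r) r ≤ l * (ballVolume d * 3 ^ d) * r ^ ((d : ℝ) * μ) := by
  have hκ := ballVolume_pos d
  have hr0 : 0 < r := one_pos.trans_le hr
  unfold interferenceBound
  split_ifs with h
  · positivity
  have hβ0 : 0 < β := lt_of_le_of_ne hβ (Ne.symm h)
  have h1 : r ^ d * r ^ (-(d : ℝ) / β) ≤ r ^ ((d : ℝ) * μ) := by
    rw [← Real.rpow_natCast, ← Real.rpow_add hr0]
    refine Real.rpow_le_rpow_of_exponent_le hr ?_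
    have h2 : 1 - μ ≤ 1 / β := by rw [le_div_iff₀ hβ0]; linarith
    have h3 := mul_le_mul_of_nonneg_left h2 (Nat.cast_nonneg (α := ℝ) d)
    have h4 : -(d : ℝ) / β = -((d : ℝ) * (1 / β)) := by ring
    rw [h4]
    linarith
  calc l * (ballVolume d * (3 * r) ^ d) * r ^ (-(d : ℝ) / β) =
        l * (ballVolume d * 3 ^ d) * (r ^ d * r ^ (-(d : ℝ) / β)) := by rw [mul_pow]; ring
    _ ≤ _ := by gcongr

theorem localEvent_subset_union [NeZero d] {c : EuclideanSpace ℝ (Fin d)} {r : ℝ} (hr : 0 ≤ r) :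
    localEvent γ δ β X U c r ⊆
      localCrossing d γ δ β X U c r ∪ highInterference β X c (3 * r) r := by
  intro ω hω
  by_cases h : ω ∈ highInterference β X c (3 * r) r
  · exact Or.inr h
  · exact Or.inl ((mem_localEvent_iff_of_notMem hr h).1 hω)

theorem localCrossing_subset_union [NeZero d] {c : EuclideanSpace ℝ (Fin d)} {r : ℝ} (hr : 0 ≤ r) :
    localCrossing d γ δ β X U c r ⊆
      localEvent γ δ β X U c r ∪ highInterference β X c (3 * r) r := by
  intro ω hω
  by_cases h : ω ∈ highInterference β X c (3 * r) r
  · exact Or.inr h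
  · exact Or.inl ((mem_localEvent_iff_of_notMem hr h).2 hω)

theorem IsSample.measureReal_highInterference_le [NeZero d] (h : IsSample d l P X U) (hl : 0 ≤ l)
    (hβ : 0 ≤ β) {μ r : ℝ} (hμβ : β * (1 - μ) ≤ 1) (c : EuclideanSpace ℝ (Fin d)) (hr : 1 ≤ r) :
    P.real (highInterference β X c (3 * r) r) ≤
      l * (ballVolume d * 3 ^ d) * r ^ ((d : ℝ) * μ) :=
  (ENNReal.toReal_le_of_le_ofReal (interferenceBound_nonneg β hl (by positivity) (by positivity))
    (measure_highInterference_le h.vertices hl hβ c (by positivity) hr)).trans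
    (interferenceBound_le hβ hμβ hl hr)

/-- The recursion is run for local events, for which independence and stationarity are exact;
switching to true crossings and back costs only large spheres of interference, of order `r ^ (dμ)`.
The constants are uniform in the intensity. -/
theorem exists_localEvent_recursion [NeZero d] (hγδ : 0 ≤ γ * δ) (hδ : 0 ≤ δ) (hβ : 0 ≤ β)
    {μ : ℝ} (hμ : μ < 0) (hμδ : 2 - δ < μ) (hμs : 2 - δ + (1 - μ) * (γ * δ - β - 1) < μ)
    (hμβ : β * (1 - μ) ≤ 1) :
    ∃ A C : ℝ, 0 < A ∧ 0 < C ∧ ∀ (l : ℝ) (P : Measure Ω), 0 < l → IsSample d l P X U →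
      ∀ r : ℝ, 1 ≤ r → P.real (localEvent γ δ β X U 0 (11 * r)) ≤
        A * P.real (localEvent γ δ β X U 0 r) ^ 2 + l * C * r ^ ((d : ℝ) * μ) := by
  have hκ := ballVolume_pos d
  obtain ⟨C, hC, hlong⟩ := exists_measure_longEdge_le (X := X) (U := U) hγδ hδ hβ hμ hμδ hμs hμβ
    (M := 3 * 11) (by norm_num)
  obtain ⟨t, ht⟩ : ∃ t : Finset (EuclideanSpace ℝ (Fin d)),
      Metric.closedBall (0 : EuclideanSpace ℝ (Fin d)) (2 * 11 + 1) ⊆ ⋃ y ∈ t, Metric.ball y 1 := by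
    obtain ⟨t, -, htf, ht⟩ := (isCompact_closedBall (0 : EuclideanSpace ℝ (Fin d))
      (2 * 11 + 1)).finite_cover_balls one_pos
    exact ⟨htf.toFinset, by simpa using ht⟩
  set N : ℝ := (t.card : ℝ)
  have hN : 0 ≤ N := by positivity
  -- `N * N` counts pairs of covering balls and the extra one secures positivity. The error collects
  -- large spheres at scale `11 r`, long edges, and large spheres around the `N` centres at scale
  -- `r`.
  refine ⟨N * N + 1, ballVolume d * 3 ^ d + C + N * (ballVolume d * 3 ^ d), by positivity,
    by positivity, fun l P hl h r hr => ?_⟩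
  have := h.vertices.isProbabilityMeasure
  have hr0 : 0 < r := one_pos.trans_le hr
  have hK : (1 : ℝ) ≤ 11 * r := by linarith
  set g := P.real (localEvent γ δ β X U 0 r) with hg
  set S : EuclideanSpace ℝ (Fin d) → EuclideanSpace ℝ (Fin d) → Set Ω := fun y z =>
    {ω | 8 * r ≤ dist (r • y) (r • z) ∧ ω ∈ localEvent γ δ β X U (r • y) r ∧
      ω ∈ localEvent γ δ β X U (r • z) r} with hS
  have hsub : localEvent γ δ β X U 0 (11 * r) ⊆
      highInterference β X 0 (3 * (11 * r)) (11 * r) ∪ (longEdge γ δ β X U (3 * 11 * r) r ∪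
        ((⋃ y ∈ t, highInterference β X (r • y) (3 * r) r) ∪ ⋃ y ∈ t, ⋃ z ∈ t, S y z)) := by
    intro ω hω
    rcases localEvent_subset_union (by positivity) hω with h1 | h1
    swap
    · exact Or.inl h1
    rcases localCrossing_subset_of_cover le_rfl hr0 ht h1 with h2 | h2
    · exact Or.inr (Or.inl h2)
    refine Or.inr (Or.inr ?_)
    by_cases hhi : ω ∈ ⋃ y ∈ t, highInterference β X (r • y) (3 * r) r
    · exact Or.inl hhi
    refine Or.inr ?_
    obtain ⟨y, hy, h3⟩ := mem_iUnion₂.1 h2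
    obtain ⟨z, hz, h4, h5, h6⟩ := mem_iUnion₂.1 h3
    have hni : ∀ y ∈ t, ω ∉ highInterference β X (r • y) (3 * r) r := fun y hy hy' =>
      hhi (mem_iUnion₂.2 ⟨y, hy, hy'⟩)
    exact mem_iUnion₂.2 ⟨y, hy, mem_iUnion₂.2 ⟨z, hz, h4,
      (mem_localEvent_iff_of_notMem hr0.le (hni y hy)).2 h5,
      (mem_localEvent_iff_of_notMem hr0.le (hni z hz)).2 h6⟩⟩
  have b1 : P.real (highInterference β X 0 (3 * (11 * r)) (11 * r)) ≤
      l * (ballVolume d * 3 ^ d) * r ^ ((d : ℝ) * μ) := by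
    refine (h.measureReal_highInterference_le hl.le hβ hμβ 0 hK).trans ?_
    refine mul_le_mul_of_nonneg_left ?_ (by positivity)
    exact Real.rpow_le_rpow_of_nonpos hr0 (by linarith)
      (mul_nonpos_of_nonneg_of_nonpos (by positivity) hμ.le)
  have b2 : P.real (longEdge γ δ β X U (3 * 11 * r) r) ≤ l * C * r ^ ((d : ℝ) * μ) :=
    ENNReal.toReal_le_of_le_ofReal (by positivity) (hlong l P hl h r hr)
  have b3 : P.real (⋃ y ∈ t, highInterference β X (r • y) (3 * r) r) ≤
      N * (l * (ballVolume d * 3 ^ d) * r ^ ((d : ℝ) * μ)) := by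
    refine (measureReal_biUnion_finset_le _ _).trans ?_
    refine (Finset.sum_le_card_nsmul _ _ _ fun y _ =>
      h.measureReal_highInterference_le hl.le hβ hμβ (r • y) hr).trans (le_of_eq ?_)
    rw [nsmul_eq_mul]
  have b4 : P.real (⋃ y ∈ t, ⋃ z ∈ t, S y z) ≤ N * (N * g ^ 2) := by
    have hyz : ∀ y z, P.real (S y z) ≤ g ^ 2 := by
      intro y z
      by_cases hdist : 8 * r ≤ dist (r • y) (r • z)
      · have h1 : P.real (S y z) ≤
            P.real (localEvent γ δ β X U (r • y) r ∩ localEvent γ δ β X U (r • z) r) :=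
          measureReal_mono fun ω hω => hω.2
        refine h1.trans (le_of_eq ?_)
        rw [measureReal_def, h.measure_localEvent_inter (disjoint_localWindow hdist),
          h.measure_localEvent_eq, h.measure_localEvent_eq (r • z), ENNReal.toReal_mul, hg,
          measureReal_def, sq]
      · have : S y z = ∅ := eq_empty_of_forall_notMem fun ω hω => hdist hω.1
        rw [this, measureReal_empty]
        positivity
    refine (measureReal_biUnion_finset_le _ _).trans ?_
    refine (Finset.sum_le_card_nsmul _ _ (N * g ^ 2) fun y _ => ?_).trans (le_of_eq ?_)
    · refine (measureReal_biUnion_finset_le _ _).trans ?_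
      refine (Finset.sum_le_card_nsmul _ _ _ fun z _ => hyz y z).trans (le_of_eq ?_)
      rw [nsmul_eq_mul]
    · rw [nsmul_eq_mul]
  have hu := (measureReal_mono (μ := P) hsub).trans ((measureReal_union_le _ _).trans
    (add_le_add le_rfl ((measureReal_union_le _ _).trans
      (add_le_add le_rfl (measureReal_union_le _ _)))))
  nlinarith [sq_nonneg g]

/-- A crossing needs a vertex in the inner ball. This starts the induction at small intensity. -/
theorem IsSample.measureReal_localEvent_le [NeZero d] (h : IsSample d l P X U) (hl : 0 ≤ l)
    {r : ℝ} (hr : 0 ≤ r) :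
    P.real (localEvent γ δ β X U 0 r) ≤ l * (ballVolume d * r ^ d) := by
  have hκ := ballVolume_pos d
  refine ENNReal.toReal_le_of_le_ofReal (by positivity) ?_
  refine (measure_mono_ae ?_).trans
    ((measure_lowMark_le h.vertices hl 0 (a := 1) hr).trans (by rw [mul_one]))
  filter_upwards [ae_mark_mem h.vertices] with ω hω
  rintro ⟨i, j, hi, -⟩
  exact ⟨i, hi, (hω i).2⟩

end Recursion

/-! ### Arithmetic of the long edge exponent. -/

section Exponents

variable {γ δ β : ℝ}

theorem longEdgeExponent_neg (hδ : 2 < δ) (hγδ : γ < (δ + β - 1) / δ) :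
    longEdgeExponent γ δ β < 0 := by
  rw [lt_div_iff₀ (by linarith)] at hγδ
  unfold longEdgeExponent
  split_ifs with h
  · exact max_lt (by linarith) (div_neg_of_neg_of_pos (by linarith) (by linarith))
  · linarith

theorem two_sub_lt_of_longEdgeExponent_lt {μ : ℝ} (h : longEdgeExponent γ δ β < μ) :
    2 - δ < μ := by
  unfold longEdgeExponent at h
  split_ifs at h
  · exact (le_max_left _ _).trans_lt h
  · exact h

/-- For `γδ > β` the inequality is `μ` exceeding the second term of the exponent, multiplied out.
For `γδ ≤ β` the left side is at most `2 - δ - (1 - μ) = μ - (δ - 1)`. -/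
theorem exponent_lt_of_longEdgeExponent_lt {μ : ℝ} (hδ : 1 < δ) (hμ : μ < 0)
    (h : longEdgeExponent γ δ β < μ) : 2 - δ + (1 - μ) * (γ * δ - β - 1) < μ := by
  by_cases hs : β < γ * δ
  · rw [longEdgeExponent, if_pos hs] at h
    have h1 := (le_max_right _ _).trans_lt h
    rw [div_lt_iff₀ (by linarith)] at h1
    nlinarith
  · nlinarith

end Exponents

/-! ### Decay of crossings and positivity of the critical intensity. -/

section Subcritical

variable {d : ℕ} {γ δ β : ℝ} {Ω : Type*} [MeasurableSpace Ω] {X : ℕ → Ω → Vertex d}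
  {U : Sym2 ℕ → Ω → ℝ}

theorem IsSample.measureReal_crossing_le [NeZero d] {l : ℝ} {P : Measure Ω}
    (h : IsSample d l P X U) (hl : 0 < l) (hβ : 0 ≤ β) {μ C r : ℝ} (hμβ : β * (1 - μ) ≤ 1)
    (hC : 0 ≤ C) (hlong : P (longEdge γ δ β X U (2 * r) r) ≤
      ENNReal.ofReal (l * C * r ^ ((d : ℝ) * μ))) (hr : 1 ≤ r) :
    P.real (crossing d γ δ β X U r) ≤ P.real (localEvent γ δ β X U 0 r) +
      l * (ballVolume d * 3 ^ d + C) * r ^ ((d : ℝ) * μ) := by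
  have := h.vertices.isProbabilityMeasure
  have hr0 : 0 < r := one_pos.trans_le hr
  have h1 : P.real (longEdge γ δ β X U (2 * r) r) ≤ l * C * r ^ ((d : ℝ) * μ) :=
    ENNReal.toReal_le_of_le_ofReal (by positivity) hlong
  have h2 := h.measureReal_highInterference_le hl.le hβ hμβ 0 hr
  have h3 := (measureReal_mono (μ := P) ((crossing_subset r).trans
    (union_subset_union_left _ (localCrossing_subset_union (γ := γ) (δ := δ) (β := β) (X := X)
      (U := U) hr0.le)))).trans ((measureReal_union_le _ _).trans
        (add_le_add (measureReal_union_le _ _) le_rfl))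
  linarith

/-- The exponents `μ` for which long edges and large spheres of interference at scale `r` have
probability of order at most `r ^ (d μ)`. -/
structure IsDecayExponent (γ δ β μ : ℝ) : Prop where
  neg : μ < 0
  two_sub_lt : 2 - δ < μ
  lt : 2 - δ + (1 - μ) * (γ * δ - β - 1) < μ
  mul_le : β * (1 - μ) ≤ 1

theorem IsDecayExponent.tendsto_rpow [NeZero d] {μ : ℝ} (hμ : IsDecayExponent γ δ β μ) :
    Tendsto (fun r : ℝ => r ^ ((d : ℝ) * μ)) atTop (𝓝 0) := by
  have hd : (0 : ℝ) < d := by exact_mod_cast Nat.pos_of_ne_zero (NeZero.ne d)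
  have := tendsto_rpow_neg_atTop (mul_pos hd (neg_pos.2 hμ.neg))
  simpa using this

theorem exists_measureReal_crossing_le [NeZero d] (hγδ : 0 ≤ γ * δ) (hδ : 0 ≤ δ) (hβ : 0 ≤ β)
    {μ : ℝ} (hμ : IsDecayExponent γ δ β μ) :
    ∃ C, 0 < C ∧ ∀ (l : ℝ) (P : Measure Ω), 0 < l → IsSample d l P X U → ∀ r : ℝ, 1 ≤ r →
      P.real (crossing d γ δ β X U r) ≤ P.real (localEvent γ δ β X U 0 r) +
        l * C * r ^ ((d : ℝ) * μ) := by
  have hκ := ballVolume_pos d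
  obtain ⟨C, hC, hlong⟩ := exists_measure_longEdge_le (X := X) (U := U) hγδ hδ hβ hμ.neg
    hμ.two_sub_lt hμ.lt hμ.mul_le (M := 2) (by norm_num)
  exact ⟨ballVolume d * 3 ^ d + C, by positivity, fun l P hl h r hr =>
    h.measureReal_crossing_le hl hβ hμ.mul_le hC.le (hlong l P hl h r hr) hr⟩

/-- Once `A g` is at most half of `11 ^ (dμ)`, the quadratic recursion is a linear contraction
faster than the decay rate of its error, so `g` inherits that rate. -/
theorem exists_crossing_decay [NeZero d] (hγδ : 0 ≤ γ * δ) (hδ : 0 ≤ δ) (hβ : 0 ≤ β)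
    {μ : ℝ} (hμ : IsDecayExponent γ δ β μ) {l : ℝ} {P : Measure Ω} (hl : 0 < l)
    (h : IsSample d l P X U) {A c r₀ : ℝ}
    (hrec : ∀ r, 1 ≤ r → P.real (localEvent γ δ β X U 0 (11 * r)) ≤
      A * P.real (localEvent γ δ β X U 0 r) ^ 2 + c * r ^ ((d : ℝ) * μ)) (hr₀ : 1 ≤ r₀)
    (hsmall : ∀ r, r₀ ≤ r → A * P.real (localEvent γ δ β X U 0 r) ≤ 11 ^ ((d : ℝ) * μ) / 2) :
    ∃ C, 0 < C ∧ ∀ᶠ r in atTop, P (crossing d γ δ β X U r) ≤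
      ENNReal.ofReal (C * r ^ ((d : ℝ) * μ)) := by
  have := h.vertices.isProbabilityMeasure
  have hd : (0 : ℝ) < d := by exact_mod_cast Nat.pos_of_ne_zero (NeZero.ne d)
  have hneg : -((d : ℝ) * -μ) = d * μ := by ring
  obtain ⟨C, hC, hg⟩ := exists_le_rpow_of_recursion (K := 11) (a := d * -μ) (c := c) (r₀ := r₀)
    (g := fun r => P.real (localEvent γ δ β X U 0 r)) (by norm_num)
    (mul_pos hd (neg_pos.2 hμ.neg)) (by linarith) (fun r => measureReal_le_one) (by
      intro r hr
      rw [hneg]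
      refine (hrec r (hr₀.trans hr)).trans ?_
      have := mul_le_mul_of_nonneg_right (hsmall r hr)
        (measureReal_nonneg (μ := P) (s := localEvent γ δ β X U 0 r))
      linarith)
  obtain ⟨C', hC', hcr⟩ := exists_measureReal_crossing_le (X := X) (U := U) hγδ hδ hβ hμ
  refine ⟨C + l * C', by positivity, ?_⟩
  filter_upwards [eventually_ge_atTop r₀] with r hr
  have hr1 := hr₀.trans hr
  have h1 := hg r hr
  rw [hneg] at h1
  have h2 := hcr l P hl h r hr1
  rw [← ENNReal.ofReal_toReal (measure_ne_top P (crossing d γ δ β X U r))]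
  refine ENNReal.ofReal_le_ofReal ?_
  rw [measureReal_def] at h2
  linarith

/-- Convergence to zero without any rate suffices: it makes the local event small beyond some scale,
and the recursion supplies the polynomial rate. -/
theorem exists_crossing_decay_of_tendsto [NeZero d] (hγδ : 0 ≤ γ * δ) (hδ : 0 ≤ δ) (hβ : 0 ≤ β)
    {μ : ℝ} (hμ : IsDecayExponent γ δ β μ) {l : ℝ} {P : Measure Ω} (hl : 0 < l)
    (h : IsSample d l P X U)
    (ht : Tendsto (fun r => P (crossing d γ δ β X U r)) atTop (𝓝 0)) :
    ∃ C, 0 < C ∧ ∀ᶠ r in atTop, P (crossing d γ δ β X U r) ≤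
      ENNReal.ofReal (C * r ^ ((d : ℝ) * μ)) := by
  have := h.vertices.isProbabilityMeasure
  obtain ⟨A, C, hA, hC, hrec⟩ := exists_localEvent_recursion (X := X) (U := U) hγδ hδ hβ hμ.neg
    hμ.two_sub_lt hμ.lt hμ.mul_le
  have ht' : Tendsto (fun r => P.real (crossing d γ δ β X U r)) atTop (𝓝 0) := by
    exact (ENNReal.tendsto_toReal ENNReal.zero_ne_top).comp ht
  have hle : ∀ᶠ r : ℝ in atTop, P.real (localEvent γ δ β X U 0 r) ≤
      P.real (crossing d γ δ β X U r) + l * (ballVolume d * 3 ^ d) * r ^ ((d : ℝ) * μ) := by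
    filter_upwards [eventually_ge_atTop 1] with r hr
    refine (measureReal_mono (localEvent_subset_union (by linarith))).trans
      ((measureReal_union_le _ _).trans (add_le_add
        (measureReal_mono (localCrossing_subset_crossing r)) ?_))
    exact h.measureReal_highInterference_le hl.le hβ hμ.mul_le 0 hr
  have hg : Tendsto (fun r => A * P.real (localEvent γ δ β X U 0 r)) atTop (𝓝 0) := by
    have h1 := ht'.add ((hμ.tendsto_rpow (d := d)).const_mul (l * (ballVolume d * 3 ^ d)))
    rw [mul_zero, add_zero] at h1
    simpa using (squeeze_zero' (Eventually.of_forall fun r => measureReal_nonneg) hle h1).const_mul A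
  obtain ⟨r₀, hr₀⟩ := eventually_atTop.1 ((hg.eventually_le_const
    (by positivity : (0 : ℝ) < 11 ^ ((d : ℝ) * μ) / 2)).and (eventually_ge_atTop 1))
  exact exists_crossing_decay hγδ hδ hβ hμ hl h (hrec l P hl h) (hr₀ r₀ le_rfl).2
    fun r hr => (hr₀ r hr).1

theorem exists_intensity_tendsto_crossing [NeZero d] (hγδ : 0 ≤ γ * δ) (hδ : 0 ≤ δ) (hβ : 0 ≤ β)
    {μ : ℝ} (hμ : IsDecayExponent γ δ β μ) :
    ∃ l₀ : ℝ, 0 < l₀ ∧ ∀ (l : ℝ) (P : Measure Ω), 0 < l → l ≤ l₀ → IsSample d l P X U →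
      Tendsto (fun r => P (crossing d γ δ β X U r)) atTop (𝓝 0) := by
  have hκ := ballVolume_pos d
  have hd : (0 : ℝ) < d := by exact_mod_cast Nat.pos_of_ne_zero (NeZero.ne d)
  obtain ⟨A, C, hA, hC, hrec⟩ := exists_localEvent_recursion (X := X) (U := U) hγδ hδ hβ hμ.neg
    hμ.two_sub_lt hμ.lt hμ.mul_le
  have hq : 0 < (11 : ℝ) ^ ((d : ℝ) * μ) := by positivity
  have hq1 : (11 : ℝ) ^ ((d : ℝ) * μ) ≤ 1 :=
    Real.rpow_le_one_of_one_le_of_nonpos (by norm_num)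
      (mul_nonpos_of_nonneg_of_nonpos hd.le hμ.neg.le)
  set η : ℝ := 11 ^ ((d : ℝ) * μ) / 2 / A with hηdef
  have hη : 0 < η := by positivity
  have hAη : A * η = 11 ^ ((d : ℝ) * μ) / 2 := by rw [hηdef]; field_simp
  -- The first bound makes `g ≤ η` on the base scales `[1, 11]`, the second makes the error at most
  -- `η / 2`.
  refine ⟨min (η / (ballVolume d * 11 ^ d)) (η / 2 / C), by positivity, fun l P hl hll h => ?_⟩
  have hl1 : l * (ballVolume d * 11 ^ d) ≤ η := by
    rw [← le_div_iff₀ (by positivity)]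
    exact hll.trans (min_le_left _ _)
  have hl2 : l * C ≤ η / 2 := by
    rw [← le_div_iff₀ (by positivity)]
    exact hll.trans (min_le_right _ _)
  have hsmall : ∀ r, 1 ≤ r → P.real (localEvent γ δ β X U 0 r) ≤ η := by
    refine le_of_quadratic_recursion (K := 11) (A := A) (c := l * C) (by norm_num)
      (fun r => measureReal_nonneg) hA.le (by rw [hAη]; linarith) hl2 hη.le ?_ ?_
    · intro r hr hr'
      refine (h.measureReal_localEvent_le hl.le (by linarith)).trans (le_trans ?_ hl1)
      gcongr
    · intro r hr
      refine (hrec l P hl h r hr).trans (add_le_add le_rfl ?_)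
      exact mul_le_of_le_one_right (by positivity) (Real.rpow_le_one_of_one_le_of_nonpos hr
        (mul_nonpos_of_nonneg_of_nonpos hd.le hμ.neg.le))
  obtain ⟨C', -, hC'⟩ := exists_crossing_decay hγδ hδ hβ hμ hl h (hrec l P hl h) le_rfl
    fun r hr => by
      rw [← hAη]
      exact mul_le_mul_of_nonneg_left (hsmall r hr) hA.le
  refine tendsto_of_tendsto_of_tendsto_of_le_of_le' tendsto_const_nhds ?_
    (Eventually.of_forall fun r => zero_le) hC'
  have := ENNReal.tendsto_ofReal ((hμ.tendsto_rpow (d := d)).const_mul C')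
  simpa using this

/-- Interference destroys the obvious monotonicity in the intensity, and none is used: crossings
vanish for every intensity up to `l₀`. -/
theorem critIntensity_pos [NeZero d] (hγδ : 0 ≤ γ * δ) (hδ : 0 ≤ δ) (hβ : 0 ≤ β)
    {μ : ℝ} (hμ : IsDecayExponent γ δ β μ) {P : ℝ → Measure Ω}
    (h : ∀ l : ℝ, 0 < l → IsSample d l (P l) X U) :
    0 < critIntensity d γ δ β X U P := by
  obtain ⟨l₀, hl₀, hsub⟩ := exists_intensity_tendsto_crossing (X := X) (U := U) hγδ hδ hβ hμ
  refine (ENNReal.ofReal_pos.2 hl₀).trans_le (le_sInf ?_)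
  rintro _ ⟨l, hl, rfl, hpos⟩
  refine ENNReal.ofReal_le_ofReal ?_
  by_contra! hcon
  rw [(hsub l (P l) hl hcon.le (h l hl)).limsup_eq] at hpos
  exact lt_irrefl _ hpos

theorem tendsto_crossing_of_lt_critIntensity {P : ℝ → Measure Ω} {l : ℝ} (hl : 0 < l)
    (hlt : ENNReal.ofReal l < critIntensity d γ δ β X U P) :
    Tendsto (fun r => P l (crossing d γ δ β X U r)) atTop (𝓝 0) := by
  have h0 : limsup (fun r => P l (crossing d γ δ β X U r)) atTop ≤ 0 := by
    by_contra! hcon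
    exact absurd hlt (not_lt.2 (sInf_le ⟨l, hl, rfl, hcon⟩))
  exact tendsto_of_le_liminf_of_limsup_le zero_le h0

theorem IsSample.limsup_log_crossing_le [NeZero d] (hγδ : 0 ≤ γ * δ) (hδ : 1 < δ)
    (hβ : β ∈ Ico (0 : ℝ) 1) {l : ℝ} {P : Measure Ω} (hl : 0 < l) (h : IsSample d l P X U)
    (ht : Tendsto (fun r => P (crossing d γ δ β X U r)) atTop (𝓝 0)) {m : ℝ} (hm : m < 0)
    (hdecay : ∀ μ, m < μ → μ < 0 → IsDecayExponent γ δ β μ) :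
    limsup (fun r : ℝ => ENNReal.log (P (crossing d γ δ β X U r)) / ((Real.log r : ℝ) : EReal))
      atTop ≤ (((d : ℝ) * m : ℝ) : EReal) := by
  have hd : (0 : ℝ) < d := by exact_mod_cast Nat.pos_of_ne_zero (NeZero.ne d)
  refine le_of_forall_gt_imp_ge_of_dense fun a ha => ?_
  obtain ⟨q, hq1, hq2⟩ := EReal.lt_iff_exists_real_btwn.1 ha
  rw [EReal.coe_lt_coe_iff] at hq1
  -- The first entry gives `d μ ≤ q`; the second keeps `μ` negative, and both exceed `m`.
  set μ : ℝ := min (q / d) (m / 2)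
  have hmμ : m < μ := lt_min (by rwa [lt_div_iff₀ hd, mul_comm]) (by linarith)
  have hμ0 : μ < 0 := (min_le_right _ _).trans_lt (by linarith)
  have hμq : (d : ℝ) * μ ≤ q := by
    have := min_le_left (q / d) (m / 2)
    rw [le_div_iff₀ hd] at this
    linarith
  obtain ⟨C, hC, hev⟩ := exists_crossing_decay_of_tendsto hγδ (by linarith) hβ.1
    (hdecay μ hmμ hμ0) hl h ht
  have := limsup_log_le_of_eventually_le hC one_pos hev
  simp only [one_mul, div_one] at this
  exact this.trans ((EReal.coe_le_coe_iff.2 hμq).trans hq2.le)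

end Subcritical

/-! ### Assembling the exponents. -/

section Main

variable {d : ℕ} {γ δ β : ℝ}

theorem isDecayExponent_of_lt (hδ : 1 < δ) {μ : ℝ} (hμ0 : μ < 0)
    (hμ : longEdgeExponent γ δ β < μ) (hμβ : β * (1 - μ) ≤ 1) : IsDecayExponent γ δ β μ :=
  ⟨hμ0, two_sub_lt_of_longEdgeExponent_lt hμ, exponent_lt_of_longEdgeExponent_lt hδ hμ0 hμ, hμβ⟩

/-- For `β > 0` the condition `β (1 - μ) ≤ 1` reads `μ ≥ 1 - 1/β`, so the threshold is the maximum
of the two exponents; for `β = 0` the condition is void. -/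
theorem exists_decay_threshold [NeZero d] (hδ : 1 < δ) (hβ : β ∈ Ico (0 : ℝ) 1)
    (hZ : longEdgeExponent γ δ β < 0) :
    ∃ m < 0, (∀ μ, m < μ → μ < 0 → IsDecayExponent γ δ β μ) ∧
      (((d : ℝ) * m : ℝ) : EReal) ≤
        max (((d : ℝ) * longEdgeExponent γ δ β : ℝ) : EReal) (mixingExponent d β) := by
  have hd : (0 : ℝ) < d := by exact_mod_cast Nat.pos_of_ne_zero (NeZero.ne d)
  by_cases h0 : β = 0
  · refine ⟨_, hZ, fun μ h1 h2 => isDecayExponent_of_lt hδ h2 h1 (by rw [h0]; simp),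
      le_max_left _ _⟩
  · have hβ0 : 0 < β := lt_of_le_of_ne hβ.1 (Ne.symm h0)
    have h1 : 1 - 1 / β < 0 := by
      have : 1 < 1 / β := by rw [lt_div_iff₀ hβ0]; linarith [hβ.2]
      linarith
    refine ⟨max (longEdgeExponent γ δ β) (1 - 1 / β), max_lt hZ h1, fun μ hμ hμ0 =>
      isDecayExponent_of_lt hδ hμ0 ((le_max_left _ _).trans_lt hμ) ?_, ?_⟩
    · have h2 : 1 - μ ≤ 1 / β := by linarith [(le_max_right _ _).trans_lt hμ]
      rw [le_div_iff₀ hβ0] at h2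
      linarith
    · rw [mixingExponent, if_neg h0]
      rcases max_choice (longEdgeExponent γ δ β) (1 - 1 / β) with h | h <;> rw [h]
      · exact le_max_left _ _
      · exact le_max_right _ _

end Main

end SoftBoolean

end

theorem corollary2p5 {Ω : Type*} [MeasurableSpace Ω] (d : ℕ) [NeZero d] (γ δ β : ℝ)
    (hγ : γ ∈ Set.Ioo (0 : ℝ) 1) (hδ : 1 < δ) (hβ : β ∈ Set.Ico (0 : ℝ) 1)
    (P : ℝ → MeasureTheory.Measure Ω) (X : ℕ → Ω → SoftBoolean.Vertex d) (U : Sym2 ℕ → Ω → ℝ)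
    (h : ∀ l : ℝ, 0 < l → SoftBoolean.IsSample d l (P l) X U) :
    -- polynomial mixing
    (∀ l : ℝ, 0 < l → SoftBoolean.PolynomiallyMixing d γ δ β X U (P l)
      (SoftBoolean.mixingExponent d β)) ∧
    -- the annealed connection probability depends on the locations only through their distance
    (∀ l : ℝ, 0 < l → ∀ x y : EuclideanSpace ℝ (Fin d), x ≠ y →
      ∀ u ∈ Set.Ioo (0 : ℝ) 1, ∀ v ∈ Set.Ioo (0 : ℝ) 1,
      ∫⁻ ω, SoftBoolean.connProb d γ δ β (x, u) (y, v) (SoftBoolean.config d X ω) ∂(P l) =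
        SoftBoolean.annealed d γ δ β X (P l) u v (‖x - y‖ ^ d)) ∧
    -- the value of the coefficient
    (∀ l : ℝ, 0 < l →
      (β ≤ γ ∨ γ * δ ≤ 1 + β →
        SoftBoolean.zetaBar d γ δ β X P l = (SoftBoolean.longEdgeExponent γ δ β : EReal)) ∧
      (γ < β → 1 + β < γ * δ →
        SoftBoolean.zetaBar d γ δ β X P l = ((2 - (1 + β) / γ : ℝ) : EReal))) ∧
    -- absence of long edges, positivity of the critical intensity, and decay below it
    (2 < δ → γ < (δ + β - 1) / δ →
      (∀ l : ℝ, 0 < l → SoftBoolean.zetaBar d γ δ β X P l < 0) ∧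
      0 < SoftBoolean.critIntensity d γ δ β X U P ∧
      ∀ l : ℝ, 0 < l → ENNReal.ofReal l < SoftBoolean.critIntensity d γ δ β X U P →
        Filter.limsup (fun r : ℝ =>
          ENNReal.log (P l (SoftBoolean.crossing d γ δ β X U r)) / ((Real.log r : ℝ) : EReal))
          Filter.atTop ≤
          max (((d : ℝ) * SoftBoolean.longEdgeExponent γ δ β : ℝ) : EReal)
            (SoftBoolean.mixingExponent d β)) := by
  have hγ0 : 0 < γ := hγ.1
  have hδ0 : 0 < δ := by linarith
  have hγδ : 0 ≤ γ * δ := by positivity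
  have hzeta : ∀ l : ℝ, 0 < l →
      (β ≤ γ ∨ γ * δ ≤ 1 + β →
        SoftBoolean.zetaBar d γ δ β X P l = (SoftBoolean.longEdgeExponent γ δ β : EReal)) ∧
      (γ < β → 1 + β < γ * δ →
        SoftBoolean.zetaBar d γ δ β X P l = ((2 - (1 + β) / γ : ℝ) : EReal)) := fun l hl =>
    ⟨fun hc => SoftBoolean.zetaBar_eq hl fun l' hl' =>
        SoftBoolean.zeta_eq_longEdgeExponent (h l' hl').vertices hl' hγ hδ hβ hc,
      fun h1 h2 => SoftBoolean.zetaBar_eq hl fun l' hl' =>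
        SoftBoolean.zeta_eq_of_lt (h l' hl').vertices hl' hγ hδ hβ h1 h2⟩
  refine ⟨fun l hl => (h l hl).polynomiallyMixing hl hβ, fun l hl x y _ u hu v hv =>
    SoftBoolean.lintegral_connProb_eq_annealed (h l hl).vertices hl x y hu.1 hv.1, hzeta,
    fun hδ2 hγ2 => ?_⟩
  have hZ : SoftBoolean.longEdgeExponent γ δ β < 0 := SoftBoolean.longEdgeExponent_neg hδ2 hγ2
  obtain ⟨m, hm, hdecay, hmle⟩ := SoftBoolean.exists_decay_threshold (d := d) hδ hβ hZ
  refine ⟨fun l hl => ?_, SoftBoolean.critIntensity_pos hγδ hδ0.le hβ.1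
    (hdecay (m / 2) (by linarith) (by linarith)) h, fun l hl hlt => ?_⟩
  · by_cases hc : β ≤ γ ∨ γ * δ ≤ 1 + β
    · rw [(hzeta l hl).1 hc]
      exact_mod_cast hZ
    · rw [not_or, not_le, not_le] at hc
      rw [(hzeta l hl).2 hc.1 hc.2]
      -- In this regime `γ < β` and `γ < 1`, hence `2 γ < 1 + β`.
      have : 2 < (1 + β) / γ := by
        rw [lt_div_iff₀ hγ0]
        linarith [hγ.2, hc.1]
      exact_mod_cast (by linarith : 2 - (1 + β) / γ < 0)
  · exact ((h l hl).limsup_log_crossing_le hγδ hδ hβ hl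
      (SoftBoolean.tendsto_crossing_of_lt_critIntensity hl hlt) hm hdecay).trans hmle
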